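/- Let $\mathbb{G}$ be a finite quantum group, i.e. let $A=C(\mathbb{G})$ be a finite-dimensional C*-algebra which is a Hopf $*$-algebra, with coproduct $\Delta_A$, counit $\varepsilon$, antipode $S$, Haar state $h$ and Haar element $\eta$ (so $\varepsilon(\eta)=1$ and $a\eta=\varepsilon(a)\eta$ for all $a$). Equip $A$ with the convolution product $a\star b=(h\otimes\mathrm{id})\bigl(((S\otimes\mathrm{id})\Delta_A(b))(a\otimes 1)\bigr)$ and the convolution adjoint $a^\bullet=S(a^*)$. For a unital C*-algebra $B$, a unital $*$-homomorphism $\alpha\colon A\to A\otimes B$ represents a quantum family of automorphisms of $\mathbb{G}$ if (i) $\alpha(A)(1\otimes B)$ spans $A\otimes B$ (Podleś condition); (ii) $\alpha$ is multiplicative from $(A,\star)$ to $(A,\star)\otimes B$; (iii) $(\bullet\otimes *)\circ\alpha=\alpha\circ\bullet$; (iv) $\alpha(\eta)=\eta\otimes 1$. Let $\mathrm{QAUT}(\mathbb{G})$ be the category whose objects are such pairs $(B,\alpha)$, a morphism $(B,\alpha)\to(B',\alpha')$ being a unital $*$-homomorphism $\Lambda\colon B'\to B$ with $\alpha=(\mathrm{id}\otimes\Lambda)\circ\alpha'$.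 A compact quantum group structure on a nonzero unital C*-algebra $B$ is a coassociative unital $*$-homomorphism $\Delta\colon B\to B\otimes B$ (spatial tensor product) such that $\Delta(B)(1\otimes B)$ and $(B\otimes 1)\Delta(B)$ have dense linear spans in $B\otimes B$. An action of it on $A$ is a unital $*$-homomorphism $\alpha\colon A\to A\otimes B$ that satisfies (i) and $(\mathrm{id}\otimes\Delta)\circ\alpha=(\alpha\otimes\mathrm{id})\circ\alpha$. Wang's quantum automorphism group of $(A,h)$ is the final object $(C(\mathbb{K}),\Delta_{\mathbb{K}},\beta)$ of the category of compact quantum groups with an action on $A$ that preserves $h$, i.e. $(h\otimes\mathrm{id})\beta(a)=h(a)1$ for all $a\in A$; morphisms in this category are $*$-homomorphisms of the algebras of functions, with arrows reversed, that intertwine the coproducts and the actions. Theorem. The category $\mathrm{QAUT}(\mathbb{G})$ has a final object $(B_u,\alpha_u)$, unique up to isomorphism. There is exactly one compact quantum group structure $\Delta$ on $B_u$ for which $\alpha_u$ is an action of the resulting compact quantum group, denoted $\mathrm{qAut}(\mathbb{G})$, on $A$. Moreover Wang's quantum automorphism group $\mathbb{K}$ of $(A,h)$ exists, and $\mathrm{qAut}(\mathbb{G})$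 is a quantum subgroup of it: there is a surjective unital $*$-homomorphism $\pi\colon C(\mathbb{K})\to B_u$ with $(\pi\otimes\pi)\circ\Delta_{\mathbb{K}}=\Delta\circ\pi$ and $(\mathrm{id}\otimes\pi)\circ\beta=\alpha_u$. -/

import Mathlib

open scoped TensorProduct

universe u v

noncomputable section

/-! ### Completing a star-algebra with respect to a C*-seminorm -/

/-- A C*-seminorm on a complex unital star-algebra `D`. -/
structure CStarSeminorm (D : Type u) [Ring D] [StarRing D] [Algebra ℂ D] where
  toFun : D → ℝ
  map_zero' : toFun 0 = 0
  add_le' : ∀ x y, toFun (x + y) ≤ toFun x + toFun y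
  neg' : ∀ x, toFun (-x) = toFun x
  smul' : ∀ (c : ℂ) x, toFun (c • x) = ‖c‖ * toFun x
  mul_le' : ∀ x y, toFun (x * y) ≤ toFun x * toFun y
  star_mul_self' : ∀ x, toFun (star x * x) = toFun x * toFun x
  star' : ∀ x, toFun (star x) = toFun x

namespace CStarSeminorm

variable {D : Type u} [Ring D] [StarRing D] [Algebra ℂ D]

/-- The algebra `D`, seminormed by `p`. -/
def Space (_p : CStarSeminorm D) : Type u := D

variable (p : CStarSeminorm D)

instance : Ring p.Space := inferInstanceAs (Ring D)
instance : StarRing p.Space := inferInstanceAs (StarRing D)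
instance : Algebra ℂ p.Space := inferInstanceAs (Algebra ℂ D)
instance [StarModule ℂ D] : StarModule ℂ p.Space := inferInstanceAs (StarModule ℂ D)

instance : SeminormedAddCommGroup p.Space :=
  AddGroupSeminorm.toSeminormedAddCommGroup
    { toFun := p.toFun, map_zero' := p.map_zero', add_le' := p.add_le', neg' := p.neg' }

theorem norm_def (x : p.Space) : ‖x‖ = p.toFun x := rfl

instance : SeminormedRing p.Space :=
  { (inferInstance : Ring p.Space), (inferInstance : SeminormedAddCommGroup p.Space) with
    norm_mul_le := p.mul_le' }

instance : NormedAlgebra ℂ p.Space where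
  norm_smul_le c x := (p.smul' c x).le

instance : NormedStarGroup p.Space where
  norm_star_le x := (p.star' x).le

/-- The separation and completion of `D` with respect to `p`. -/
abbrev PreCompletion : Type u := UniformSpace.Completion p.Space

/-- The extension of the star operation to the completion. -/
def starFun : p.PreCompletion → p.PreCompletion := UniformSpace.Completion.map star

theorem continuous_starFun : Continuous p.starFun :=
  UniformSpace.Completion.continuous_map

theorem coe_starFun (x : p.Space) : (↑(star x) : p.PreCompletion) = p.starFun (x : p.PreCompletion) :=
  (UniformSpace.Completion.map_coe star_isometry.uniformContinuous x).symm

theorem continuous_of_le {E : Type v} [CStarAlgebra E] (F : D →⋆ₐ[ℂ] E)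
    (hF : ∀ x, ‖F x‖ ≤ p.toFun x) : Continuous (show p.Space →+* E from (F : D →+* E)) :=
  AddMonoidHomClass.continuous_of_bound _ 1 (fun x => by rw [one_mul]; exact hF x)

open UniformSpace.Completion in
instance [StarModule ℂ D] : CStarAlgebra p.PreCompletion where
  star := p.starFun
  star_involutive x := by
    induction x using induction_on with
    | hp =>
      exact isClosed_eq (p.continuous_starFun.comp p.continuous_starFun)
        continuous_id
    | ih x =>
      rw [← coe_starFun, ← coe_starFun, star_star]
  star_mul x y := by
    induction x, y using induction_on₂ with
    | hp =>
      exact isClosed_eq (p.continuous_starFun.comp continuous_mul)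
        ((p.continuous_starFun.comp continuous_snd).mul
          (p.continuous_starFun.comp continuous_fst))
    | ih x y =>
      change p.starFun _ = p.starFun _ * p.starFun _
      rw [← coe_mul, ← coe_starFun, ← coe_starFun, ← coe_starFun, star_mul, coe_mul]
  star_add x y := by
    induction x, y using induction_on₂ with
    | hp =>
      exact isClosed_eq (p.continuous_starFun.comp continuous_add)
        ((p.continuous_starFun.comp continuous_fst).add
          (p.continuous_starFun.comp continuous_snd))
    | ih x y =>
      change p.starFun _ = p.starFun _ + p.starFun _
      rw [← coe_add, ← coe_starFun, ← coe_starFun, ← coe_starFun, star_add, coe_add]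
  norm_mul_self_le x := by
    induction x using induction_on with
    | hp =>
      exact isClosed_le (continuous_norm.mul continuous_norm)
        (continuous_norm.comp (p.continuous_starFun.mul continuous_id))
    | ih x =>
      change _ ≤ ‖p.starFun _ * _‖
      rw [← coe_starFun, ← coe_mul, norm_coe, norm_coe]
      exact (p.star_mul_self' x).ge
  norm_smul_le := norm_smul_le
  star_smul c x := by
    induction x using induction_on with
    | hp =>
      exact isClosed_eq (p.continuous_starFun.comp (continuous_const_smul c))
        ((continuous_const_smul (star c)).comp p.continuous_starFun)
    | ih x =>
      rw [← coe_smul, ← coe_starFun, ← coe_starFun, star_smul, coe_smul]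

variable [StarModule ℂ D]

theorem coe_star (x : p.Space) : (↑(star x) : p.PreCompletion) = star (x : p.PreCompletion) :=
  p.coe_starFun x

/-- The C*-algebra obtained from `D` by separation and completion with respect to `p`. -/
def Completion : Type u := p.PreCompletion

instance : CStarAlgebra p.Completion := inferInstanceAs (CStarAlgebra p.PreCompletion)

/-- The canonical map of `D` into its completion. -/
def incl : D →⋆ₐ[ℂ] p.Completion where
  toFun x := ((show p.Space from x) : p.PreCompletion)
  map_one' := rfl
  map_mul' x y := UniformSpace.Completion.coe_mul (α := p.Space) x y
  map_zero' := rfl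
  map_add' x y := UniformSpace.Completion.coe_add (α := p.Space) x y
  commutes' _ := rfl
  map_star' x := p.coe_star x

theorem norm_incl (x : D) : ‖p.incl x‖ = p.toFun x :=
  UniformSpace.Completion.norm_coe (E := p.Space) x

theorem denseRange_incl : DenseRange p.incl :=
  UniformSpace.Completion.denseRange_coe (α := p.Space)

open scoped CStarAlgebra in
/-- Two star-homomorphisms on the completion that agree on `D` are equal. -/
theorem hom_ext {E : Type v} [CStarAlgebra E] {F G : p.Completion →⋆ₐ[ℂ] E}
    (h : ∀ x, F (p.incl x) = G (p.incl x)) : F = G :=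
  DFunLike.coe_injective
    (p.denseRange_incl.equalizer (map_continuous F) (map_continuous G) (funext h))

/-- A unital star-homomorphism dominated by `p` extends to the completion. -/
def extend {E : Type v} [CStarAlgebra E] (F : D →⋆ₐ[ℂ] E) (hF : ∀ x, ‖F x‖ ≤ p.toFun x) :
    p.Completion →⋆ₐ[ℂ] E :=
  let f : p.PreCompletion →+* E :=
    UniformSpace.Completion.extensionHom _ (p.continuous_of_le F hF)
  have hf : Continuous (show p.Completion → E from f) :=
    UniformSpace.Completion.continuous_extension
  have hfx : ∀ x : D, f (p.incl x) = F x := fun x =>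
    UniformSpace.Completion.extensionHom_coe _ (p.continuous_of_le F hF) x
  { toFun := f
    map_one' := f.map_one
    map_mul' := f.map_mul
    map_zero' := f.map_zero
    map_add' := f.map_add
    commutes' := fun c => (hfx (algebraMap ℂ D c)).trans (F.toAlgHom.commutes c)
    map_star' := fun x => congrFun (p.denseRange_incl.equalizer (hf.comp continuous_star)
      (continuous_star.comp hf) (funext fun d =>
        (congrArg f (map_star p.incl d).symm).trans ((hfx (star d)).trans
          ((map_star F d).trans (congrArg star (hfx d).symm))))) x }

theorem extend_incl {E : Type v} [CStarAlgebra E] (F : D →⋆ₐ[ℂ] E)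
    (hF : ∀ x, ‖F x‖ ≤ p.toFun x) (x : D) : p.extend F hF (p.incl x) = F x :=
  UniformSpace.Completion.extensionHom_coe _ (p.continuous_of_le F hF) x

end CStarSeminorm

/-! ### The spatial (minimal) tensor product of C*-algebras -/

/-- A unital representation of a C*-algebra on a Hilbert space. -/
structure HilbertRep (A : Type u) [CStarAlgebra A] where
  space : Type u
  [normedAddCommGroup : NormedAddCommGroup space]
  [innerProductSpace : InnerProductSpace ℂ space]
  [completeSpace : CompleteSpace space]
  rep : A →⋆ₐ[ℂ] (space →L[ℂ] space)

attribute [instance] HilbertRep.normedAddCommGroup HilbertRep.innerProductSpace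
  HilbertRep.completeSpace

namespace HilbertRep

variable {A A' : Type u} [CStarAlgebra A] [CStarAlgebra A'] {B B' : Type v} [CStarAlgebra B]
  [CStarAlgebra B']

/-- The restriction of a representation along a unital star-homomorphism. -/
def comp (P : HilbertRep A') (f : A →⋆ₐ[ℂ] A') : HilbertRep A where
  space := P.space
  rep := P.rep.comp f

/-- The representation of the algebraic tensor product `A ⊗ B` on the tensor product of the two
Hilbert spaces, which sends `a ⊗ b` to `π(a) ⊗ ρ(b)`. Operators are regarded as bounded operators
on the algebraic tensor product with its pre-Hilbert norm; passing to the Hilbert space completion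
does not affect their norms. -/
def tensor (P : HilbertRep A) (Q : HilbertRep B) :
    A ⊗[ℂ] B →ₐ[ℂ] ((P.space ⊗[ℂ] Q.space) →L[ℂ] (P.space ⊗[ℂ] Q.space)) :=
  Algebra.TensorProduct.algHomOfLinearMapTensorProduct
    (TensorProduct.lift
      (LinearMap.mk₂ ℂ (fun a b => TensorProduct.mapL (P.rep a) (Q.rep b))
        (fun a a' b => by rw [map_add, TensorProduct.mapL_add_left])
        (fun c a b => by rw [map_smul, TensorProduct.mapL_smul_left])
        (fun a b b' => by rw [map_add, TensorProduct.mapL_add_right])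
        (fun c a b => by rw [map_smul, TensorProduct.mapL_smul_right])))
    (fun a a' b b' => by simp [TensorProduct.mapL_mul])
    (by simp [ContinuousLinearMap.one_def])

theorem tensor_tmul (P : HilbertRep A) (Q : HilbertRep B) (a : A) (b : B) :
    P.tensor Q (a ⊗ₜ b) = TensorProduct.mapL (P.rep a) (Q.rep b) := rfl

theorem inner_tensor_star (P : HilbertRep A) (Q : HilbertRep B) (x : A ⊗[ℂ] B)
    (v w : P.space ⊗[ℂ] Q.space) :
    inner ℂ (P.tensor Q (star x) v) w = inner ℂ v (P.tensor Q x w) := by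
  induction x with
  | zero => simp
  | add x y hx hy => simp [inner_add_left, inner_add_right, hx, hy]
  | tmul a b =>
    induction v with
    | zero => simp
    | add v v' hv hv' => simp only [map_add, inner_add_left, hv, hv']
    | tmul ξ η =>
      induction w with
      | zero => simp
      | add w w' hw hw' => simp only [map_add, inner_add_right, hw, hw']
      | tmul ξ' η' =>
        have h1 := ContinuousLinearMap.adjoint_inner_left (P.rep a) ξ' ξ
        have h2 := ContinuousLinearMap.adjoint_inner_left (Q.rep b) η' η
        rw [← ContinuousLinearMap.star_eq_adjoint, ← map_star] at h1 h2
        simp [tensor_tmul, h1, h2]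

theorem norm_tensor_mul_le (P : HilbertRep A) (Q : HilbertRep B) (x y : A ⊗[ℂ] B) :
    ‖P.tensor Q (x * y)‖ ≤ ‖P.tensor Q x‖ * ‖P.tensor Q y‖ := by
  rw [map_mul]
  exact ContinuousLinearMap.opNorm_comp_le _ _

theorem norm_tensor_mul_self_le (P : HilbertRep A) (Q : HilbertRep B) (x : A ⊗[ℂ] B) :
    ‖P.tensor Q x‖ * ‖P.tensor Q x‖ ≤ ‖P.tensor Q (star x * x)‖ := by
  have h : ‖P.tensor Q x‖ ≤ √‖P.tensor Q (star x * x)‖ := by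
    refine ContinuousLinearMap.opNorm_le_bound _ (Real.sqrt_nonneg _) fun v => ?_
    refine abs_le_of_sq_le_sq' ?_ (by positivity) |>.2
    rw [mul_pow, Real.sq_sqrt (ContinuousLinearMap.opNorm_nonneg _),
      ← inner_self_eq_norm_sq (𝕜 := ℂ), ← inner_tensor_star, pow_two, ← mul_assoc]
    have h1 := norm_inner_le_norm (𝕜 := ℂ) (P.tensor Q (star x) (P.tensor Q x v)) v
    have h2 : ‖P.tensor Q (star x) (P.tensor Q x v)‖ ≤ ‖P.tensor Q (star x * x)‖ * ‖v‖ := by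
      have := ContinuousLinearMap.le_opNorm (P.tensor Q (star x * x)) v
      rw [map_mul] at this ⊢
      exact this
    exact (Complex.re_le_norm _).trans
      (h1.trans (mul_le_mul_of_nonneg_right h2 (norm_nonneg _)))
  calc _ ≤ √‖P.tensor Q (star x * x)‖ * √‖P.tensor Q (star x * x)‖ :=
        mul_le_mul h h (ContinuousLinearMap.opNorm_nonneg _) (Real.sqrt_nonneg _)
    _ = _ := Real.mul_self_sqrt (ContinuousLinearMap.opNorm_nonneg _)

theorem norm_tensor_le_star (P : HilbertRep A) (Q : HilbertRep B) (x : A ⊗[ℂ] B) :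
    ‖P.tensor Q x‖ ≤ ‖P.tensor Q (star x)‖ := by
  have h := (P.norm_tensor_mul_self_le Q x).trans (P.norm_tensor_mul_le Q (star x) x)
  have h1 : 0 ≤ ‖P.tensor Q x‖ := ContinuousLinearMap.opNorm_nonneg _
  have h2 : 0 ≤ ‖P.tensor Q (star x)‖ := ContinuousLinearMap.opNorm_nonneg _
  by_contra! hlt
  nlinarith

theorem norm_tensor_star (P : HilbertRep A) (Q : HilbertRep B) (x : A ⊗[ℂ] B) :
    ‖P.tensor Q (star x)‖ = ‖P.tensor Q x‖ := by
  refine le_antisymm ?_ (P.norm_tensor_le_star Q x)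
  simpa using P.norm_tensor_le_star Q (star x)

theorem norm_tensor_star_mul_self (P : HilbertRep A) (Q : HilbertRep B) (x : A ⊗[ℂ] B) :
    ‖P.tensor Q (star x * x)‖ = ‖P.tensor Q x‖ * ‖P.tensor Q x‖ := by
  refine le_antisymm ?_ (P.norm_tensor_mul_self_le Q x)
  simpa only [norm_tensor_star] using P.norm_tensor_mul_le Q (star x) x

theorem exists_norm_tensor_le (x : A ⊗[ℂ] B) :
    ∃ C : ℝ, ∀ (P : HilbertRep A) (Q : HilbertRep B), ‖P.tensor Q x‖ ≤ C := by
  induction x with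
  | zero => exact ⟨0, fun P Q => by rw [map_zero]; exact ContinuousLinearMap.opNorm_zero.le⟩
  | add x y hx hy =>
    obtain ⟨C, hC⟩ := hx
    obtain ⟨C', hC'⟩ := hy
    refine ⟨C + C', fun P Q => ?_⟩
    rw [map_add]
    exact (ContinuousLinearMap.opNorm_add_le _ _).trans (add_le_add (hC P Q) (hC' P Q))
  | tmul a b =>
    refine ⟨‖a‖ * ‖b‖, fun P Q => ?_⟩
    rw [tensor_tmul]
    refine (TensorProduct.norm_mapL_le _ _).trans ?_
    exact mul_le_mul (NonUnitalStarAlgHom.norm_apply_le P.rep a)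
      (NonUnitalStarAlgHom.norm_apply_le Q.rep b) (norm_nonneg _) (norm_nonneg _)

theorem tensor_comp (P : HilbertRep A') (Q : HilbertRep B') (f : A →⋆ₐ[ℂ] A') (g : B →⋆ₐ[ℂ] B')
    (x : A ⊗[ℂ] B) :
    P.tensor Q (Algebra.TensorProduct.map (f : A →ₐ[ℂ] A') (g : B →ₐ[ℂ] B') x) =
      (P.comp f).tensor (Q.comp g) x := by
  induction x with
  | zero => simp only [map_zero]; rfl
  | add x y hx hy => rw [map_add, map_add, map_add, hx, hy]; rfl
  | tmul a b => rfl

end HilbertRep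

/-- The spatial norm on `A ⊗ B`: the supremum of `‖(π ⊗ ρ)(x)‖` over all pairs of unital
representations `π` of `A` and `ρ` of `B` on Hilbert spaces. -/
def spatialNorm {A : Type u} {B : Type v} [CStarAlgebra A] [CStarAlgebra B] (x : A ⊗[ℂ] B) : ℝ :=
  ⨆ PQ : HilbertRep A × HilbertRep B, ‖PQ.1.tensor PQ.2 x‖

section

variable {A A' : Type u} [CStarAlgebra A] [CStarAlgebra A'] {B B' : Type v} [CStarAlgebra B]
  [CStarAlgebra B']

theorem le_spatialNorm (x : A ⊗[ℂ] B) (P : HilbertRep A) (Q : HilbertRep B) :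
    ‖P.tensor Q x‖ ≤ spatialNorm x := by
  obtain ⟨C, hC⟩ := HilbertRep.exists_norm_tensor_le x
  refine le_ciSup (f := fun PQ : HilbertRep A × HilbertRep B => ‖PQ.1.tensor PQ.2 x‖) ?_ (P, Q)
  exact ⟨C, Set.forall_mem_range.2 fun PQ => hC PQ.1 PQ.2⟩

theorem spatialNorm_nonneg (x : A ⊗[ℂ] B) : 0 ≤ spatialNorm x :=
  Real.iSup_nonneg fun _ => ContinuousLinearMap.opNorm_nonneg _

theorem spatialNorm_smul_le (c : ℂ) (x : A ⊗[ℂ] B) :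
    spatialNorm (c • x) ≤ ‖c‖ * spatialNorm x := by
  refine Real.iSup_le (fun PQ => ?_) (mul_nonneg (norm_nonneg _) (spatialNorm_nonneg x))
  rw [map_smul]
  exact (ContinuousLinearMap.opNorm_smul_le _ _).trans
    (mul_le_mul_of_nonneg_left (le_spatialNorm x PQ.1 PQ.2) (norm_nonneg _))

theorem spatialNorm_map_le (f : A →⋆ₐ[ℂ] A') (g : B →⋆ₐ[ℂ] B') (x : A ⊗[ℂ] B) :
    spatialNorm (Algebra.TensorProduct.map (f : A →ₐ[ℂ] A') (g : B →ₐ[ℂ] B') x) ≤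
      spatialNorm x := by
  refine Real.iSup_le (fun PQ => ?_) (spatialNorm_nonneg x)
  rw [HilbertRep.tensor_comp]
  exact le_spatialNorm x (PQ.1.comp f) (PQ.2.comp g)

end

/-- The spatial norm is a C*-seminorm. -/
def spatialSeminorm (A : Type u) (B : Type v) [CStarAlgebra A] [CStarAlgebra B] :
    CStarSeminorm (A ⊗[ℂ] B) where
  toFun := spatialNorm
  map_zero' := by
    have : ∀ PQ : HilbertRep A × HilbertRep B, ‖PQ.1.tensor PQ.2 0‖ = 0 := fun PQ => by
      rw [map_zero]; exact ContinuousLinearMap.opNorm_zero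
    simp only [spatialNorm, this, Real.iSup_const_zero]
  add_le' x y := by
    refine Real.iSup_le (fun PQ => ?_) (add_nonneg (spatialNorm_nonneg x) (spatialNorm_nonneg y))
    rw [map_add]
    exact (ContinuousLinearMap.opNorm_add_le _ _).trans
      (add_le_add (le_spatialNorm x PQ.1 PQ.2) (le_spatialNorm y PQ.1 PQ.2))
  neg' x := by
    refine iSup_congr fun PQ => ?_
    rw [map_neg]
    exact ContinuousLinearMap.opNorm_neg _
  smul' c x := by
    refine le_antisymm (spatialNorm_smul_le c x) ?_
    rcases eq_or_ne c 0 with rfl | hc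
    · rw [norm_zero, zero_mul]; exact spatialNorm_nonneg _
    · have h := spatialNorm_smul_le c⁻¹ (c • x)
      rw [smul_smul, inv_mul_cancel₀ hc, one_smul, norm_inv] at h
      rwa [← le_inv_mul_iff₀ (norm_pos_iff.2 hc)]
  mul_le' x y := by
    refine Real.iSup_le (fun PQ => ?_) (mul_nonneg (spatialNorm_nonneg x) (spatialNorm_nonneg y))
    exact (PQ.1.norm_tensor_mul_le PQ.2 x y).trans
      (mul_le_mul (le_spatialNorm x PQ.1 PQ.2) (le_spatialNorm y PQ.1 PQ.2)
        (ContinuousLinearMap.opNorm_nonneg _) (spatialNorm_nonneg x))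
  star_mul_self' x := by
    refine le_antisymm ?_ ?_
    · refine Real.iSup_le (fun PQ => ?_) (mul_nonneg (spatialNorm_nonneg x) (spatialNorm_nonneg x))
      rw [PQ.1.norm_tensor_star_mul_self PQ.2 x]
      exact mul_le_mul (le_spatialNorm x PQ.1 PQ.2) (le_spatialNorm x PQ.1 PQ.2)
        (ContinuousLinearMap.opNorm_nonneg _) (spatialNorm_nonneg x)
    · have h : spatialNorm x ≤ √(spatialNorm (star x * x)) := by
        refine Real.iSup_le (fun PQ => Real.le_sqrt_of_sq_le ?_) (Real.sqrt_nonneg _)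
        rw [pow_two, ← PQ.1.norm_tensor_star_mul_self PQ.2 x]
        exact le_spatialNorm _ PQ.1 PQ.2
      calc _ ≤ √(spatialNorm (star x * x)) * √(spatialNorm (star x * x)) :=
            mul_le_mul h h (spatialNorm_nonneg _) (Real.sqrt_nonneg _)
        _ = _ := Real.mul_self_sqrt (spatialNorm_nonneg _)
  star' x := iSup_congr fun PQ => PQ.1.norm_tensor_star PQ.2 x

/-- The spatial (minimal) tensor product of two unital C*-algebras: the completion of the
algebraic tensor product in the spatial norm. -/
abbrev SpatialTensor (A : Type u) (B : Type v) [CStarAlgebra A] [CStarAlgebra B] : Type (max u v) :=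
  (spatialSeminorm A B).Completion

namespace SpatialTensor

variable {A A' : Type u} [CStarAlgebra A] [CStarAlgebra A'] {B B' : Type v} [CStarAlgebra B]
  [CStarAlgebra B']

/-- The canonical map of the algebraic tensor product into the spatial one. -/
def incl (A : Type u) (B : Type v) [CStarAlgebra A] [CStarAlgebra B] :
    A ⊗[ℂ] B →⋆ₐ[ℂ] SpatialTensor A B :=
  (spatialSeminorm A B).incl

/-- The elementary tensor `a ⊗ b` in the spatial tensor product. -/
def tmul (a : A) (b : B) : SpatialTensor A B := incl A B (a ⊗ₜ b)

/-- The star-homomorphism `f ⊗ g` on algebraic tensor products. -/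
def algMap (f : A →⋆ₐ[ℂ] A') (g : B →⋆ₐ[ℂ] B') : A ⊗[ℂ] B →⋆ₐ[ℂ] A' ⊗[ℂ] B' :=
  { Algebra.TensorProduct.map (f : A →ₐ[ℂ] A') (g : B →ₐ[ℂ] B') with
    map_star' := fun x => by
      change Algebra.TensorProduct.map (f : A →ₐ[ℂ] A') (g : B →ₐ[ℂ] B') (star x) =
        star (Algebra.TensorProduct.map (f : A →ₐ[ℂ] A') (g : B →ₐ[ℂ] B') x)
      induction x with
      | zero => simp
      | add x y hx hy => rw [star_add, map_add, map_add, star_add, hx, hy]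
      | tmul a b => simp [map_star] }

/-- The star-homomorphism `f ⊗ g` on spatial tensor products. -/
def map (f : A →⋆ₐ[ℂ] A') (g : B →⋆ₐ[ℂ] B') : SpatialTensor A B →⋆ₐ[ℂ] SpatialTensor A' B' :=
  (spatialSeminorm A B).extend ((incl A' B').comp (algMap f g)) fun x =>
    ((spatialSeminorm A' B').norm_incl _).trans_le
      (spatialNorm_map_le f g x)

theorem map_tmul (f : A →⋆ₐ[ℂ] A') (g : B →⋆ₐ[ℂ] B') (a : A) (b : B) :
    map f g (tmul a b) = tmul (f a) (g b) :=
  (spatialSeminorm A B).extend_incl _ _ (a ⊗ₜ b)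

theorem map_incl (f : A →⋆ₐ[ℂ] A') (g : B →⋆ₐ[ℂ] B') (x : A ⊗[ℂ] B) :
    map f g (incl A B x) = incl A' B' (algMap f g x) :=
  (spatialSeminorm A B).extend_incl _ _ x

theorem map_id : map (StarAlgHom.id ℂ A) (StarAlgHom.id ℂ B) = StarAlgHom.id ℂ _ := by
  refine (spatialSeminorm A B).hom_ext fun x => (map_incl _ _ x).trans ?_
  refine congrArg (incl A B) ?_
  induction x with
  | zero => exact _root_.map_zero _
  | add x y hx hy => rw [_root_.map_add, hx, hy]
  | tmul a b => rfl

theorem map_comp {A'' : Type u} [CStarAlgebra A''] {B'' : Type v} [CStarAlgebra B'']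
    (f : A →⋆ₐ[ℂ] A') (g : B →⋆ₐ[ℂ] B') (f' : A' →⋆ₐ[ℂ] A'') (g' : B' →⋆ₐ[ℂ] B'') :
    map (f'.comp f) (g'.comp g) = (map f' g').comp (map f g) := by
  refine (spatialSeminorm A B).hom_ext fun x => (map_incl _ _ x).trans ?_
  refine Eq.trans ?_ ((congrArg (map f' g') (map_incl f g x)).trans (map_incl _ _ _)).symm
  refine congrArg (incl A'' B'') ?_
  induction x with
  | zero => simp only [_root_.map_zero]
  | add x y hx hy => simp only [_root_.map_add, hx, hy]
  | tmul a b => rfl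

end SpatialTensor

/-! ### Compact quantum groups -/

/-- Coassociativity `(Δ ⊗ id) ∘ Δ = (id ⊗ Δ) ∘ Δ`, read through the canonical identification `Φ`
of `(B ⊗ B) ⊗ B` with `B ⊗ (B ⊗ B)`. -/
def IsCoassociative {B : Type v} [CStarAlgebra B] (Δ : B →⋆ₐ[ℂ] SpatialTensor B B) : Prop :=
  ∃ Φ : SpatialTensor (SpatialTensor B B) B →⋆ₐ[ℂ] SpatialTensor B (SpatialTensor B B),
    (∀ a b c : B, Φ (.tmul (.tmul a b) c) = .tmul a (.tmul b c)) ∧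
    ∀ b : B, Φ (SpatialTensor.map Δ (StarAlgHom.id ℂ B) (Δ b)) =
      SpatialTensor.map (StarAlgHom.id ℂ B) Δ (Δ b)

/-- `Δ` makes the unital C*-algebra `B` the algebra of continuous functions on a compact quantum
group (in the sense of Woronowicz): `B` is nonzero, `Δ` is a coassociative unital
star-homomorphism, and the linear spans of `Δ(B)(1 ⊗ B)` and of `(B ⊗ 1)Δ(B)` are dense. -/
structure IsCompactQuantumGroup {B : Type v} [CStarAlgebra B]
    (Δ : B →⋆ₐ[ℂ] SpatialTensor B B) : Prop where
  nontrivial : Nontrivial B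
  coassoc : IsCoassociative Δ
  dense_right : Dense (Submodule.span ℂ
    {x : SpatialTensor B B | ∃ a b : B, x = Δ a * .tmul 1 b} : Set (SpatialTensor B B))
  dense_left : Dense (Submodule.span ℂ
    {x : SpatialTensor B B | ∃ a b : B, x = .tmul b 1 * Δ a} : Set (SpatialTensor B B))

/-! ### Finite quantum groups -/

/-- A finite quantum group, given by its algebra of functions `A`: a finite-dimensional
C*-algebra that is a Hopf star-algebra (the coproduct is a unital star-homomorphism). -/
class FiniteQuantumGroup (A : Type u) [CStarAlgebra A] extends Coalgebra ℂ A where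
  finiteDimensional : FiniteDimensional ℂ A
  comul_one : comul (1 : A) = 1
  comul_mul : ∀ a b : A, comul (a * b) = comul a * comul b
  comul_star : ∀ a : A, comul (star a) = star (comul a)
  counit_one : counit (1 : A) = 1
  counit_mul : ∀ a b : A, counit (a * b) = counit a * counit b
  /-- The antipode. -/
  antipode : A →ₗ[ℂ] A
  mul_antipode_rTensor_comul :
    LinearMap.mul' ℂ A ∘ₗ antipode.rTensor A ∘ₗ comul = Algebra.linearMap ℂ A ∘ₗ counit
  mul_antipode_lTensor_comul :
    LinearMap.mul' ℂ A ∘ₗ antipode.lTensor A ∘ₗ comul = Algebra.linearMap ℂ A ∘ₗ counit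

/-- The slice map `φ ⊗ id : A ⊗ B → B`. -/
def sliceLeft {A : Type u} {B : Type v} [AddCommGroup A] [Module ℂ A] [AddCommGroup B] [Module ℂ B]
    (φ : A →ₗ[ℂ] ℂ) : A ⊗[ℂ] B →ₗ[ℂ] B :=
  (TensorProduct.lid ℂ B).toLinearMap ∘ₗ φ.rTensor B

/-- The slice map `id ⊗ φ : A ⊗ B → A`. -/
def sliceRight {A : Type u} {B : Type v} [AddCommGroup A] [Module ℂ A] [AddCommGroup B]
    [Module ℂ B] (φ : B →ₗ[ℂ] ℂ) : A ⊗[ℂ] B →ₗ[ℂ] A :=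
  (TensorProduct.rid ℂ A).toLinearMap ∘ₗ φ.lTensor A

section FiniteQuantumGroup

variable (A : Type u) [CStarAlgebra A] [FiniteQuantumGroup A]

open Coalgebra FiniteQuantumGroup

open scoped ComplexOrder in
/-- `h` is a Haar state: a state invariant under the coproduct from both sides. -/
structure IsHaarState (h : A →ₗ[ℂ] ℂ) : Prop where
  nonneg : ∀ a : A, 0 ≤ h (star a * a)
  map_one : h 1 = 1
  left_inv : ∀ a : A, sliceRight h (comul (R := ℂ) a) = algebraMap ℂ A (h a)
  right_inv : ∀ a : A, sliceLeft h (comul (R := ℂ) a) = algebraMap ℂ A (h a)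

/-- The Haar state of a finite quantum group (every finite quantum group has exactly one). -/
def haarState : A →ₗ[ℂ] ℂ := Classical.epsilon (IsHaarState A)

variable {A}

/-- `η` is a Haar element: `ε(η) = 1` and `a η = ε(a) η` for all `a`. -/
structure IsHaarElement (η : A) : Prop where
  counit_eq : counit (R := ℂ) η = 1
  mul_eq : ∀ a : A, a * η = counit (R := ℂ) a • η

variable (A) in
/-- The Haar element of a finite quantum group (every finite quantum group has exactly one). -/
def haarElement : A := Classical.epsilon (IsHaarElement (A := A))

variable (A) in
/-- The convolution product `a ⋆ b = (h ⊗ id)(((S ⊗ id)Δ(b))(a ⊗ 1))`. -/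
def convProd : A →ₗ[ℂ] A →ₗ[ℂ] A :=
  LinearMap.mk₂ ℂ
    (fun a b => sliceLeft (haarState A) ((antipode.rTensor A (comul (R := ℂ) b)) * (a ⊗ₜ 1)))
    (fun a a' b => by rw [TensorProduct.add_tmul, mul_add, map_add])
    (fun c a b => by rw [← TensorProduct.smul_tmul', mul_smul_comm, map_smul])
    (fun a b b' => by rw [map_add, map_add, add_mul, map_add])
    (fun c a b => by rw [map_smul, map_smul, smul_mul_assoc, map_smul])

variable (A) in
/-- The convolution adjoint `a ↦ S(a*)`. -/
def convAdjoint : A →ₗ⋆[ℂ] A :=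
  antipode.comp (starLinearEquiv ℂ : A ≃ₗ⋆[ℂ] A).toLinearMap

end FiniteQuantumGroup

/-! ### Quantum families of maps -/

section Families

variable {A : Type u} [CStarAlgebra A] {B : Type v} [CStarAlgebra B]

/-- The Podleś condition: `α(A)(1 ⊗ B)` spans `A ⊗ B`. (As `A` is finite-dimensional, `A ⊗ B` is
the algebraic tensor product.) A unital star-homomorphism `α : A → A ⊗ B` with this property
represents a quantum family of invertible maps. -/
def IsInvertibleFamily (α : A →⋆ₐ[ℂ] A ⊗[ℂ] B) : Prop :=
  Submodule.span ℂ {x : A ⊗[ℂ] B | ∃ (a : A) (b : B), x = α a * (1 ⊗ₜ b)} = ⊤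

/-- `α` preserves the functional `φ`: `(φ ⊗ id)α(a) = φ(a)1`. -/
def PreservesFunctional (φ : A →ₗ[ℂ] ℂ) (α : A →⋆ₐ[ℂ] A ⊗[ℂ] B) : Prop :=
  ∀ a : A, sliceLeft φ (α a) = algebraMap ℂ B (φ a)

/-- `α` represents a quantum family of automorphisms: it represents a quantum family of invertible
maps and preserves the convolution product, the convolution adjoint and the Haar element. -/
structure IsAutomorphismFamily [FiniteQuantumGroup A] (α : A →⋆ₐ[ℂ] A ⊗[ℂ] B) : Prop where
  invertible : IsInvertibleFamily α
  map_convProd : ∀ a b : A, α (convProd A a b) =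
    TensorProduct.map₂ (convProd A) (LinearMap.mul ℂ B) (α a) (α b)
  map_convAdjoint : ∀ a : A, α (convAdjoint A a) =
    TensorProduct.map (convAdjoint A) (starLinearEquiv ℂ : B ≃ₗ⋆[ℂ] B).toLinearMap (α a)
  map_haarElement : α (haarElement A) = haarElement A ⊗ₜ 1

/-- `α` is an action on `A` of the compact quantum group given by `Δ`: it represents a quantum
family of invertible maps and `(id ⊗ Δ) ∘ α = (α ⊗ id) ∘ α` as maps `A → A ⊗ (B ⊗ B)`. -/
structure IsAction (Δ : B →⋆ₐ[ℂ] SpatialTensor B B) (α : A →⋆ₐ[ℂ] A ⊗[ℂ] B) : Prop where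
  invertible : IsInvertibleFamily α
  action_eq : ∀ a : A, Δ.toAlgHom.toLinearMap.lTensor A (α a) =
    (SpatialTensor.incl B B).toAlgHom.toLinearMap.lTensor A
      (TensorProduct.assoc ℂ A B B (α.toAlgHom.toLinearMap.rTensor B (α a)))

end Families

/-! ### The category of quantum families of automorphisms -/

/-- Objects of `QAUT`: pairs `(B, α)` with `B` a unital C*-algebra and `α : A → A ⊗ B` a quantum
family of automorphisms. -/
structure QAUT (A : Type u) [CStarAlgebra A] [FiniteQuantumGroup A] where
  carrier : Type v
  [cstarAlgebra : CStarAlgebra carrier]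
  map : A →⋆ₐ[ℂ] A ⊗[ℂ] carrier
  isAutomorphismFamily : IsAutomorphismFamily map

namespace QAUT

attribute [instance] QAUT.cstarAlgebra

variable {A : Type u} [CStarAlgebra A] [FiniteQuantumGroup A]

/-- A morphism `(B, α) → (B', α')` is a unital star-homomorphism `Λ : B' → B` with
`α = (id ⊗ Λ) ∘ α'`. -/
@[ext]
structure Hom (X Y : QAUT.{u, v} A) where
  hom : Y.carrier →⋆ₐ[ℂ] X.carrier
  comm : ∀ a : A, hom.toAlgHom.toLinearMap.lTensor A (Y.map a) = X.map a

instance : CategoryTheory.Category (QAUT.{u, v} A) where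
  Hom := Hom
  id X := ⟨StarAlgHom.id ℂ X.carrier, fun a => LinearMap.congr_fun (LinearMap.lTensor_id A _) _⟩
  comp {X Y Z} f g := ⟨f.hom.comp g.hom, fun a => by
    rw [← f.comm, ← g.comm]
    exact LinearMap.lTensor_comp_apply A f.hom.toAlgHom.toLinearMap g.hom.toAlgHom.toLinearMap _⟩

end QAUT

/-! ### Wang's quantum automorphism group -/

/-- Compact quantum groups acting on the C*-algebra `A` and preserving the functional `φ`. -/
structure PreservingAction (A : Type u) [CStarAlgebra A] (φ : A →ₗ[ℂ] ℂ) where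
  carrier : Type v
  [cstarAlgebra : CStarAlgebra carrier]
  comul : carrier →⋆ₐ[ℂ] SpatialTensor carrier carrier
  isCompactQuantumGroup : IsCompactQuantumGroup comul
  map : A →⋆ₐ[ℂ] A ⊗[ℂ] carrier
  isAction : IsAction comul map
  preserves : PreservesFunctional φ map

namespace PreservingAction

attribute [instance] PreservingAction.cstarAlgebra

variable {A : Type u} [CStarAlgebra A] {φ : A →ₗ[ℂ] ℂ}

/-- A morphism is a morphism of compact quantum groups that intertwines the actions; on the
algebras of functions the arrow is reversed. -/
@[ext]
structure Hom (X Y : PreservingAction.{u, v} A φ) where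
  hom : Y.carrier →⋆ₐ[ℂ] X.carrier
  comul_comm : ∀ b, SpatialTensor.map hom hom (Y.comul b) = X.comul (hom b)
  comm : ∀ a : A, hom.toAlgHom.toLinearMap.lTensor A (Y.map a) = X.map a

instance : CategoryTheory.Category (PreservingAction.{u, v} A φ) where
  Hom := Hom
  id X := ⟨StarAlgHom.id ℂ X.carrier,
    fun b => by rw [SpatialTensor.map_id]; rfl,
    fun a => LinearMap.congr_fun (LinearMap.lTensor_id A _) _⟩
  comp {X Y Z} f g := ⟨f.hom.comp g.hom,
    fun b => by
      rw [SpatialTensor.map_comp]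
      exact (congrArg _ (g.comul_comm b)).trans (f.comul_comm _),
    fun a => by
      rw [← f.comm, ← g.comm]
      exact LinearMap.lTensor_comp_apply A f.hom.toAlgHom.toLinearMap
        g.hom.toAlgHom.toLinearMap _⟩

end PreservingAction

/-- `W` is Wang's quantum automorphism group of `(A, φ)`: the final object among the compact
quantum groups acting on `A` and preserving `φ`. -/
def IsWangQuantumAutomorphismGroup {A : Type u} [CStarAlgebra A] {φ : A →ₗ[ℂ] ℂ}
    (W : PreservingAction.{u, v} A φ) : Prop :=
  Nonempty (CategoryTheory.Limits.IsTerminal W)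

end

/-!
# The quantum automorphism group of a finite quantum group

Let `h` be the Haar state of `A` and `e` a basis of `A` that is orthonormal for `h(a* b)`. A family
`α : A → A ⊗ B` is encoded by its coefficient matrix `u`, where `α(e_j) = ∑ᵢ eᵢ ⊗ u_ij`. It preserves
`h` if and only if `u* u = 1`, and then the Podleś condition says that `u u* = 1`
(`coeffMatrix_mem_unitary_iff`). As `a ⋆ 1 = h(a)1`, a quantum family of automorphisms preserves `h`.
So both `QAUT` and the families in Wang's definition consist of those families with unitary `u`
that preserve some further operations of `A`; these are the *symmetric families*
(`IsSymmetryFamily`), and the two cases are treated together.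

* The entries of a unitary matrix have norm at most `1`, so the free star-algebra on the symbols
  `u_ij` has a largest C*-seminorm coming from symmetric families. Its completion `U` carries a
  family `α_U`, and the maps from `U` given by symmetric families are jointly injective. Each
  property of symmetric families is an equation between coefficients, so it passes from these images
  to `α_U`, which is therefore a universal family (`UniversalFamily.isUniversalFamily_map`), and its
  coefficients generate `U`. Every universal family is isomorphic to it.
* The composition `(α ⊗ id) ∘ α` of a symmetric family with itself is symmetric, with coefficients
  `∑ₖ u_ik ⊗ u_kj`. For a universal family, universality turns it into a coproduct `Δ`, the only one
  for which `α` is an action. Coassociativity can be checked on coefficients. The density conditions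
  hold because `u_ij ⊗ 1 = ∑ₖ Δ(u_ik)(1 ⊗ u_jk*)` and `1 ⊗ u_ij = ∑ₖ (u_ki* ⊗ 1)Δ(u_kj)`
  (`CoefficientsGenerate.isCompactQuantumGroup`).
* Without further operations this produces Wang's quantum automorphism group. Its finality maps it
  to the universal object of `QAUT`; the image contains the coefficients and is closed
  (`StarAlgHom.isClosed_range`), so the map is onto.

Two ingredients precede this. The Haar state exists and is faithful: for a faithful state `φ`, the
operator `a ↦ (id ⊗ φ)Δ(a)` obeys a maximum principle
(`FiniteQuantumGroup.not_convOp_sub_eq`), so only scalars are fixed by it and `1` is not in the range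
of its difference with the identity. This splits off an invariant functional, which the maximum
principle shows to be positive. The associator `(A ⊗ B) ⊗ C → A ⊗ (B ⊗ C)` of spatial tensor products
(`SpatialTensor.assoc`), through which coassociativity is expressed, is contractive because the
spatial norm can be computed from any jointly injective family of representations of one factor
(`HilbertRep.spatialNorm_le_of_jointly_injective`).
-/

noncomputable section

/-! ### Positive functionals and slices of tensors -/

section Slices

variable {A B C : Type*} [AddCommGroup A] [Module ℂ A] [AddCommGroup B] [Module ℂ B]
  [AddCommGroup C] [Module ℂ C]

@[simp]
theorem sliceLeft_tmul (φ : A →ₗ[ℂ] ℂ) (a : A) (b : B) : sliceLeft φ (a ⊗ₜ[ℂ] b) = φ a • b := by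
  simp [sliceLeft]

@[simp]
theorem sliceRight_tmul (φ : B →ₗ[ℂ] ℂ) (a : A) (b : B) : sliceRight φ (a ⊗ₜ[ℂ] b) = φ b • a := by
  simp [sliceRight]

theorem sliceLeft_lTensor (φ : A →ₗ[ℂ] ℂ) (f : B →ₗ[ℂ] C) (z : A ⊗[ℂ] B) :
    sliceLeft φ (f.lTensor A z) = f (sliceLeft φ z) := by
  induction z with
  | zero => simp
  | add x y hx hy => simp only [map_add, hx, hy]
  | tmul a b => simp

variable {ι : Type*} [Fintype ι]

theorem Module.Basis.sum_tmul_slice (e : Module.Basis ι ℂ A) (z : A ⊗[ℂ] B) :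
    ∑ i, e i ⊗ₜ[ℂ] sliceLeft (e.coord i) z = z := by
  induction z with
  | zero => simp
  | add x y hx hy => simp only [map_add, TensorProduct.tmul_add, Finset.sum_add_distrib, hx, hy]
  | tmul a b =>
    simp only [sliceLeft_tmul, ← TensorProduct.smul_tmul, ← TensorProduct.sum_tmul]
    congr 1
    exact e.sum_repr a

theorem Module.Basis.tensor_ext (e : Module.Basis ι ℂ A) {z w : A ⊗[ℂ] B}
    (h : ∀ i, sliceLeft (e.coord i) z = sliceLeft (e.coord i) w) : z = w := by
  rw [← e.sum_tmul_slice z, ← e.sum_tmul_slice w]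
  simp only [h]

theorem Module.Basis.slice_sum_tmul [DecidableEq ι] (e : Module.Basis ι ℂ A) (b : ι → B) (i : ι) :
    sliceLeft (e.coord i) (∑ j, e j ⊗ₜ[ℂ] b j) = b i := by
  simp [Finsupp.single_apply, ite_smul]

end Slices

open scoped ComplexOrder in
/-- A positive functional that vanishes on no nonzero positive element. -/
structure IsFaithfulPositive {A : Type*} [Ring A] [StarRing A] [Algebra ℂ A]
    (φ : A →ₗ[ℂ] ℂ) : Prop where
  nonneg : ∀ a : A, 0 ≤ φ (star a * a)
  eq_zero : ∀ a : A, φ (star a * a) = 0 → a = 0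

/-- A finite basis that is orthonormal for the sesquilinear form `⟨a, b⟩ = φ(a* b)`. -/
def IsOrthonormalFor {A : Type*} [Ring A] [StarRing A] [Algebra ℂ A] {n : ℕ} (φ : A →ₗ[ℂ] ℂ)
    (e : Module.Basis (Fin n) ℂ A) : Prop :=
  ∀ i j, φ (star (e i) * e j) = if i = j then 1 else 0

theorem InnerProductSpace.Core.exists_orthonormal_basis {V : Type*} [AddCommGroup V] [Module ℂ V]
    [FiniteDimensional ℂ V] (c : InnerProductSpace.Core ℂ V) :
    ∃ (n : ℕ) (e : Module.Basis (Fin n) ℂ V),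
      ∀ i j, c.inner (e i) (e j) = if i = j then 1 else 0 := by
  let _ : NormedAddCommGroup V := c.toNormedAddCommGroup
  let _ : InnerProductSpace ℂ V := InnerProductSpace.ofCore c.toCore
  let b := stdOrthonormalBasis ℂ V
  refine ⟨_, b.toBasis, fun i j => ?_⟩
  rw [b.coe_toBasis]
  exact orthonormal_iff_ite.1 b.orthonormal i j

section Positive

variable {A : Type*} [Ring A] [StarRing A] [Algebra ℂ A] [StarModule ℂ A]

/-- By polarization, a functional that takes real values on all `a* a` gives a Hermitian form. -/
theorem conj_apply_star_mul {φ : A →ₗ[ℂ] ℂ} (hφ : ∀ a : A, star (φ (star a * a)) = φ (star a * a))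
    (a b : A) : star (φ (star a * b)) = φ (star b * a) := by
  have h1 := hφ (a + b)
  have h2 := hφ (a + Complex.I • b)
  have ha := hφ a
  have hb := hφ b
  simp only [star_add, star_smul, add_mul, mul_add, map_add, smul_mul_assoc, mul_smul_comm,
    map_smul, smul_eq_mul, star_mul', RCLike.star_def, Complex.conj_I, map_neg] at *
  rw [ha, hb] at h1 h2
  have e1 : (starRingEnd ℂ) (φ (star a * b)) + (starRingEnd ℂ) (φ (star b * a)) =
    φ (star a * b) + φ (star b * a) := by linear_combination h1
  have e2 : Complex.I * ((starRingEnd ℂ) (φ (star b * a)) - (starRingEnd ℂ) (φ (star a * b))) =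
    Complex.I * (φ (star a * b) - φ (star b * a)) := by
    linear_combination h2
  have e3 := mul_left_cancel₀ Complex.I_ne_zero e2
  linear_combination (e1 - e3) / 2

open scoped ComplexOrder

theorem IsFaithfulPositive.conj_apply {φ : A →ₗ[ℂ] ℂ} (hφ : IsFaithfulPositive φ) (a b : A) :
    star (φ (star a * b)) = φ (star b * a) :=
  conj_apply_star_mul (fun a => (IsSelfAdjoint.of_nonneg (hφ.nonneg a)).star_eq) a b

theorem IsFaithfulPositive.exists_orthonormal [FiniteDimensional ℂ A] {φ : A →ₗ[ℂ] ℂ}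
    (hφ : IsFaithfulPositive φ) :
    ∃ (n : ℕ) (e : Module.Basis (Fin n) ℂ A), IsOrthonormalFor φ e :=
  InnerProductSpace.Core.exists_orthonormal_basis
    { inner := fun a b => φ (star a * b)
      conj_inner_symm := fun a b => hφ.conj_apply b a
      re_inner_nonneg := fun a => (Complex.le_def.1 (hφ.nonneg a)).1
      add_left := fun a b c => by simp [add_mul]
      smul_left := fun a b c => by simp
      definite := fun a h => hφ.eq_zero a h }

variable {B : Type*} [Ring B] [StarRing B] [Algebra ℂ B] [StarModule ℂ B]

/-- In coordinates with respect to an orthonormal basis, `(φ ⊗ id)(z* w) = ∑ zᵢ* wᵢ`. -/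
theorem IsOrthonormalFor.slice_star_mul {n : ℕ} {φ : A →ₗ[ℂ] ℂ} {e : Module.Basis (Fin n) ℂ A}
    (he : IsOrthonormalFor φ e) (z w : A ⊗[ℂ] B) :
    sliceLeft φ (star z * w) =
      ∑ i, star (sliceLeft (e.coord i) z) * sliceLeft (e.coord i) w := by
  conv_lhs => rw [← e.sum_tmul_slice z, ← e.sum_tmul_slice w]
  simp only [star_sum, TensorProduct.star_tmul, Finset.sum_mul_sum,
    Algebra.TensorProduct.tmul_mul_tmul, map_sum, sliceLeft_tmul]
  refine Finset.sum_congr rfl fun i _ => ?_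
  simp [he i, ite_smul]

theorem IsFaithfulPositive.slice_nonneg [FiniteDimensional ℂ A] {φ : A →ₗ[ℂ] ℂ}
    (hφ : IsFaithfulPositive φ) {ψ : B →ₗ[ℂ] ℂ} (hψ : ∀ b : B, 0 ≤ ψ (star b * b))
    (z : A ⊗[ℂ] B) : 0 ≤ ψ (sliceLeft φ (star z * z)) := by
  obtain ⟨n, e, he⟩ := hφ.exists_orthonormal
  rw [he.slice_star_mul, map_sum]
  exact Finset.sum_nonneg fun i _ => hψ _

theorem IsFaithfulPositive.tensor [FiniteDimensional ℂ A] {φ : A →ₗ[ℂ] ℂ}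
    (hφ : IsFaithfulPositive φ) {ψ : B →ₗ[ℂ] ℂ} (hψ : IsFaithfulPositive ψ) :
    IsFaithfulPositive (ψ ∘ₗ sliceLeft φ) where
  nonneg := hφ.slice_nonneg hψ.nonneg
  eq_zero z hz := by
    obtain ⟨n, e, he⟩ := hφ.exists_orthonormal
    rw [LinearMap.comp_apply, he.slice_star_mul, map_sum,
      Finset.sum_eq_zero_iff_of_nonneg fun i _ => hψ.nonneg _] at hz
    refine e.tensor_ext fun i => ?_
    rw [hψ.eq_zero _ (hz i (Finset.mem_univ i)), map_zero]

end Positive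

/-! ### Existence of a faithful state on a finite-dimensional C*-algebra -/

section Trace

variable {A : Type*} [CStarAlgebra A] [FiniteDimensional ℂ A]

theorem exists_mul_eq_zero_of_not_isUnit {x : A} (hx : ¬ IsUnit x) : ∃ y ≠ 0, x * y = 0 := by
  by_contra! h
  have hinj : Function.Injective (LinearMap.mulLeft ℂ x) := by
    rw [injective_iff_map_eq_zero]
    intro y hy
    by_contra hy0
    exact h y hy0 hy
  obtain ⟨y, hy⟩ := (LinearMap.injective_iff_surjective.1 hinj) 1
  have hy : x * y = 1 := hy
  have : y * x = 1 := by
    refine sub_eq_zero.1 (hinj ?_)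
    rw [map_zero, LinearMap.mulLeft_apply, mul_sub, ← mul_assoc, hy]; simp
  exact hx ⟨⟨x, y, hy, this⟩, rfl⟩

open scoped ComplexOrder

theorem roots_charpoly_mulLeft_nonneg (a : A) :
    ∀ μ ∈ (LinearMap.mulLeft ℂ (star a * a)).charpoly.roots, 0 ≤ μ := by
  intro μ hμ
  have h1 := Polynomial.isRoot_of_mem_roots hμ
  rw [← Module.End.hasEigenvalue_iff_isRoot_charpoly] at h1
  obtain ⟨y, hy⟩ := h1.exists_hasEigenvector
  have hspec : μ ∈ spectrum ℂ (star a * a) := by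
    rw [spectrum.mem_iff]
    intro hu
    refine hy.2 (hu.mul_right_eq_zero.1 ?_)
    have := hy.apply_eq_smul
    rw [LinearMap.mulLeft_apply] at this
    rw [sub_mul, this, Algebra.smul_def, sub_self]
  let _ := CStarAlgebra.spectralOrder A
  have _ := CStarAlgebra.spectralOrderedRing A
  exact spectrum_nonneg_of_nonneg (star_mul_self_nonneg a) hspec

/-- Left multiplication by a positive element has nonnegative eigenvalues, so its trace is
nonnegative, and it vanishes only for nilpotent, hence zero, elements. -/
theorem isFaithfulPositive_trace :
    IsFaithfulPositive (LinearMap.trace ℂ A ∘ₗ LinearMap.mul ℂ A) := by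
  have htr : ∀ a : A, (LinearMap.trace ℂ A ∘ₗ LinearMap.mul ℂ A) a =
      (LinearMap.mulLeft ℂ a).charpoly.roots.sum := fun a =>
    Module.End.trace_eq_sum_roots_charpoly_of_splits (IsAlgClosed.splits _)
  refine ⟨fun a => ?_, fun a ha => ?_⟩
  · rw [htr]
    exact Multiset.sum_nonneg (roots_charpoly_mulLeft_nonneg a)
  · rw [htr] at ha
    have hspec : ∀ μ ∈ spectrum ℂ (star a * a), μ = 0 := fun μ hμ => by
      obtain ⟨y, hy0, hy⟩ := exists_mul_eq_zero_of_not_isUnit (spectrum.mem_iff.1 hμ)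
      rw [sub_mul, sub_eq_zero] at hy
      have hev : Module.End.HasEigenvalue (LinearMap.mulLeft ℂ (star a * a)) μ :=
        Module.End.hasEigenvalue_of_hasEigenvector (x := y)
          ⟨Module.End.mem_eigenspace_iff.2 (by rw [LinearMap.mulLeft_apply, ← hy, Algebra.smul_def]),
            hy0⟩
      have hμ : μ ∈ (LinearMap.mulLeft ℂ (star a * a)).charpoly.roots :=
        (Polynomial.mem_roots (LinearMap.charpoly_monic _).ne_zero).2
          ((Module.End.hasEigenvalue_iff_isRoot_charpoly _ _).1 hev)
      have hpos := roots_charpoly_mulLeft_nonneg a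
      exact le_antisymm (ha ▸ Multiset.single_le_sum hpos μ hμ) (hpos μ hμ)
    exact (CStarRing.star_mul_self_eq_zero_iff a).1 (CFC.eq_zero_of_spectrum_subset_zero (R := ℂ) _
      hspec (IsSelfAdjoint.star_mul_self a).isStarNormal)

theorem exists_faithful_state [Nontrivial A] :
    ∃ φ : A →ₗ[ℂ] ℂ, IsFaithfulPositive φ ∧ φ 1 = 1 := by
  have h := isFaithfulPositive_trace (A := A)
  set τ := LinearMap.trace ℂ A ∘ₗ LinearMap.mul ℂ A
  have h1 : τ 1 ≠ 0 := fun h1 => one_ne_zero (h.eq_zero (1 : A) (by simpa using h1))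
  have h1' : 0 ≤ τ 1 := by simpa using h.nonneg 1
  refine ⟨(τ 1)⁻¹ • τ, ⟨fun a => ?_, fun a ha => h.eq_zero a ?_⟩, ?_⟩
  · exact mul_nonneg (inv_nonneg.2 h1') (h.nonneg a)
  · simpa [h1] using ha
  · simp [h1]

end Trace

/-! ### The Haar state of a finite quantum group -/

namespace FiniteQuantumGroup

open Coalgebra

variable {A : Type u} [CStarAlgebra A]

theorem comm_mul (z w : A ⊗[ℂ] A) : TensorProduct.comm ℂ A A (z * w) =
    TensorProduct.comm ℂ A A z * TensorProduct.comm ℂ A A w :=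
  map_mul (Algebra.TensorProduct.comm ℂ A A) z w

theorem star_comm (z : A ⊗[ℂ] A) : TensorProduct.comm ℂ A A (star z) =
    star (TensorProduct.comm ℂ A A z) := by
  induction z with
  | zero => simp
  | add x y hx hy => simp only [map_add, star_add, hx, hy]
  | tmul x y => simp

section

variable [FiniteQuantumGroup A]

local notation "Δ" => comul (R := ℂ) (A := A)
local notation "ε" => counit (R := ℂ) (A := A)

theorem nontrivial : Nontrivial A := by
  refine ⟨⟨1, 0, fun h => ?_⟩⟩
  have h1 : ε 1 = 1 := counit_one
  rw [h, map_zero] at h1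
  exact zero_ne_one h1

theorem counit_star (a : A) : ε (star a) = star (ε a) := by
  -- both `ε` and `a ↦ conj ε(a*)` are counits, and counits are unique
  let ε' : A →ₗ[ℂ] ℂ :=
    { toFun := fun x => star (ε (star x))
      map_add' := fun x y => by simp
      map_smul' := fun c x => by simp }
  have h1 : ∀ z : A ⊗[ℂ] A, TensorProduct.lid ℂ A (ε'.rTensor A z) =
      star (TensorProduct.lid ℂ A ((counit (R := ℂ)).rTensor A (star z))) := by
    intro z
    induction z with
    | zero => simp
    | add x y hx hy => simp only [map_add, star_add, hx, hy]
    | tmul x y => simp [ε']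
  have h2 : ∀ z : A ⊗[ℂ] A, ε (TensorProduct.lid ℂ A (ε'.rTensor A z)) =
      ε' (TensorProduct.rid ℂ A ((counit (R := ℂ)).lTensor A z)) := by
    intro z
    induction z with
    | zero => simp
    | add x y hx hy => simp only [map_add, hx, hy]
    | tmul x y => simp [mul_comm]
  have h3 := h2 (Δ a)
  rw [h1, ← comul_star, rTensor_counit_comul, lTensor_counit_comul] at h3
  have h4 : ε a = star (ε (star a)) := by simpa [ε'] using h3
  rw [h4, star_star]

/-- The map `x ↦ S(x*)*`. It inverts the antipode, and it is the antipode for the opposite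
coproduct. -/
def antipodeInv : A →ₗ[ℂ] A where
  toFun x := star (antipode (star x))
  map_add' x y := by simp
  map_smul' c x := by simp

theorem mul_antipodeInv_rTensor_comm_comul (x : A) :
    LinearMap.mul' ℂ A (antipodeInv.rTensor A (TensorProduct.comm ℂ A A (Δ x))) =
      algebraMap ℂ A (ε x) := by
  have h : ∀ z : A ⊗[ℂ] A,
      LinearMap.mul' ℂ A (antipodeInv.rTensor A (TensorProduct.comm ℂ A A z)) =
        star (LinearMap.mul' ℂ A (antipode.lTensor A (star z))) := by
    intro z
    induction z with
    | zero => simp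
    | add x y hx hy => simp only [map_add, star_add, hx, hy]
    | tmul x y => simp [antipodeInv]
  rw [h, ← comul_star]
  have := LinearMap.congr_fun (mul_antipode_lTensor_comul (A := A)) (star x)
  simp only [LinearMap.comp_apply] at this
  rw [this, counit_star]
  simp [← algebraMap_star_comm]

theorem mul_antipodeInv_lTensor_comm_comul (x : A) :
    LinearMap.mul' ℂ A (antipodeInv.lTensor A (TensorProduct.comm ℂ A A (Δ x))) =
      algebraMap ℂ A (ε x) := by
  have h : ∀ z : A ⊗[ℂ] A,
      LinearMap.mul' ℂ A (antipodeInv.lTensor A (TensorProduct.comm ℂ A A z)) =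
        star (LinearMap.mul' ℂ A (antipode.rTensor A (star z))) := by
    intro z
    induction z with
    | zero => simp
    | add x y hx hy => simp only [map_add, star_add, hx, hy]
    | tmul x y => simp [antipodeInv]
  rw [h, ← comul_star]
  have := LinearMap.congr_fun (mul_antipode_rTensor_comul (A := A)) (star x)
  simp only [LinearMap.comp_apply] at this
  rw [this, counit_star]
  simp [← algebraMap_star_comm]

theorem antipode_one : antipode (1 : A) = 1 := by
  have := LinearMap.congr_fun (mul_antipode_rTensor_comul (A := A)) 1
  simpa [comul_one, counit_one, Algebra.TensorProduct.one_def] using this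

variable (A) in
/-- The co-opposite finite quantum group: the coproduct is flipped and the antipode inverted. -/
@[reducible]
def cop : FiniteQuantumGroup A where
  comul := (TensorProduct.comm ℂ A A).toLinearMap ∘ₗ Δ
  counit := ε
  coassoc := by
    let σ : A ⊗[ℂ] (A ⊗[ℂ] A) ≃ₗ[ℂ] A ⊗[ℂ] (A ⊗[ℂ] A) :=
      (TensorProduct.comm ℂ A (A ⊗[ℂ] A)) ≪≫ₗ
        (TensorProduct.congr (TensorProduct.comm ℂ A A) (LinearEquiv.refl ℂ A)) ≪≫ₗ
        TensorProduct.assoc ℂ A A A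
    have h1 : ∀ z : A ⊗[ℂ] A, TensorProduct.assoc ℂ A A A
        (((TensorProduct.comm ℂ A A).toLinearMap ∘ₗ Δ).rTensor A (TensorProduct.comm ℂ A A z)) =
          σ ((Δ).lTensor A z) := by
      intro z
      induction z with
      | zero => simp
      | add x y hx hy => simp only [map_add, hx, hy]
      | tmul x y => simp [σ]
    have h2 : ∀ z : A ⊗[ℂ] A,
        ((TensorProduct.comm ℂ A A).toLinearMap ∘ₗ Δ).lTensor A (TensorProduct.comm ℂ A A z) =
          σ (TensorProduct.assoc ℂ A A A ((Δ).rTensor A z)) := by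
      intro z
      induction z with
      | zero => simp
      | add x y hx hy => simp only [map_add, hx, hy]
      | tmul x y =>
        simp only [TensorProduct.comm_tmul, LinearMap.lTensor_tmul, LinearMap.rTensor_tmul,
          LinearMap.comp_apply]
        induction Δ x with
        | zero => simp
        | add p q hp hq => simp only [map_add, TensorProduct.tmul_add, TensorProduct.add_tmul, hp, hq]
        | tmul p q => simp [σ]
    refine LinearMap.ext fun a => ?_
    refine (h1 (Δ a)).trans (Eq.trans ?_ (h2 (Δ a)).symm)
    rw [coassoc_apply]
  rTensor_counit_comp_comul := by
    have h : ∀ z : A ⊗[ℂ] A, (ε).rTensor A (TensorProduct.comm ℂ A A z) =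
        TensorProduct.comm ℂ A ℂ ((ε).lTensor A z) := by
      intro z
      induction z with
      | zero => simp
      | add x y hx hy => simp only [map_add, hx, hy]
      | tmul x y => simp
    refine LinearMap.ext fun a => (h (Δ a)).trans ?_
    simp
  lTensor_counit_comp_comul := by
    have h : ∀ z : A ⊗[ℂ] A, (ε).lTensor A (TensorProduct.comm ℂ A A z) =
        TensorProduct.comm ℂ ℂ A ((ε).rTensor A z) := by
      intro z
      induction z with
      | zero => simp
      | add x y hx hy => simp only [map_add, hx, hy]
      | tmul x y => simp
    refine LinearMap.ext fun a => (h (Δ a)).trans ?_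
    simp
  finiteDimensional := finiteDimensional
  comul_one := by
    change TensorProduct.comm ℂ A A (Δ 1) = 1
    rw [comul_one]; simp [Algebra.TensorProduct.one_def]
  comul_mul a b := by
    change TensorProduct.comm ℂ A A (Δ (a * b)) = _
    rw [comul_mul, comm_mul]; rfl
  comul_star a := by
    change TensorProduct.comm ℂ A A (Δ (star a)) = _
    rw [comul_star, star_comm]; rfl
  counit_one := counit_one
  counit_mul := counit_mul
  antipode := antipodeInv
  mul_antipode_rTensor_comul := LinearMap.ext mul_antipodeInv_rTensor_comm_comul
  mul_antipode_lTensor_comul := LinearMap.ext mul_antipodeInv_lTensor_comm_comul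

/-- Injectivity of the Galois map `y ⊗ d ↦ Δ(d)(y ⊗ 1)` on elementary tensors: it is inverted by
`x ⊗ d ↦ S⁻¹(d₁) x ⊗ d₂`. -/
theorem eq_zero_of_comul_mul_tmul_one {d y : A} (hy : y ≠ 0) (h : Δ d * (y ⊗ₜ[ℂ] 1) = 0) :
    d = 0 := by
  -- `x ⊗ (u ⊗ v) ↦ S⁻¹(u) x y ⊗ v`
  let L : A ⊗[ℂ] (A ⊗[ℂ] A) →ₗ[ℂ] A ⊗[ℂ] A := TensorProduct.lift
    ((LinearMap.mul ℂ (A ⊗[ℂ] A)).flip ∘ₗ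
      (TensorProduct.mk ℂ A A).flip 1 ∘ₗ LinearMap.mulRight ℂ y) ∘ₗ
      (antipodeInv.rTensor A).lTensor A
  have hL : ∀ (x : A) (t : A ⊗[ℂ] A),
      L (x ⊗ₜ t) = antipodeInv.rTensor A t * ((x * y) ⊗ₜ 1) := fun x t => by
    simp [L]
  let G : A ⊗[ℂ] A →ₗ[ℂ] A ⊗[ℂ] A := TensorProduct.lift
    ((LinearMap.mul ℂ (A ⊗[ℂ] A)).flip ∘ₗ (TensorProduct.mk ℂ A A).flip 1) ∘ₗ
      (antipodeInv.rTensor A ∘ₗ Δ).lTensor A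
  have hG : ∀ z : A ⊗[ℂ] A, L ((Δ).lTensor A z) = G (z * (y ⊗ₜ 1)) := by
    intro z
    induction z with
    | zero => simp
    | add x y hx hy => simp only [map_add, add_mul, hx, hy]
    | tmul x w => simp [hL, G]
  have hL2 : ∀ (t : A ⊗[ℂ] A) (q : A), L (TensorProduct.assoc ℂ A A A (t ⊗ₜ q)) =
      (LinearMap.mul' ℂ A (antipodeInv.rTensor A (TensorProduct.comm ℂ A A t)) * y) ⊗ₜ q := by
    intro t q
    induction t with
    | zero => simp
    | add x y hx hy => simp only [map_add, add_mul, TensorProduct.add_tmul, hx, hy]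
    | tmul x w => simp [hL, mul_assoc]
  have hL3 : ∀ z : A ⊗[ℂ] A, L (TensorProduct.assoc ℂ A A A ((Δ).rTensor A z)) =
      y ⊗ₜ TensorProduct.lid ℂ A ((ε).rTensor A z) := by
    intro z
    induction z with
    | zero => simp
    | add p q hp hq => simp only [map_add, TensorProduct.tmul_add, hp, hq]
    | tmul p q =>
      rw [LinearMap.rTensor_tmul, hL2, mul_antipodeInv_rTensor_comm_comul]
      simp [Algebra.algebraMap_eq_smul_one, TensorProduct.smul_tmul]
  have h1 := hL3 (Δ d)
  rw [coassoc_apply, hG, h, map_zero, rTensor_counit_comul] at h1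
  have h2 : y ⊗ₜ[ℂ] d = 0 := by simpa using h1.symm
  obtain ⟨f, hf⟩ : ∃ f : Module.Dual ℂ A, f y ≠ 0 := by
    by_contra! hf
    exact hy ((Module.forall_dual_apply_eq_zero_iff ℂ y).1 hf)
  have h3 := congrArg (sliceLeft f) h2
  rw [sliceLeft_tmul, map_zero] at h3
  exact (smul_eq_zero.1 h3).resolve_left hf

end

end FiniteQuantumGroup

namespace FiniteQuantumGroup

open Coalgebra

open scoped ComplexOrder

variable {A : Type u} [CStarAlgebra A]

/-- Every self-adjoint `r` has the form `M - d*d`, where `M` is the largest element of its spectrum;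
in finite dimensions `d*d` then annihilates some nonzero `y`. -/
theorem exists_real_sub_eq_star_mul_self [FiniteDimensional ℂ A] [Nontrivial A] {r : A}
    (hr : IsSelfAdjoint r) : ∃ (M : ℝ) (d y : A), y ≠ 0 ∧
      algebraMap ℂ A M - r = star d * d ∧ star d * d * y = 0 := by
  let _ := CStarAlgebra.spectralOrder A
  have _ := CStarAlgebra.spectralOrderedRing A
  have hne : (spectrum ℝ r).Nonempty := ContinuousFunctionalCalculus.spectrum_nonempty r hr
  have hc : IsCompact (spectrum ℝ r) := spectrum.isCompact r
  obtain ⟨M, hM, hmax⟩ := hc.exists_isMaxOn hne continuousOn_id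
  have hle : r ≤ algebraMap ℝ A M := (le_algebraMap_iff_spectrum_le hr).2 fun x hx => hmax hx
  obtain ⟨d, hd⟩ := CStarAlgebra.nonneg_iff_eq_star_mul_self.1 (sub_nonneg.2 hle)
  have hMc : algebraMap ℂ A M = algebraMap ℝ A M := by
    rw [IsScalarTower.algebraMap_apply ℝ ℂ A]; rfl
  obtain ⟨y, hy, h0⟩ := exists_mul_eq_zero_of_not_isUnit (spectrum.mem_iff.1 hM)
  exact ⟨M, d, y, hy, hMc ▸ hd, hd ▸ h0⟩

theorem star_apply {φ : A →ₗ[ℂ] ℂ} (hφ : IsFaithfulPositive φ) (a : A) : φ (star a) = star (φ a) := by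
  have := hφ.conj_apply 1 a
  simpa using this.symm

theorem apply_sliceLeft (φ ψ : A →ₗ[ℂ] ℂ) (z : A ⊗[ℂ] A) :
    φ (sliceLeft ψ z) = ψ (sliceRight φ z) := by
  induction z with
  | zero => simp
  | add x y hx hy => simp only [map_add, hx, hy]
  | tmul x y => simp [mul_comm]

/-- By the Cauchy–Schwarz inequality, null vectors of a positive functional form a left ideal in
its kernel. -/
theorem apply_mul_eq_zero {h : A →ₗ[ℂ] ℂ} (hpos : ∀ a : A, 0 ≤ h (star a * a)) {z : A}
    (hz : h (star z * z) = 0) (c : A) : h (c * z) = 0 := by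
  let core : PreInnerProductSpace.Core ℂ A :=
    { inner := fun a b => h (star a * b)
      conj_inner_symm := fun a b => conj_apply_star_mul
        (fun a => (IsSelfAdjoint.of_nonneg (hpos a)).star_eq) b a
      re_inner_nonneg := fun a => (Complex.le_def.1 (hpos a)).1
      add_left := fun a b c => by simp [add_mul]
      smul_left := fun a b c => by simp }
  have key := @InnerProductSpace.Core.inner_mul_inner_self_le ℂ A _ _ _ core (star c) z
  have e1 : core.inner (star c) z = h (c * z) := by
    change h (star (star c) * z) = _
    rw [star_star]
  have e2 : core.inner z (star c) = star (h (c * z)) := by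
    rw [← e1]; exact (core.conj_inner_symm z (star c)).symm
  have e3 : core.inner z z = 0 := hz
  change ‖core.inner (star c) z‖ * ‖core.inner z (star c)‖ ≤ _ * RCLike.re (core.inner z z) at key
  rw [e1, e2, e3, norm_star, map_zero, mul_zero] at key
  exact norm_eq_zero.1 (mul_self_eq_zero.1 (le_antisymm key (mul_self_nonneg _)))

variable [FiniteQuantumGroup A]

local notation "Δ" => comul (R := ℂ) (A := A)
local notation "ε" => counit (R := ℂ) (A := A)

instance : FiniteDimensional ℂ A := finiteDimensional

/-- The right convolution operator `a ↦ (id ⊗ φ)Δ(a)`. -/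
def convOp (φ : A →ₗ[ℂ] ℂ) : A →ₗ[ℂ] A := sliceRight φ ∘ₗ Δ

theorem convOp_one (φ : A →ₗ[ℂ] ℂ) : convOp φ 1 = φ 1 • 1 := by
  simp [convOp, comul_one, Algebra.TensorProduct.one_def]

theorem convOp_convOp (φ ψ : A →ₗ[ℂ] ℂ) (a : A) :
    convOp ψ (convOp φ a) = convOp (φ ∘ₗ sliceLeft ψ ∘ₗ Δ) a := by
  let F : A ⊗[ℂ] (A ⊗[ℂ] A) →ₗ[ℂ] A := sliceRight (φ ∘ₗ sliceLeft ψ)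
  have h1 : ∀ z : A ⊗[ℂ] A, convOp ψ (sliceRight φ z) =
      F (TensorProduct.assoc ℂ A A A ((Δ).rTensor A z)) := by
    intro z
    induction z with
    | zero => simp
    | add x y hx hy => simp only [map_add, hx, hy]
    | tmul x y =>
      simp only [sliceRight_tmul, map_smul, convOp, LinearMap.comp_apply, LinearMap.rTensor_tmul]
      induction Δ x with
      | zero => simp
      | add p q hp hq => simp only [map_add, TensorProduct.add_tmul, smul_add, hp, hq]
      | tmul p q => simp [F, smul_smul, mul_comm]
  have h2 : ∀ z : A ⊗[ℂ] A, sliceRight (φ ∘ₗ sliceLeft ψ ∘ₗ Δ) z = F ((Δ).lTensor A z) := by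
    intro z
    induction z with
    | zero => simp
    | add x y hx hy => simp only [map_add, hx, hy]
    | tmul x y => simp [F]
  exact (h1 (Δ a)).trans ((congrArg F (coassoc_apply a)).trans (h2 (Δ a)).symm)

section State

variable {φ : A →ₗ[ℂ] ℂ}

theorem convOp_star (hφ : ∀ a, φ (star a) = star (φ a)) (a : A) :
    convOp φ (star a) = star (convOp φ a) := by
  have h : ∀ z : A ⊗[ℂ] A, sliceRight φ (star z) = star (sliceRight φ z) := by
    intro z
    induction z with
    | zero => simp
    | add x y hx hy => simp only [map_add, star_add, hx, hy]
    | tmul x y => simp [hφ]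
  rw [convOp, LinearMap.comp_apply, comul_star, h]; rfl

theorem apply_mul_convOp_mul (d y : A) :
    φ (star y * convOp φ (star d * d) * y) =
      (φ ∘ₗ sliceLeft φ) (star (Δ d * (y ⊗ₜ 1)) * (Δ d * (y ⊗ₜ 1))) := by
  have h : ∀ z : A ⊗[ℂ] A, φ (star y * sliceRight φ z * y) =
      φ (sliceLeft φ ((star y ⊗ₜ 1) * z * (y ⊗ₜ 1))) := by
    intro z
    induction z with
    | zero => simp
    | add x y hx hy => simp only [map_add, mul_add, add_mul, hx, hy]
    | tmul p q => simp [mul_comm]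
  rw [convOp, LinearMap.comp_apply, h, comul_mul, comul_star]
  simp [mul_assoc]

/-- The maximum principle for the convolution operator `T` of a faithful state: `T(r) - r` is never
bounded below by a positive scalar. If `M` is the largest spectral value of `r` and `M - r = d*d`
annihilates `y ≠ 0`, then `φ(y* T(d*d) y) ≥ 0` prevents `T(r)` from exceeding `M` at `y`. -/
theorem not_convOp_sub_eq (hφ : IsFaithfulPositive φ) (h1 : φ 1 = 1) {r p : A}
    (hr : IsSelfAdjoint r) {s : ℝ} (hs : 0 < s) :
    convOp φ r - r ≠ star p * p + algebraMap ℂ A s := by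
  intro h
  have _ := nontrivial (A := A)
  obtain ⟨M, d, y, hy, hd, h0⟩ := exists_real_sub_eq_star_mul_self hr
  have key := (hφ.tensor hφ).nonneg (Δ d * (y ⊗ₜ 1))
  rw [← apply_mul_convOp_mul, ← hd, map_sub, Algebra.algebraMap_eq_smul_one, map_smul, convOp_one,
    h1, one_smul, sub_eq_iff_eq_add.1 h] at key
  have e : star y * ((M : ℂ) • (1 : A) - (star p * p + algebraMap ℂ A s + r)) * y =
      star y * (star d * d * y) - star (p * y) * (p * y) - (s : ℂ) • (star y * y) := by
    rw [← mul_assoc (star y), ← hd, Algebra.algebraMap_eq_smul_one, Algebra.algebraMap_eq_smul_one]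
    simp only [mul_sub, sub_mul, mul_add, add_mul, star_mul, mul_smul_comm, smul_mul_assoc, mul_one,
      mul_assoc]
    abel
  rw [e, h0, mul_zero, zero_sub, map_sub, map_neg, map_smul, smul_eq_mul] at key
  have k1 := (Complex.le_def.1 key).1
  have k2 := (Complex.le_def.1 (hφ.nonneg (p * y))).1
  have k3 := Complex.le_def.1 (hφ.nonneg y)
  have k4 : (φ (star y * y)).re ≠ 0 := fun h' => hy (hφ.eq_zero y (Complex.ext h' k3.2.symm))
  have k5 : 0 < (φ (star y * y)).re := lt_of_le_of_ne k3.1 (Ne.symm k4)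
  simp only [Complex.zero_re, Complex.sub_re, Complex.neg_re, Complex.re_ofReal_mul] at k1 k2
  have := mul_pos hs k5
  linarith

/-- Equality in the maximum principle: if `T(r) = r`, then `φ(y* T(d*d) y) = 0`, so `Δ(d)(y ⊗ 1) = 0`
by faithfulness and `d = 0`. -/
theorem eq_algebraMap_of_convOp_eq_of_isSelfAdjoint (hφ : IsFaithfulPositive φ) (h1 : φ 1 = 1)
    {r : A} (hr : IsSelfAdjoint r) (h : convOp φ r = r) : ∃ c : ℂ, r = c • 1 := by
  have _ := nontrivial (A := A)
  obtain ⟨M, d, y, hy, hd, h0⟩ := exists_real_sub_eq_star_mul_self hr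
  have key := apply_mul_convOp_mul (φ := φ) d y
  have e : convOp φ (star d * d) = star d * d := by
    rw [← hd, map_sub, h, Algebra.algebraMap_eq_smul_one, map_smul, convOp_one, h1, one_smul]
  rw [e, mul_assoc, h0, mul_zero, map_zero] at key
  have hd0 := eq_zero_of_comul_mul_tmul_one hy ((hφ.tensor hφ).eq_zero _ key.symm)
  rw [hd0, mul_zero, sub_eq_zero] at hd
  exact ⟨M, by rw [← hd, Algebra.algebraMap_eq_smul_one]⟩

open ComplexStarModule in
theorem eq_smul_one_of_convOp_eq (hφ : IsFaithfulPositive φ) (h1 : φ 1 = 1)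
    {r : A} (h : convOp φ r = r) : ∃ c : ℂ, r = c • 1 := by
  have hs : convOp φ (star r) = star r := by rw [convOp_star (star_apply hφ), h]
  obtain ⟨c, hc⟩ := eq_algebraMap_of_convOp_eq_of_isSelfAdjoint hφ h1
    (ℜ r).2 (by rw [realPart_apply_coe, ← Complex.coe_smul, map_smul, map_add, h, hs])
  obtain ⟨c', hc'⟩ := eq_algebraMap_of_convOp_eq_of_isSelfAdjoint hφ h1
    (ℑ r).2 (by
      rw [imaginaryPart_apply_coe, ← Complex.coe_smul, map_smul, map_smul, map_sub, h, hs])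
  refine ⟨c + Complex.I * c', ?_⟩
  conv_lhs => rw [← realPart_add_I_smul_imaginaryPart r, hc, hc']
  rw [add_smul, mul_smul]

open ComplexStarModule in
theorem one_notMem_range_convOp_sub (hφ : IsFaithfulPositive φ) (h1 : φ 1 = 1) :
    (1 : A) ∉ LinearMap.range (convOp φ - LinearMap.id) := by
  rintro ⟨r, hr⟩
  rw [LinearMap.sub_apply, LinearMap.id_apply] at hr
  refine not_convOp_sub_eq hφ h1 (p := 0) (ℜ r).2 one_pos ?_
  have hs : convOp φ (star r) - star r = 1 := by
    rw [convOp_star (star_apply hφ), ← star_sub, hr, star_one]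
  rw [realPart_apply_coe, ← Complex.coe_smul, map_smul, map_add, ← smul_sub, add_sub_add_comm,
    hr, hs, ← two_smul ℂ (1 : A), smul_smul]
  simp

/-- The invariant functional of the convolution operator. As its fixed points are the scalars and
`1` is not of the form `φ∗r - r`, the algebra decomposes as `ℂ1 ⊕ {φ∗r - r}`. -/
theorem exists_functional (hφ : IsFaithfulPositive φ) (h1 : φ 1 = 1) :
    ∃ h : A →ₗ[ℂ] ℂ, h 1 = 1 ∧ (∀ r, h (convOp φ r) = h r) ∧
      ∀ a, ∃ r, a = h a • 1 + (convOp φ r - r) := by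
  have _ := nontrivial (A := A)
  set D : A →ₗ[ℂ] A := convOp φ - LinearMap.id with hD
  obtain ⟨f, hf, hle⟩ := Submodule.exists_le_ker_of_notMem (one_notMem_range_convOp_sub hφ h1)
  have hfh : ∀ r, f (convOp φ r) = f r := fun r => by
    have := hle ⟨r, rfl⟩
    rw [LinearMap.mem_ker, LinearMap.sub_apply, map_sub, sub_eq_zero] at this
    exact this
  have hker : LinearMap.ker D = Submodule.span ℂ {1} := by
    refine le_antisymm (fun r hr => ?_) ?_
    · obtain ⟨c, rfl⟩ := eq_smul_one_of_convOp_eq hφ h1 (r := r) (by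
        rw [LinearMap.mem_ker, LinearMap.sub_apply, sub_eq_zero] at hr
        exact hr)
      exact Submodule.smul_mem _ _ (Submodule.mem_span_singleton_self _)
    · rw [Submodule.span_singleton_le_iff_mem, LinearMap.mem_ker, hD, LinearMap.sub_apply,
        convOp_one, h1, one_smul, LinearMap.id_apply, sub_self]
  have hr1 := D.finrank_range_add_finrank_ker
  have hr2 := f.finrank_range_add_finrank_ker
  rw [hker, finrank_span_singleton one_ne_zero] at hr1
  rw [LinearMap.range_eq_top.2 (LinearMap.surjective (fun h' => hf (by rw [h']; rfl))),
    finrank_top, Module.finrank_self] at hr2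
  have heq : LinearMap.range D = LinearMap.ker f :=
    Submodule.eq_of_le_of_finrank_eq hle (by omega)
  refine ⟨(f 1)⁻¹ • f, by simp [hf], fun r => by simp [hfh], fun a => ?_⟩
  have : a - ((f 1)⁻¹ • f) a • (1 : A) ∈ LinearMap.range D := by
    rw [heq, LinearMap.mem_ker]
    simp [hf, mul_comm]
  obtain ⟨r, hr⟩ := this
  exact ⟨r, by rw [LinearMap.sub_apply, LinearMap.id_apply] at hr; rw [hr]; abel⟩

end State

open ComplexStarModule in
variable (A) in
/-- The functional fixed by the convolution operator of a faithful state is a left invariant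
state. -/
theorem exists_left_invariant_state : ∃ h : A →ₗ[ℂ] ℂ, (∀ a : A, 0 ≤ h (star a * a)) ∧ h 1 = 1 ∧
    ∀ a : A, sliceRight h (Δ a) = algebraMap ℂ A (h a) := by
  have _ := nontrivial (A := A)
  obtain ⟨φ, hφ, h1⟩ := exists_faithful_state (A := A)
  obtain ⟨h, hh1, hinv, hdec⟩ := exists_functional hφ h1
  have hstar : ∀ a, h (star a) = star (h a) := fun a => by
    obtain ⟨r, hr⟩ := hdec a
    conv_lhs => rw [hr]
    rw [star_add, star_sub, ← convOp_star (star_apply hφ), map_add, map_sub, hinv, sub_self,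
      add_zero, star_smul, star_one, map_smul, hh1, smul_eq_mul, mul_one]
  refine ⟨h, fun a => ?_, hh1, fun a => ?_⟩
  · have him : (h (star a * a)).im = 0 := by
      have := hstar (star a * a)
      rw [star_mul, star_star] at this
      exact Complex.conj_eq_iff_im.1 this.symm
    refine Complex.le_def.2 ⟨?_, him.symm⟩
    by_contra! hneg
    rw [Complex.zero_re] at hneg
    obtain ⟨r, hr⟩ := hdec (star a * a)
    have hre : ((h (star a * a)).re : ℂ) = h (star a * a) := Complex.ext rfl (by simp [him])
    rw [← hre] at hr
    have hr' := congrArg star hr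
    rw [star_add, star_sub, ← convOp_star (star_apply hφ), star_mul, star_star, star_smul, star_one,
      Complex.star_def, Complex.conj_ofReal] at hr'
    -- a negative value `h(a*a)` would contradict the maximum principle for the real part of `r`
    refine not_convOp_sub_eq hφ h1 (p := a) (ℜ r).2 (neg_pos.2 hneg) ?_
    rw [realPart_apply_coe, ← Complex.coe_smul, map_smul, map_add, ← smul_sub, add_sub_add_comm,
      ← sub_eq_iff_eq_add'.2 hr, ← sub_eq_iff_eq_add'.2 hr', ← two_smul ℂ, smul_smul,
      Algebra.algebraMap_eq_smul_one]
    simp [sub_eq_add_neg]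
  · obtain ⟨r, hr⟩ := hdec a
    have hcomp : φ ∘ₗ sliceLeft h ∘ₗ Δ = h := LinearMap.ext fun x =>
      (apply_sliceLeft φ h (Δ x)).trans (hinv x)
    calc convOp h a = convOp h (h a • 1 + (convOp φ r - r)) := congrArg _ hr
      _ = h a • 1 := by
        rw [map_add, map_sub, map_smul, convOp_one, hh1, one_smul, convOp_convOp, hcomp, sub_self,
          add_zero]
      _ = _ := (Algebra.algebraMap_eq_smul_one _).symm

variable (A) in
/-- A left invariant state for the opposite coproduct is right invariant, and a left invariant
functional coincides with every right invariant one. -/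
theorem exists_isHaarState : ∃ h : A →ₗ[ℂ] ℂ, IsHaarState A h := by
  obtain ⟨h, hpos, h1, hl⟩ := exists_left_invariant_state A
  obtain ⟨k, -, k1, kr⟩ := @exists_left_invariant_state A _ (cop A)
  have hcomm : ∀ z : A ⊗[ℂ] A, sliceRight k (TensorProduct.comm ℂ A A z) = sliceLeft k z := by
    intro z
    induction z with
    | zero => simp
    | add x y hx hy => simp only [map_add, hx, hy]
    | tmul x y => simp
  have kr' : ∀ a, sliceLeft k (Δ a) = algebraMap ℂ A (k a) := fun a =>
    (hcomm (Δ a)).symm.trans (kr a)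
  have hk : k = h := LinearMap.ext fun a => by
    have := apply_sliceLeft h k (Δ a)
    rw [hl, kr', Algebra.algebraMap_eq_smul_one, Algebra.algebraMap_eq_smul_one, map_smul, map_smul,
      h1, k1] at this
    simpa using this
  exact ⟨h, hpos, h1, hl, hk ▸ kr'⟩

variable (A) in
theorem isHaarState_haarState : IsHaarState A (haarState A) :=
  Classical.epsilon_spec (exists_isHaarState A)

/-- A Haar state is faithful: if `h(a*a) = 0`, invariance gives `(id ⊗ h)((1 ⊗ c)Δ(a)) = 0` for all
`c`, and contracting `a₁ ⊗ a₂ ⊗ a₃` to `a₁ h(S(a₂)a₃) = a` yields `a = 0`. -/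
theorem _root_.IsHaarState.isFaithfulPositive {h : A →ₗ[ℂ] ℂ} (hh : IsHaarState A h) :
    IsFaithfulPositive h := by
  refine ⟨hh.nonneg, fun a ha => ?_⟩
  have _ := nontrivial (A := A)
  obtain ⟨φ, hφ, -⟩ := exists_faithful_state (A := A)
  obtain ⟨n, e, he⟩ := hφ.exists_orthonormal
  have h0 : h (sliceLeft φ (star (Δ a) * Δ a)) = 0 := by
    rw [← comul_star, ← comul_mul, apply_sliceLeft, hh.left_inv, ha, map_zero, map_zero]
  rw [he.slice_star_mul, map_sum, Finset.sum_eq_zero_iff_of_nonneg fun i _ => hh.nonneg _] at h0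
  let W : A ⊗[ℂ] (A ⊗[ℂ] A) →ₗ[ℂ] A :=
    sliceRight (h ∘ₗ LinearMap.mul' ℂ A ∘ₗ antipode.rTensor A)
  have hW : ∀ z : A ⊗[ℂ] A, W ((Δ).lTensor A z) =
      TensorProduct.rid ℂ A ((counit (R := ℂ)).lTensor A z) := by
    intro z
    induction z with
    | zero => simp
    | add x y hx hy => simp only [map_add, hx, hy]
    | tmul x y =>
      have := LinearMap.congr_fun (mul_antipode_rTensor_comul (A := A)) y
      simp only [LinearMap.comp_apply] at this
      simp [W, this, Algebra.algebraMap_eq_smul_one, hh.map_one]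
  have hW2 : ∀ (t : A ⊗[ℂ] A) (z : A), h (star z * z) = 0 →
      W (TensorProduct.assoc ℂ A A A (t ⊗ₜ z)) = 0 := by
    intro t z hz
    induction t with
    | zero => simp
    | add x y hx hy => simp only [map_add, TensorProduct.add_tmul, hx, hy, add_zero]
    | tmul x y => simp [W, apply_mul_eq_zero hh.nonneg hz]
  have h1 := hW (Δ a)
  rw [lTensor_counit_comul, ← coassoc_apply, ← e.sum_tmul_slice (Δ a)] at h1
  rw [map_sum, map_sum, map_sum, Finset.sum_eq_zero fun i _ => by
    rw [LinearMap.rTensor_tmul]; exact hW2 _ _ (h0 i (Finset.mem_univ i))] at h1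
  simpa using h1.symm

end FiniteQuantumGroup

/-! ### Jointly injective families of star-homomorphisms -/

/-- A jointly injective family of star-homomorphisms of C*-algebras computes the norm: it gives an
injective, hence isometric, star-homomorphism into the `ℓ^∞` product. -/
theorem norm_le_of_jointly_injective {C : Type*} [CStarAlgebra C] {ι : Type*} {E : ι → Type*}
    [∀ i, CStarAlgebra (E i)] (f : ∀ i, C →⋆ₐ[ℂ] E i) (hf : ∀ c, (∀ i, f i c = 0) → c = 0)
    {M : ℝ} (hM : 0 ≤ M) {c : C} (h : ∀ i, ‖f i c‖ ≤ M) : ‖c‖ ≤ M := by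
  let F : C →⋆ₙₐ[ℂ] lp E ⊤ :=
    { toFun := fun x => ⟨fun i => f i x, memℓp_infty ⟨‖x‖, by
        rintro _ ⟨i, rfl⟩
        exact NonUnitalStarAlgHom.norm_apply_le (f i) x⟩⟩
      map_smul' := fun c x => by ext i; simp
      map_zero' := by ext i; simp
      map_add' := fun x y => by ext i; exact map_add (f i) x y
      map_mul' := fun x y => by ext i; simp
      map_star' := fun x => by ext i; simp [map_star] }
  have hF : Function.Injective F := (injective_iff_map_eq_zero F).2 fun x hx => hf x fun i =>
    congrFun (congrArg (fun y : lp E ⊤ => (y : ∀ i, E i)) hx) i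
  rw [← NonUnitalStarAlgHom.norm_map F hF c]
  exact lp.norm_le_of_forall_le hM h

/-- A family of star-homomorphisms on a completion that computes the defining seminorm is jointly
injective. -/
theorem CStarSeminorm.eq_zero_of_forall {D : Type u} [Ring D] [StarRing D] [Algebra ℂ D]
    [StarModule ℂ D] (p : CStarSeminorm D) {ι : Type*} {E : ι → Type*} [∀ i, CStarAlgebra (E i)]
    (f : ∀ i, p.Completion →⋆ₐ[ℂ] E i)
    (hp : ∀ (x : D) (M : ℝ), 0 ≤ M → (∀ i, ‖f i (p.incl x)‖ ≤ M) → p.toFun x ≤ M)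
    {x : p.Completion} (hx : ∀ i, f i x = 0) : x = 0 := by
  rw [← norm_le_zero_iff]
  refine le_of_forall_pos_le_add fun δ hδ => ?_
  obtain ⟨d, hd⟩ := p.denseRange_incl.exists_dist_lt x (half_pos hδ)
  rw [dist_eq_norm] at hd
  have h1 : p.toFun d ≤ δ / 2 := hp d _ (half_pos hδ).le fun i => by
    have : f i (p.incl d) = - f i (x - p.incl d) := by rw [map_sub, hx, zero_sub, neg_neg]
    rw [this, norm_neg]
    exact (NonUnitalStarAlgHom.norm_apply_le (f i) _).trans hd.le
  calc ‖x‖ = ‖(x - p.incl d) + p.incl d‖ := by rw [sub_add_cancel]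
    _ ≤ ‖x - p.incl d‖ + ‖p.incl d‖ := norm_add_le _ _
    _ ≤ δ / 2 + δ / 2 := by rw [p.norm_incl]; exact add_le_add hd.le h1
    _ = 0 + δ := by ring

/-! ### Representations of tensor products and of matrix algebras -/

theorem ContinuousLinearMap.norm_completion_le {V : Type*} [NormedAddCommGroup V]
    [InnerProductSpace ℂ V] (T : V →L[ℂ] V) : ‖T.completion‖ ≤ ‖T‖ := by
  refine ContinuousLinearMap.opNorm_le_bound _ (norm_nonneg _) fun x => ?_
  induction x using UniformSpace.Completion.induction_on with
  | hp => exact isClosed_le (by fun_prop) (by fun_prop)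
  | ih x =>
    rw [ContinuousLinearMap.completion_apply_coe, UniformSpace.Completion.norm_coe,
      UniformSpace.Completion.norm_coe]
    exact T.le_opNorm x

namespace HilbertRep

section Tensor

variable {A : Type u} [CStarAlgebra A] {B : Type v} [CStarAlgebra B]

open UniformSpace.Completion in
/-- The representation `π ⊗ ρ` of the algebraic tensor product on the completed tensor product of
the Hilbert spaces. -/
def tensorCompletion (P : HilbertRep A) (Q : HilbertRep B) : A ⊗[ℂ] B →⋆ₐ[ℂ]
    (UniformSpace.Completion (P.space ⊗[ℂ] Q.space) →L[ℂ]
      UniformSpace.Completion (P.space ⊗[ℂ] Q.space)) where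
  toFun x := (P.tensor Q x).completion
  map_one' := by
    ext v
    induction v using induction_on with
    | hp => apply isClosed_eq <;> fun_prop
    | ih v => simp
  map_mul' x y := by
    ext v
    induction v using induction_on with
    | hp => apply isClosed_eq <;> fun_prop
    | ih v => simp
  map_zero' := by
    ext v
    induction v using induction_on with
    | hp => apply isClosed_eq <;> fun_prop
    | ih v => simp
  map_add' x y := by
    ext v
    induction v using induction_on with
    | hp => apply isClosed_eq <;> fun_prop
    | ih v => simp [coe_add]
  commutes' c := by
    ext v
    induction v using induction_on with
    | hp => apply isClosed_eq <;> fun_prop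
    | ih v => simp [Algebra.algebraMap_eq_smul_one, coe_smul]
  map_star' x := by
    refine (ContinuousLinearMap.eq_adjoint_iff _ _).2 fun v w => ?_
    induction v, w using induction_on₂ with
    | hp => apply isClosed_eq <;> fun_prop
    | ih v w => simp [inner_tensor_star]

theorem norm_tensorCompletion_le (P : HilbertRep A) (Q : HilbertRep B) (x : A ⊗[ℂ] B) :
    ‖P.tensorCompletion Q x‖ ≤ spatialNorm x :=
  (ContinuousLinearMap.norm_completion_le _).trans (le_spatialNorm x P Q)

/-- The representation `π ⊗ ρ` of the spatial tensor product. -/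
def spatial (P : HilbertRep A) (Q : HilbertRep B) : HilbertRep (SpatialTensor A B) where
  space := UniformSpace.Completion (P.space ⊗[ℂ] Q.space)
  rep := (spatialSeminorm A B).extend (P.tensorCompletion Q) (P.norm_tensorCompletion_le Q)

/-- The embedding of the algebraic tensor product of the Hilbert spaces into the space of the
representation `π ⊗ ρ`. -/
def spatialEmbedding (P : HilbertRep A) (Q : HilbertRep B) :
    P.space ⊗[ℂ] Q.space →ₗᵢ[ℂ] (P.spatial Q).space :=
  UniformSpace.Completion.toComplₗᵢ

theorem denseRange_spatialEmbedding (P : HilbertRep A) (Q : HilbertRep B) :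
    DenseRange (P.spatialEmbedding Q) :=
  UniformSpace.Completion.denseRange_coe

theorem spatial_incl_apply (P : HilbertRep A) (Q : HilbertRep B) (x : A ⊗[ℂ] B)
    (v : P.space ⊗[ℂ] Q.space) :
    (P.spatial Q).rep (SpatialTensor.incl A B x) (P.spatialEmbedding Q v) =
      P.spatialEmbedding Q (P.tensor Q x v) := by
  have h : (P.spatial Q).rep (SpatialTensor.incl A B x) = P.tensorCompletion Q x :=
    (spatialSeminorm A B).extend_incl _ (P.norm_tensorCompletion_le Q) x
  rw [h]
  exact ContinuousLinearMap.completion_apply_coe _ _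

theorem norm_tensor_le_norm_spatial (P : HilbertRep A) (Q : HilbertRep B) (x : A ⊗[ℂ] B) :
    ‖P.tensor Q x‖ ≤ ‖(P.spatial Q).rep (SpatialTensor.incl A B x)‖ := by
  refine ContinuousLinearMap.opNorm_le_bound _ (norm_nonneg _) fun v => ?_
  rw [← (P.spatialEmbedding Q).norm_map, ← spatial_incl_apply,
    ← (P.spatialEmbedding Q).norm_map v]
  exact ContinuousLinearMap.le_opNorm _ _

theorem spatial_jointly_injective {x : SpatialTensor A B}
    (h : ∀ PQ : HilbertRep A × HilbertRep B, (PQ.1.spatial PQ.2).rep x = 0) : x = 0 :=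
  (spatialSeminorm A B).eq_zero_of_forall (ι := HilbertRep A × HilbertRep B)
    (fun PQ => (PQ.1.spatial PQ.2).rep)
    (fun x _ hM hx => Real.iSup_le
      (fun PQ => (norm_tensor_le_norm_spatial PQ.1 PQ.2 x).trans (hx PQ)) hM) h

end Tensor

section Matrix

variable {C : Type u} [CStarAlgebra C]

/-- The amplification of a representation of `C` to `k × k` matrices over `C`, acting on the direct
sum of `k` copies of the Hilbert space. -/
def amplify (R : HilbertRep C) (k : ℕ) : CStarMatrix (Fin k) (Fin k) C →⋆ₐ[ℂ]
    (PiLp 2 (fun _ : Fin k => R.space) →L[ℂ] PiLp 2 (fun _ : Fin k => R.space)) :=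
  let op : CStarMatrix (Fin k) (Fin k) C →
      (PiLp 2 (fun _ : Fin k => R.space) →L[ℂ] PiLp 2 (fun _ : Fin k => R.space)) := fun c =>
    (PiLp.continuousLinearEquiv 2 ℂ (fun _ : Fin k => R.space)).symm.toContinuousLinearMap ∘L
      ContinuousLinearMap.pi fun i => ∑ j, R.rep (c i j) ∘L PiLp.proj 2 (fun _ => R.space) j
  have hop : ∀ c v i, op c v i = ∑ j, R.rep (c i j) (v j) := fun c v i => by
    simp [op]
  have hone : op 1 = 1 := by
    ext v i
    rw [hop, Finset.sum_eq_single i (fun j _ hj => by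
      rw [CStarMatrix.one_apply_ne hj.symm, map_zero, zero_apply])
      (fun h => absurd (Finset.mem_univ i) h), CStarMatrix.one_apply_eq, map_one]
    rfl
  { toFun := op
    map_one' := hone
    map_mul' := fun c d => by
      ext v i
      rw [mul_apply_eq_comp, hop, hop]
      simp only [hop, CStarMatrix.mul_apply, map_sum, map_mul, sum_apply,
        mul_apply_eq_comp]
      exact Finset.sum_comm
    map_zero' := by
      ext v i
      rw [hop]; simp
    map_add' := fun c d => by
      ext v i
      rw [add_apply, PiLp.add_apply, hop, hop, hop]
      simp [Finset.sum_add_distrib]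
    commutes' := fun a => by
      rw [Algebra.algebraMap_eq_smul_one, Algebra.algebraMap_eq_smul_one, ← hone]
      ext v i
      rw [smul_apply, PiLp.smul_apply, hop, hop]
      simp [Finset.smul_sum]
    map_star' := fun c => by
      refine (ContinuousLinearMap.eq_adjoint_iff _ _).2 fun v w => ?_
      simp only [PiLp.inner_apply, hop, sum_inner, inner_sum]
      rw [Finset.sum_comm]
      refine Finset.sum_congr rfl fun i _ => Finset.sum_congr rfl fun j _ => ?_
      rw [CStarMatrix.star_apply, map_star, ContinuousLinearMap.star_eq_adjoint,
        ContinuousLinearMap.adjoint_inner_left] }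

theorem amplify_apply (R : HilbertRep C) {k : ℕ} (c : CStarMatrix (Fin k) (Fin k) C)
    (v : PiLp 2 (fun _ : Fin k => R.space)) (i : Fin k) :
    R.amplify k c v i = ∑ j, R.rep (c i j) (v j) := by
  simp [amplify]

/-- A jointly injective family of representations of `C` computes the norm of matrices over `C`:
amplifications preserve joint injectivity. -/
theorem norm_amplify_le {ι : Type*} (ρ : ι → HilbertRep C)
    (hρ : ∀ c, (∀ i, (ρ i).rep c = 0) → c = 0) {k : ℕ} (c : CStarMatrix (Fin k) (Fin k) C) {M : ℝ}
    (hM : 0 ≤ M) (h : ∀ i, ‖(ρ i).amplify k c‖ ≤ M) (R : HilbertRep C) : ‖R.amplify k c‖ ≤ M := by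
  let _ := CStarAlgebra.spectralOrder C
  have _ := CStarAlgebra.spectralOrderedRing C
  refine (NonUnitalStarAlgHom.norm_apply_le (R.amplify k) c).trans ?_
  refine norm_le_of_jointly_injective (fun i => (ρ i).amplify k) (fun d hd => ?_) hM h
  refine CStarMatrix.ext fun r s => hρ _ fun i => ?_
  ext ζ
  have h1 := congrArg (fun T => T (PiLp.single 2 s ζ) r) (hd i)
  simpa [amplify_apply, PiLp.single_apply, apply_ite] using h1

end Matrix

end HilbertRep

/-! ### The spatial norm and jointly injective families of representations -/

section Decomposition

variable {H K : Type*} [NormedAddCommGroup H] [InnerProductSpace ℂ H] [NormedAddCommGroup K]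
  [InnerProductSpace ℂ K]

theorem norm_le_of_norm_inner_self_le {v : H} {c : ℝ} (hc : 0 ≤ c)
    (h : ‖(inner ℂ v v : ℂ)‖ ≤ ‖v‖ * c) : ‖v‖ ≤ c := by
  rw [inner_self_eq_norm_sq_to_K, norm_pow, RCLike.norm_ofReal, abs_norm, sq] at h
  rcases (norm_nonneg v).eq_or_lt with h0 | h0
  · rwa [← h0]
  · exact le_of_mul_le_mul_left h h0

theorem norm_sum_tmul_of_orthonormal {k : ℕ} {ξ : Fin k → H} (hξ : Orthonormal ℂ ξ)
    (ζ : PiLp 2 (fun _ : Fin k => K)) : ‖∑ s, ξ s ⊗ₜ[ℂ] ζ s‖ = ‖ζ‖ := by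
  have h : inner ℂ (∑ s, ξ s ⊗ₜ[ℂ] ζ s) (∑ s, ξ s ⊗ₜ[ℂ] ζ s) = inner ℂ ζ ζ := by
    rw [PiLp.inner_apply, sum_inner]
    refine Finset.sum_congr rfl fun i _ => ?_
    rw [inner_sum, Finset.sum_eq_single i]
    · rw [TensorProduct.inner_tmul, orthonormal_iff_ite.1 hξ, if_pos rfl, one_mul]
    · intro j _ hj
      rw [TensorProduct.inner_tmul, orthonormal_iff_ite.1 hξ, if_neg hj.symm, zero_mul]
    · simp
  rw [@norm_eq_sqrt_re_inner ℂ, @norm_eq_sqrt_re_inner ℂ _ _ _ _ ζ, h]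

theorem exists_orthonormal_tmul_decomposition (v w : H ⊗[ℂ] K) :
    ∃ (k : ℕ) (ξ : Fin k → H), Orthonormal ℂ ξ ∧
      ∃ ζ ω : PiLp 2 (fun _ : Fin k => K), v = ∑ s, ξ s ⊗ₜ ζ s ∧ w = ∑ s, ξ s ⊗ₜ ω s := by
  obtain ⟨F, hF, hsub⟩ := TensorProduct.exists_finite_submodule_left_of_setFinite
    ({v, w} : Set (H ⊗[ℂ] K)) (Set.toFinite _)
  let b := stdOrthonormalBasis ℂ F
  have key : ∀ t : F ⊗[ℂ] K, ∃ ζ : PiLp 2 (fun _ : Fin (Module.finrank ℂ F) => K),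
      F.subtype.rTensor K t = ∑ s, (b s : H) ⊗ₜ[ℂ] ζ s := fun t => by
    refine ⟨WithLp.toLp 2 fun s => sliceLeft (b.toBasis.coord s) t, ?_⟩
    conv_lhs => rw [← b.toBasis.sum_tmul_slice t]
    simp
  obtain ⟨tv, htv⟩ := hsub (Set.mem_insert v _)
  obtain ⟨tw, htw⟩ := hsub (Set.mem_insert_of_mem v rfl)
  obtain ⟨ζ, hζ⟩ := key tv
  obtain ⟨ω, hω⟩ := key tw
  exact ⟨_, fun s => (b s : H), b.orthonormal.comp_linearIsometry F.subtypeₗᵢ, ζ, ω,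
    htv ▸ hζ, htw ▸ hω⟩

end Decomposition

namespace HilbertRep

variable {A : Type u} [CStarAlgebra A] {C : Type v} [CStarAlgebra C]

/-- The matrix coefficient `a ↦ ⟨ξ, π(a)ξ'⟩`. -/
def coeff (P : HilbertRep A) (ξ ξ' : P.space) : A →ₗ[ℂ] ℂ where
  toFun a := inner ℂ ξ (P.rep a ξ')
  map_add' a b := by simp
  map_smul' c a := by simp

/-- The compression of `y ∈ A ⊗ C` by the vectors `ξ`, a matrix over `C`. -/
def compress (P : HilbertRep A) {k : ℕ} (ξ : Fin k → P.space) :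
    A ⊗[ℂ] C →ₗ[ℂ] CStarMatrix (Fin k) (Fin k) C where
  toFun y := CStarMatrix.ofMatrix fun r s => sliceLeft (P.coeff (ξ r) (ξ s)) y
  map_add' x y := CStarMatrix.ext fun r s =>
    map_add (sliceLeft (P.coeff (ξ r) (ξ s))) x y
  map_smul' c y := CStarMatrix.ext fun r s =>
    map_smul (sliceLeft (P.coeff (ξ r) (ξ s))) c y

theorem compress_tmul (P : HilbertRep A) {k : ℕ} (ξ : Fin k → P.space) (a : A) (c : C)
    (r s : Fin k) :
    P.compress ξ (a ⊗ₜ[ℂ] c) r s = (inner ℂ (ξ r) (P.rep a (ξ s)) : ℂ) • c :=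
  sliceLeft_tmul (P.coeff (ξ r) (ξ s)) a c

theorem inner_tensor_sum_tmul (P : HilbertRep A) (R : HilbertRep C) {k : ℕ} (ξ : Fin k → P.space)
    (y : A ⊗[ℂ] C) (ω ζ : PiLp 2 (fun _ : Fin k => R.space)) :
    inner ℂ (∑ r, ξ r ⊗ₜ[ℂ] ω r) (P.tensor R y (∑ s, ξ s ⊗ₜ[ℂ] ζ s)) =
      inner ℂ ω (R.amplify k (P.compress ξ y) ζ) := by
  induction y with
  | zero => simp
  | add x y hx hy => simp only [map_add, add_apply, inner_add_right, hx, hy]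
  | tmul a c =>
    simp only [PiLp.inner_apply, amplify_apply, sum_inner, inner_sum, map_sum]
    rw [Finset.sum_comm]
    refine Finset.sum_congr rfl fun r _ => Finset.sum_congr rfl fun s _ => ?_
    rw [compress_tmul]
    simp [tensor_tmul, inner_smul_right]

/-- The spatial norm can be computed with a jointly injective family of representations of the
second factor: compressing the first factor to finite-dimensional subspaces turns the
operators into matrices over `C`, and for these the family computes the norm. -/
theorem spatialNorm_le_of_jointly_injective {ι : Type*} (ρ : ι → HilbertRep C)
    (hρ : ∀ c, (∀ i, (ρ i).rep c = 0) → c = 0) (y : A ⊗[ℂ] C) {M : ℝ} (hM : 0 ≤ M)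
    (h : ∀ (P : HilbertRep A) (i : ι), ‖P.tensor (ρ i) y‖ ≤ M) : spatialNorm y ≤ M := by
  refine Real.iSup_le (fun PR => ?_) hM
  obtain ⟨P, R⟩ := PR
  change ‖P.tensor R y‖ ≤ M
  refine ContinuousLinearMap.opNorm_le_bound _ hM fun v => ?_
  obtain ⟨k, ξ, hξ, ζ, ω, hv, hw⟩ := exists_orthonormal_tmul_decomposition v (P.tensor R y v)
  have hc : ‖R.amplify k (P.compress ξ y)‖ ≤ M := by
    refine norm_amplify_le ρ hρ _ hM (fun i => ?_) R
    refine ContinuousLinearMap.opNorm_le_bound _ hM fun θ => ?_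
    refine norm_le_of_norm_inner_self_le (v := (ρ i).amplify k (P.compress ξ y) θ)
      (by positivity) ?_
    rw [← inner_tensor_sum_tmul]
    refine (norm_inner_le_norm (𝕜 := ℂ) (E := P.space ⊗[ℂ] (ρ i).space) _ _).trans ?_
    rw [norm_sum_tmul_of_orthonormal hξ, ← norm_sum_tmul_of_orthonormal hξ θ]
    refine mul_le_mul_of_nonneg_left ?_ (norm_nonneg _)
    exact (ContinuousLinearMap.le_opNorm _ _).trans
      (mul_le_mul_of_nonneg_right (h P i) (norm_nonneg _))
  refine norm_le_of_norm_inner_self_le (by positivity) ?_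
  have h1 := inner_tensor_sum_tmul P R ξ y ω ζ
  rw [← hv, ← hw] at h1
  rw [h1, hw, norm_sum_tmul_of_orthonormal hξ, hv, norm_sum_tmul_of_orthonormal hξ]
  refine (norm_inner_le_norm _ _).trans (mul_le_mul_of_nonneg_left ?_ (norm_nonneg _))
  exact (ContinuousLinearMap.le_opNorm _ _).trans (mul_le_mul_of_nonneg_right hc (norm_nonneg _))

end HilbertRep

/-! ### The associator of the spatial tensor product -/

section Legs

variable (A B : Type*) [Ring A] [StarRing A] [Algebra ℂ A] [StarModule ℂ A] [Ring B] [StarRing B]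
  [Algebra ℂ B] [StarModule ℂ B]

/-- The embedding `a ↦ a ⊗ 1` into the algebraic tensor product. -/
def starIncludeLeft : A →⋆ₐ[ℂ] A ⊗[ℂ] B :=
  { (Algebra.TensorProduct.includeLeft : A →ₐ[ℂ] A ⊗[ℂ] B) with
    map_star' := fun a => by simp }

/-- The embedding `b ↦ 1 ⊗ b` into the algebraic tensor product. -/
def starIncludeRight : B →⋆ₐ[ℂ] A ⊗[ℂ] B :=
  { (Algebra.TensorProduct.includeRight : B →ₐ[ℂ] A ⊗[ℂ] B) with
    map_star' := fun a => by simp }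

end Legs

namespace SpatialTensor

section

variable {A : Type u} {B : Type v} [CStarAlgebra A] [CStarAlgebra B]

theorem tmul_mul_tmul (a a' : A) (b b' : B) : tmul a b * tmul a' b' = tmul (a * a') (b * b') := by
  rw [tmul, tmul, ← map_mul, Algebra.TensorProduct.tmul_mul_tmul]; rfl

variable (A B) in
/-- The embedding `a ↦ a ⊗ 1` into the spatial tensor product. -/
def includeLeft : A →⋆ₐ[ℂ] SpatialTensor A B := (incl A B).comp (starIncludeLeft A B)

variable (A B) in
/-- The embedding `b ↦ 1 ⊗ b` into the spatial tensor product. -/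
def includeRight : B →⋆ₐ[ℂ] SpatialTensor A B := (incl A B).comp (starIncludeRight A B)

theorem includeLeft_apply (a : A) : includeLeft A B a = tmul a 1 := rfl

theorem includeRight_apply (b : B) : includeRight A B b = tmul 1 b := rfl

theorem norm_incl_tmul_le (a : A) (b : B) : ‖incl A B (a ⊗ₜ b)‖ ≤ ‖a‖ * ‖b‖ := by
  have h : incl A B (a ⊗ₜ b) = includeLeft A B a * includeRight A B b := by
    rw [includeLeft_apply, includeRight_apply, tmul_mul_tmul, mul_one, one_mul]; rfl
  rw [h]
  exact (norm_mul_le _ _).trans (mul_le_mul (NonUnitalStarAlgHom.norm_apply_le _ _)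
    (NonUnitalStarAlgHom.norm_apply_le _ _) (norm_nonneg _) (norm_nonneg _))

end

open scoped CStarAlgebra

variable {A B C : Type v} [CStarAlgebra A] [CStarAlgebra B] [CStarAlgebra C]

/-- Two star-homomorphisms with pointwise commuting ranges define one on the tensor product. -/
def liftCommute {D E F : Type*} [Ring D] [StarRing D] [Algebra ℂ D] [StarModule ℂ D] [Ring E]
    [StarRing E] [Algebra ℂ E] [StarModule ℂ E] [Ring F] [StarRing F] [Algebra ℂ F]
    [StarModule ℂ F] (f : D →⋆ₐ[ℂ] F) (g : E →⋆ₐ[ℂ] F) (h : ∀ d e, Commute (f d) (g e)) :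
    D ⊗[ℂ] E →⋆ₐ[ℂ] F :=
  { Algebra.TensorProduct.lift (f : D →ₐ[ℂ] F) (g : E →ₐ[ℂ] F) h with
    map_star' := fun x => by
      change Algebra.TensorProduct.lift (f : D →ₐ[ℂ] F) (g : E →ₐ[ℂ] F) h (star x) =
        star (Algebra.TensorProduct.lift (f : D →ₐ[ℂ] F) (g : E →ₐ[ℂ] F) h x)
      induction x with
      | zero => simp
      | add x y hx hy => rw [star_add, map_add, map_add, star_add, hx, hy]
      | tmul d e =>
        rw [TensorProduct.star_tmul, Algebra.TensorProduct.lift_tmul,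
          Algebra.TensorProduct.lift_tmul]
        simp only [StarAlgHom.coe_toAlgHom, map_star, ← star_mul]
        rw [(h d e).eq] }

theorem liftCommute_tmul {D E F : Type*} [Ring D] [StarRing D] [Algebra ℂ D] [StarModule ℂ D]
    [Ring E] [StarRing E] [Algebra ℂ E] [StarModule ℂ E] [Ring F] [StarRing F] [Algebra ℂ F]
    [StarModule ℂ F] (f : D →⋆ₐ[ℂ] F) (g : E →⋆ₐ[ℂ] F) (h : ∀ d e, Commute (f d) (g e)) (d : D)
    (e : E) : liftCommute f g h (d ⊗ₜ e) = f d * g e :=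
  Algebra.TensorProduct.lift_tmul (f : D →ₐ[ℂ] F) (g : E →ₐ[ℂ] F) h d e

variable (A B C) in
/-- The map `a ⊗ b ↦ a ⊗ (b ⊗ 1)`. -/
def assocLeft : SpatialTensor A B →⋆ₐ[ℂ] SpatialTensor A (SpatialTensor B C) :=
  map (StarAlgHom.id ℂ A) (includeLeft B C)

variable (A B C) in
/-- The map `c ↦ 1 ⊗ (1 ⊗ c)`. -/
def assocRight : C →⋆ₐ[ℂ] SpatialTensor A (SpatialTensor B C) :=
  (includeRight A (SpatialTensor B C)).comp (includeRight B C)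

theorem assocLeft_tmul (a : A) (b : B) : assocLeft A B C (tmul a b) = tmul a (tmul b 1) :=
  map_tmul _ _ _ _

theorem commute_assoc (t : SpatialTensor A B) (c : C) :
    Commute (assocLeft A B C t) (assocRight A B C c) := by
  have hcl : IsClosed {t | assocLeft A B C t * assocRight A B C c =
      assocRight A B C c * assocLeft A B C t} :=
    isClosed_eq ((map_continuous (assocLeft A B C)).mul continuous_const)
      (continuous_const.mul (map_continuous (assocLeft A B C)))
  refine (spatialSeminorm A B).denseRange_incl.induction_on t hcl fun z => ?_
  induction z with
  | zero => simp
  | add x y hx hy =>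
    rw [_root_.map_add, _root_.map_add]
    exact hx.add_left hy
  | tmul a b =>
    change assocLeft A B C (tmul a b) * tmul 1 (tmul 1 c) =
      tmul 1 (tmul 1 c) * assocLeft A B C (tmul a b)
    rw [assocLeft_tmul, tmul_mul_tmul, tmul_mul_tmul, tmul_mul_tmul, tmul_mul_tmul]
    simp

variable (A B C) in
/-- The associator on `(A ⊗ B) ⊗ C`, with the outer tensor product algebraic. -/
def assocAlg : SpatialTensor A B ⊗[ℂ] C →⋆ₐ[ℂ] SpatialTensor A (SpatialTensor B C) :=
  liftCommute (assocLeft A B C) (assocRight A B C) commute_assoc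

theorem assocAlg_tmul (t : SpatialTensor A B) (c : C) :
    assocAlg A B C (t ⊗ₜ c) = assocLeft A B C t * assocRight A B C c :=
  liftCommute_tmul _ _ _ _ _

theorem assocAlg_rTensor_incl (x : (A ⊗[ℂ] B) ⊗[ℂ] C) :
    assocAlg A B C ((incl A B).toAlgHom.toLinearMap.rTensor C x) =
      incl A (SpatialTensor B C)
        ((incl B C).toAlgHom.toLinearMap.lTensor A (TensorProduct.assoc ℂ A B C x)) := by
  induction x with
  | zero => simp
  | add x y hx hy => simp only [_root_.map_add, hx, hy]
  | tmul z c =>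
    induction z with
    | zero => simp
    | add x y hx hy => simp only [_root_.map_add, TensorProduct.add_tmul, hx, hy]
    | tmul a b =>
      rw [LinearMap.rTensor_tmul, assocAlg_tmul]
      change assocLeft A B C (tmul a b) * tmul 1 (tmul 1 c) = tmul a (tmul b c)
      rw [assocLeft_tmul, tmul_mul_tmul, tmul_mul_tmul]
      simp

end SpatialTensor

namespace HilbertRep

variable {A B C : Type v} [CStarAlgebra A] [CStarAlgebra B] [CStarAlgebra C]

theorem denseRange_lTensor {H V W : Type*} [NormedAddCommGroup H] [InnerProductSpace ℂ H]
    [NormedAddCommGroup V] [InnerProductSpace ℂ V] [NormedAddCommGroup W] [InnerProductSpace ℂ W]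
    {f : V →ₗᵢ[ℂ] W} (hf : DenseRange f) : DenseRange (f.lTensor H) := by
  intro z
  have hs : closure (Set.range (f.lTensor H)) =
      (LinearMap.range (f.lTensor H).toLinearMap).topologicalClosure := rfl
  rw [hs]
  induction z with
  | zero => exact zero_mem _
  | add x y hx hy => exact add_mem hx hy
  | tmul p k =>
    change _ ∈ closure _
    refine hf.induction_on (p := fun k => _ ∈ closure _) k
      (isClosed_closure.preimage (TensorProduct.mkL ℂ H _ p).continuous) fun q => ?_
    exact subset_closure ⟨p ⊗ₜ q, by simp⟩

/-- On the vectors of the algebraic threefold tensor product of the Hilbert spaces, the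
operators `(π ⊗ ρ) ⊗ σ` and `π ⊗ (ρ ⊗ σ)` agree up to reassociation. -/
theorem exists_tensor_assoc (P : HilbertRep A) (Q : HilbertRep B) (R : HilbertRep C)
    (x : (A ⊗[ℂ] B) ⊗[ℂ] C) (t : (P.space ⊗[ℂ] Q.space) ⊗[ℂ] R.space) :
    ∃ s : (P.space ⊗[ℂ] Q.space) ⊗[ℂ] R.space,
      (P.spatial Q).tensor R ((SpatialTensor.incl A B).toAlgHom.toLinearMap.rTensor C x)
          ((P.spatialEmbedding Q).rTensor R.space t) =
        (P.spatialEmbedding Q).rTensor R.space s ∧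
      P.tensor (Q.spatial R) ((SpatialTensor.incl B C).toAlgHom.toLinearMap.lTensor A
          (TensorProduct.assoc ℂ A B C x))
          ((Q.spatialEmbedding R).lTensor P.space
            (TensorProduct.assoc ℂ P.space Q.space R.space t)) =
        (Q.spatialEmbedding R).lTensor P.space
          (TensorProduct.assoc ℂ P.space Q.space R.space s) := by
  induction x with
  | zero => exact ⟨0, by simp, by simp⟩
  | add x y hx hy =>
    obtain ⟨s, h1, h2⟩ := hx
    obtain ⟨s', h1', h2'⟩ := hy
    exact ⟨s + s', by simp only [map_add, add_apply, h1, h1'],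
      by simp only [map_add, add_apply, h2, h2']⟩
  | tmul z c =>
    induction z with
    | zero => exact ⟨0, by simp, by simp⟩
    | add x y hx hy =>
      obtain ⟨s, h1, h2⟩ := hx
      obtain ⟨s', h1', h2'⟩ := hy
      exact ⟨s + s', by simp only [map_add, TensorProduct.add_tmul, add_apply, h1, h1'],
        by simp only [map_add, TensorProduct.add_tmul, add_apply, h2, h2']⟩
    | tmul a b =>
      induction t with
      | zero => exact ⟨0, by simp, by simp⟩
      | add x y hx hy =>
        obtain ⟨s, h1, h2⟩ := hx
        obtain ⟨s', h1', h2'⟩ := hy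
        exact ⟨s + s', by simp only [map_add, h1, h1'], by simp only [map_add, h2, h2']⟩
      | tmul t r =>
        induction t with
        | zero => exact ⟨0, by simp, by simp⟩
        | add x y hx hy =>
          obtain ⟨s, h1, h2⟩ := hx
          obtain ⟨s', h1', h2'⟩ := hy
          exact ⟨s + s', by simp only [map_add, TensorProduct.add_tmul, h1, h1'],
            by simp only [map_add, TensorProduct.add_tmul, h2, h2']⟩
        | tmul p q =>
          refine ⟨(P.rep a p ⊗ₜ Q.rep b q) ⊗ₜ R.rep c r, ?_, ?_⟩
          · exact congrArg (· ⊗ₜ[ℂ] R.rep c r) (spatial_incl_apply P Q (a ⊗ₜ b) (p ⊗ₜ q))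
          · exact congrArg (P.rep a p ⊗ₜ[ℂ] ·) (spatial_incl_apply Q R (b ⊗ₜ c) (q ⊗ₜ r))

theorem norm_tensor_spatial_assoc_le (P : HilbertRep A) (Q : HilbertRep B) (R : HilbertRep C)
    (x : (A ⊗[ℂ] B) ⊗[ℂ] C) :
    ‖P.tensor (Q.spatial R) ((SpatialTensor.incl B C).toAlgHom.toLinearMap.lTensor A
      (TensorProduct.assoc ℂ A B C x))‖ ≤
    ‖(P.spatial Q).tensor R ((SpatialTensor.incl A B).toAlgHom.toLinearMap.rTensor C x)‖ := by
  refine ContinuousLinearMap.opNorm_le_bound _ (ContinuousLinearMap.opNorm_nonneg _) fun v => ?_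
  refine (denseRange_lTensor (H := P.space) (Q.denseRange_spatialEmbedding R)).induction_on v
    (isClosed_le (by fun_prop) (by fun_prop)) fun t' => ?_
  obtain ⟨t, rfl⟩ := (TensorProduct.assoc ℂ P.space Q.space R.space).surjective t'
  obtain ⟨s, h1, h2⟩ := exists_tensor_assoc P Q R x t
  have h3 := ContinuousLinearMap.le_opNorm ((P.spatial Q).tensor R
    ((SpatialTensor.incl A B).toAlgHom.toLinearMap.rTensor C x))
    ((P.spatialEmbedding Q).rTensor R.space t)
  rw [h1, LinearIsometry.norm_map, LinearIsometry.norm_map] at h3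
  rw [h2, LinearIsometry.norm_map, LinearIsometry.norm_map, TensorProduct.norm_assoc,
    TensorProduct.norm_assoc]
  exact h3

end HilbertRep

namespace SpatialTensor

variable {A B C : Type v} [CStarAlgebra A] [CStarAlgebra B] [CStarAlgebra C]

theorem norm_assocAlg_rTensor_incl_le (x : (A ⊗[ℂ] B) ⊗[ℂ] C) :
    ‖assocAlg A B C ((incl A B).toAlgHom.toLinearMap.rTensor C x)‖ ≤
      spatialNorm ((incl A B).toAlgHom.toLinearMap.rTensor C x) := by
  rw [assocAlg_rTensor_incl]
  refine ((spatialSeminorm A (SpatialTensor B C)).norm_incl _).trans_le ?_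
  exact HilbertRep.spatialNorm_le_of_jointly_injective
    (fun QR : HilbertRep B × HilbertRep C => QR.1.spatial QR.2)
    (fun _ h => HilbertRep.spatial_jointly_injective h) _ (spatialNorm_nonneg _)
    fun P QR => (P.norm_tensor_spatial_assoc_le QR.1 QR.2 x).trans (le_spatialNorm _ _ _)

theorem norm_assocAlg_le (y : SpatialTensor A B ⊗[ℂ] C) :
    ‖assocAlg A B C y‖ ≤ spatialNorm y := by
  have happrox : ∀ δ > 0, ∃ x : (A ⊗[ℂ] B) ⊗[ℂ] C,
      ‖incl _ C (y - (incl A B).toAlgHom.toLinearMap.rTensor C x)‖ ≤ δ ∧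
      ‖assocAlg A B C (y - (incl A B).toAlgHom.toLinearMap.rTensor C x)‖ ≤ δ := by
    induction y with
    | zero => exact fun δ hδ => ⟨0, by simpa using hδ.le, by simpa using hδ.le⟩
    | add y z hy hz =>
      intro δ hδ
      obtain ⟨x, h1, h2⟩ := hy (δ / 2) (half_pos hδ)
      obtain ⟨x', h1', h2'⟩ := hz (δ / 2) (half_pos hδ)
      refine ⟨x + x', ?_, ?_⟩
      · rw [_root_.map_add, add_sub_add_comm, _root_.map_add]
        exact (norm_add_le _ _).trans ((add_le_add h1 h1').trans_eq (add_halves δ))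
      · rw [_root_.map_add, add_sub_add_comm, _root_.map_add]
        exact (norm_add_le _ _).trans ((add_le_add h2 h2').trans_eq (add_halves δ))
    | tmul t c =>
      intro δ hδ
      have hc : 0 < ‖c‖ + 1 := by positivity
      obtain ⟨z, hz⟩ := (spatialSeminorm A B).denseRange_incl.exists_dist_lt t (div_pos hδ hc)
      rw [dist_eq_norm] at hz
      have hb : ‖t - incl A B z‖ * ‖c‖ ≤ δ := by
        refine (mul_le_mul hz.le (le_add_of_nonneg_right zero_le_one) (norm_nonneg _)
          (by positivity)).trans_eq ?_
        exact div_mul_cancel₀ δ hc.ne'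
      have he : t ⊗ₜ[ℂ] c - (incl A B).toAlgHom.toLinearMap.rTensor C (z ⊗ₜ c) =
          (t - incl A B z) ⊗ₜ[ℂ] c := by
        rw [TensorProduct.sub_tmul]; rfl
      refine ⟨z ⊗ₜ c, ?_, ?_⟩
      · rw [he]
        exact (norm_incl_tmul_le _ _).trans hb
      · rw [he, assocAlg_tmul]
        exact (norm_mul_le _ _).trans ((mul_le_mul (NonUnitalStarAlgHom.norm_apply_le _ _)
          (NonUnitalStarAlgHom.norm_apply_le _ _) (norm_nonneg _) (norm_nonneg _)).trans hb)
  have hn : ∀ y : SpatialTensor A B ⊗[ℂ] C, spatialNorm y = ‖incl _ C y‖ := fun y =>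
    ((spatialSeminorm _ C).norm_incl y).symm
  refine le_of_forall_pos_le_add fun δ hδ => ?_
  obtain ⟨x, h1, h2⟩ := happrox (δ / 2) (half_pos hδ)
  have h3 := norm_assocAlg_rTensor_incl_le x
  set y' := (incl A B).toAlgHom.toLinearMap.rTensor C x
  rw [hn] at h3 ⊢
  have h4 : ‖assocAlg A B C y‖ ≤ ‖assocAlg A B C (y - y')‖ + ‖assocAlg A B C y'‖ := by
    rw [_root_.map_sub]
    simpa using norm_add_le (assocAlg A B C y - assocAlg A B C y') (assocAlg A B C y')
  have h5 : ‖incl _ C y'‖ ≤ ‖incl _ C y‖ + ‖incl _ C (y - y')‖ := by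
    rw [_root_.map_sub, norm_sub_rev]
    simpa using norm_add_le (incl _ C y) (incl _ C y' - incl _ C y)
  linarith

variable (A B C) in
/-- The associator of the spatial tensor product. -/
def assoc : SpatialTensor (SpatialTensor A B) C →⋆ₐ[ℂ] SpatialTensor A (SpatialTensor B C) :=
  (spatialSeminorm (SpatialTensor A B) C).extend (assocAlg A B C) norm_assocAlg_le

theorem assoc_tmul (a : A) (b : B) (c : C) :
    assoc A B C (tmul (tmul a b) c) = tmul a (tmul b c) := by
  refine ((spatialSeminorm (SpatialTensor A B) C).extend_incl _ norm_assocAlg_le _).trans ?_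
  exact assocAlg_rTensor_incl ((a ⊗ₜ b) ⊗ₜ c)

end SpatialTensor

/-! ### Symmetric families and their coefficient matrices -/

/-- A bilinear operation, a conjugate-linear map and an element of `A`, which a quantum family may
be required to preserve. -/
structure InvariantData (A : Type*) [AddCommGroup A] [Module ℂ A] where
  mul : A →ₗ[ℂ] A →ₗ[ℂ] A
  conj : A →ₗ⋆[ℂ] A
  point : A

section Families

variable {A : Type u} [CStarAlgebra A] {B B' : Type v} [CStarAlgebra B] [CStarAlgebra B']

/-- A quantum family of invertible maps that preserves the functional `φ` and the additional
structure `s`. -/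
structure IsSymmetryFamily (φ : A →ₗ[ℂ] ℂ) (s : InvariantData A) (α : A →⋆ₐ[ℂ] A ⊗[ℂ] B) :
    Prop where
  invertible : IsInvertibleFamily α
  preserves : PreservesFunctional φ α
  map_mul : ∀ a b : A, α (s.mul a b) =
    TensorProduct.map₂ s.mul (LinearMap.mul ℂ B) (α a) (α b)
  map_conj : ∀ a : A, α (s.conj a) =
    TensorProduct.map s.conj (starLinearEquiv ℂ : B ≃ₗ⋆[ℂ] B).toLinearMap (α a)
  map_point : α s.point = s.point ⊗ₜ 1

/-- The star-homomorphism `id ⊗ Λ`. -/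
def idTensor (A : Type u) [CStarAlgebra A] (Λ : B →⋆ₐ[ℂ] B') : A ⊗[ℂ] B →⋆ₐ[ℂ] A ⊗[ℂ] B' :=
  SpatialTensor.algMap (StarAlgHom.id ℂ A) Λ

@[simp]
theorem idTensor_tmul (Λ : B →⋆ₐ[ℂ] B') (a : A) (b : B) :
    idTensor A Λ (a ⊗ₜ b) = a ⊗ₜ Λ b := rfl

theorem idTensor_eq_lTensor (Λ : B →⋆ₐ[ℂ] B') (z : A ⊗[ℂ] B) :
    idTensor A Λ z = Λ.toAlgHom.toLinearMap.lTensor A z := by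
  induction z with
  | zero => simp only [map_zero]
  | add x y hx hy => rw [map_add, map_add, hx, hy]
  | tmul a b => rfl

theorem idTensor_comp_idTensor {B'' : Type v} [CStarAlgebra B''] (Λ : B →⋆ₐ[ℂ] B')
    (Λ' : B' →⋆ₐ[ℂ] B'') : (idTensor A Λ').comp (idTensor A Λ) = idTensor A (Λ'.comp Λ) := by
  refine StarAlgHom.ext fun z => ?_
  rw [StarAlgHom.comp_apply, idTensor_eq_lTensor, idTensor_eq_lTensor, idTensor_eq_lTensor]
  exact (LinearMap.lTensor_comp_apply A _ _ _).symm

theorem idTensor_id : idTensor A (StarAlgHom.id ℂ B) = StarAlgHom.id ℂ (A ⊗[ℂ] B) := by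
  refine StarAlgHom.ext fun z => ?_
  rw [idTensor_eq_lTensor]
  exact LinearMap.congr_fun (LinearMap.lTensor_id A _) _

theorem sliceLeft_idTensor (φ : A →ₗ[ℂ] ℂ) (Λ : B →⋆ₐ[ℂ] B') (z : A ⊗[ℂ] B) :
    sliceLeft φ (idTensor A Λ z) = Λ (sliceLeft φ z) := by
  rw [idTensor_eq_lTensor, sliceLeft_lTensor]; rfl

theorem idTensor_map₂ (m : A →ₗ[ℂ] A →ₗ[ℂ] A) (Λ : B →⋆ₐ[ℂ] B') (z w : A ⊗[ℂ] B) :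
    idTensor A Λ (TensorProduct.map₂ m (LinearMap.mul ℂ B) z w) =
      TensorProduct.map₂ m (LinearMap.mul ℂ B') (idTensor A Λ z) (idTensor A Λ w) := by
  induction z with
  | zero => simp only [map_zero, LinearMap.zero_apply]
  | add x y hx hy => simp only [map_add, LinearMap.add_apply, hx, hy]
  | tmul a b =>
    induction w with
    | zero => simp only [map_zero]
    | add x y hx hy => simp only [map_add, hx, hy]
    | tmul a' b' => simp [TensorProduct.map₂_apply_tmul]

theorem idTensor_map_conj (j : A →ₗ⋆[ℂ] A) (Λ : B →⋆ₐ[ℂ] B') (z : A ⊗[ℂ] B) :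
    idTensor A Λ (TensorProduct.map j (starLinearEquiv ℂ : B ≃ₗ⋆[ℂ] B).toLinearMap z) =
      TensorProduct.map j (starLinearEquiv ℂ : B' ≃ₗ⋆[ℂ] B').toLinearMap (idTensor A Λ z) := by
  induction z with
  | zero => simp only [map_zero]
  | add x y hx hy => simp only [map_add, hx, hy]
  | tmul a b => simp [map_star]

variable {n : ℕ}

/-- The coefficient matrix `u` of a family, determined by `α(e_j) = ∑ᵢ eᵢ ⊗ u_ij`. -/
def coeffMatrix (e : Module.Basis (Fin n) ℂ A) (α : A →⋆ₐ[ℂ] A ⊗[ℂ] B) :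
    Matrix (Fin n) (Fin n) B :=
  Matrix.of fun i j => sliceLeft (e.coord i) (α (e j))

variable {e : Module.Basis (Fin n) ℂ A} {α : A →⋆ₐ[ℂ] A ⊗[ℂ] B} {φ : A →ₗ[ℂ] ℂ}

theorem coeffMatrix_apply (e : Module.Basis (Fin n) ℂ A) (α : A →⋆ₐ[ℂ] A ⊗[ℂ] B) (i j : Fin n) :
    coeffMatrix e α i j = sliceLeft (e.coord i) (α (e j)) := rfl

theorem apply_basis_eq_sum (e : Module.Basis (Fin n) ℂ A) (α : A →⋆ₐ[ℂ] A ⊗[ℂ] B) (j : Fin n) :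
    α (e j) = ∑ i, e i ⊗ₜ coeffMatrix e α i j :=
  (e.sum_tmul_slice _).symm

theorem sliceLeft_mul_one_tmul (φ : A →ₗ[ℂ] ℂ) (z : A ⊗[ℂ] B) (b : B) :
    sliceLeft φ (z * (1 ⊗ₜ b)) = sliceLeft φ z * b := by
  induction z with
  | zero => simp only [zero_mul, map_zero]
  | add x y hx hy => simp only [add_mul, map_add, hx, hy]
  | tmul a c => simp

/-- Preservation of `φ` says that the coefficient matrix is an isometry, because the products
`eᵢ* eⱼ` span `A`. -/
theorem preservesFunctional_iff (he : IsOrthonormalFor φ e) :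
    PreservesFunctional φ α ↔ star (coeffMatrix e α) * coeffMatrix e α = 1 := by
  have key : ∀ i j, (star (coeffMatrix e α) * coeffMatrix e α) i j =
      sliceLeft φ (α (star (e i) * e j)) := fun i j => by
    rw [map_mul, map_star, he.slice_star_mul, Matrix.mul_apply]
    rfl
  have key' : ∀ i j, (1 : Matrix (Fin n) (Fin n) B) i j =
      algebraMap ℂ B (φ (star (e i) * e j)) := fun i j => by
    rw [he i j, Matrix.one_apply]
    split_ifs <;> simp
  constructor
  · intro h
    ext i j
    rw [key, key', h]
  · intro h a
    have h1 : ∀ i j, sliceLeft φ (α (star (e i) * e j)) =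
        algebraMap ℂ B (φ (star (e i) * e j)) := fun i j => by rw [← key, ← key', h]
    have h2 : a = ∑ i, ∑ j, (star (e.repr 1 i) * e.repr a j) • (star (e i) * e j) := by
      conv_lhs => rw [← one_mul a, ← star_one A, ← e.sum_repr a, ← e.sum_repr (1 : A)]
      simp only [star_sum, star_smul, Finset.sum_mul_sum, smul_mul_smul_comm]
    rw [h2]
    refine (map_sum ((sliceLeft φ) ∘ₗ α.toAlgHom.toLinearMap) _ _).trans
      (Eq.trans (Finset.sum_congr rfl fun i _ => ?_)
        (map_sum (Algebra.linearMap ℂ B ∘ₗ φ) _ _).symm)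
    refine (map_sum ((sliceLeft φ) ∘ₗ α.toAlgHom.toLinearMap) _ _).trans
      (Eq.trans (Finset.sum_congr rfl fun j _ => ?_)
        (map_sum (Algebra.linearMap ℂ B ∘ₗ φ) _ _).symm)
    rw [map_smul, map_smul]
    exact congrArg _ (h1 i j)

/-- The Podleś condition says that the coefficient matrix has a right inverse. -/
theorem isInvertibleFamily_iff (hu : star (coeffMatrix e α) * coeffMatrix e α = 1) :
    IsInvertibleFamily α ↔ coeffMatrix e α * star (coeffMatrix e α) = 1 := by
  constructor
  · intro h
    have key : ∀ x : A ⊗[ℂ] B, ∃ b : Fin n → B, ∀ i,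
        sliceLeft (e.coord i) x = ∑ j, coeffMatrix e α i j * b j := by
      intro x
      have hx : x ∈ Submodule.span ℂ {x : A ⊗[ℂ] B | ∃ (a : A) (b : B), x = α a * (1 ⊗ₜ b)} := by
        rw [h]; trivial
      induction hx using Submodule.span_induction with
      | mem x hx =>
        obtain ⟨a, b, rfl⟩ := hx
        refine ⟨fun j => e.repr a j • b, fun i => ?_⟩
        rw [sliceLeft_mul_one_tmul]
        simp only [coeffMatrix_apply, mul_smul_comm, ← smul_mul_assoc, ← Finset.sum_mul,
          ← map_smul, ← map_sum, e.sum_repr]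
      | zero => exact ⟨0, fun i => by simp⟩
      | add x y _ _ hx hy =>
        obtain ⟨b, hb⟩ := hx
        obtain ⟨c, hc⟩ := hy
        exact ⟨b + c, fun i => by simp [hb, hc, mul_add, Finset.sum_add_distrib]⟩
      | smul c x _ hx =>
        obtain ⟨b, hb⟩ := hx
        exact ⟨c • b, fun i => by simp [hb, Finset.smul_sum]⟩
    choose b hb using fun k => key (e k ⊗ₜ 1)
    have h1 : coeffMatrix e α * (Matrix.of fun j k => b k j) = 1 := by
      ext i k
      rw [Matrix.mul_apply]
      refine (hb k i).symm.trans ?_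
      rw [Matrix.one_apply, sliceLeft_tmul, e.coord_apply, e.repr_self, Finsupp.single_apply]
      simp only [eq_comm (a := k), ite_smul, one_smul, zero_smul]
    rwa [left_inv_eq_right_inv hu h1]
  · intro h
    refine eq_top_iff.2 fun x _ => ?_
    have hx : x = ∑ j, α (e j) *
        (1 ⊗ₜ ∑ i, star (coeffMatrix e α) j i * sliceLeft (e.coord i) x) := by
      refine e.tensor_ext fun k => ?_
      simp only [map_sum, sliceLeft_mul_one_tmul, ← coeffMatrix_apply, Finset.mul_sum,
        ← mul_assoc]
      rw [Finset.sum_comm]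
      simp only [← Finset.sum_mul, ← Matrix.mul_apply, h]
      simp [Matrix.one_apply, ite_mul]
    rw [hx]
    exact Submodule.sum_mem _ fun j _ => Submodule.subset_span ⟨_, _, rfl⟩

/-- For an orthonormal basis, the families of invertible maps that preserve the functional are
those whose coefficient matrix is unitary. -/
theorem coeffMatrix_mem_unitary_iff (he : IsOrthonormalFor φ e) :
    coeffMatrix e α ∈ unitary (Matrix (Fin n) (Fin n) B) ↔
      IsInvertibleFamily α ∧ PreservesFunctional φ α := by
  rw [Unitary.mem_iff, preservesFunctional_iff he]
  constructor
  · exact fun ⟨h1, h2⟩ => ⟨(isInvertibleFamily_iff h1).2 h2, h1⟩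
  · exact fun ⟨h1, h2⟩ => ⟨h2, (isInvertibleFamily_iff h2).1 h1⟩

theorem coeffMatrix_idTensor (Λ : B →⋆ₐ[ℂ] B') :
    coeffMatrix e ((idTensor A Λ).comp α) = (coeffMatrix e α).map Λ := by
  ext i j
  exact sliceLeft_idTensor _ _ _

theorem Matrix.map_mem_unitary (Λ : B →⋆ₐ[ℂ] B') {M : Matrix (Fin n) (Fin n) B}
    (hM : M ∈ unitary (Matrix (Fin n) (Fin n) B)) :
    M.map Λ ∈ unitary (Matrix (Fin n) (Fin n) B') := by
  have hs : star (M.map Λ) = (star M).map Λ := by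
    ext i j
    exact (map_star Λ _).symm
  rw [Unitary.mem_iff, hs, ← Matrix.map_mul, ← Matrix.map_mul, hM.1, hM.2]
  simp [Matrix.map_one]

theorem eq_of_idTensor_eq (e : Module.Basis (Fin n) ℂ A) {ι : Type*} {E : ι → Type v}
    [∀ k, CStarAlgebra (E k)] (π : ∀ k, B →⋆ₐ[ℂ] E k)
    (hπ : ∀ b, (∀ k, π k b = 0) → b = 0) {z w : A ⊗[ℂ] B}
    (h : ∀ k, idTensor A (π k) z = idTensor A (π k) w) : z = w := by
  refine e.tensor_ext fun i => sub_eq_zero.1 (hπ _ fun k => ?_)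
  rw [map_sub, sub_eq_zero, ← sliceLeft_idTensor, ← sliceLeft_idTensor, h]

/-- A family is symmetric if its images under jointly injective star-homomorphisms are. -/
theorem IsSymmetryFamily.of_jointly_injective {s : InvariantData A} (he : IsOrthonormalFor φ e)
    {ι : Type*} {E : ι → Type v} [∀ k, CStarAlgebra (E k)] (π : ∀ k, B →⋆ₐ[ℂ] E k)
    (hπ : ∀ b, (∀ k, π k b = 0) → b = 0)
    (h : ∀ k, IsSymmetryFamily φ s ((idTensor A (π k)).comp α)) : IsSymmetryFamily φ s α := by
  have hM : ∀ M N : Matrix (Fin n) (Fin n) B, (∀ k, M.map (π k) = N.map (π k)) → M = N := by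
    intro M N hMN
    ext i j
    refine sub_eq_zero.1 (hπ _ fun k => ?_)
    rw [map_sub, sub_eq_zero]
    exact congrFun (congrFun (hMN k) i) j
  have hs : ∀ k, (star (coeffMatrix e α)).map (π k) = star ((coeffMatrix e α).map (π k)) :=
    fun k => by
      ext i j
      exact map_star (π k) _
  have hu : coeffMatrix e α ∈ unitary (Matrix (Fin n) (Fin n) B) := by
    have hk := fun k => (coeffMatrix_mem_unitary_iff he).2 ⟨(h k).invertible, (h k).preserves⟩
    simp only [coeffMatrix_idTensor] at hk
    constructor <;> refine hM _ _ fun k => ?_ <;> rw [Matrix.map_mul, hs]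
    · rw [(hk k).1]; simp [Matrix.map_one]
    · rw [(hk k).2]; simp [Matrix.map_one]
  obtain ⟨h1, h2⟩ := (coeffMatrix_mem_unitary_iff he).1 hu
  refine ⟨h1, h2, fun a b => ?_, fun a => ?_, ?_⟩ <;>
    refine eq_of_idTensor_eq e π hπ fun k => ?_
  · rw [idTensor_map₂]; exact (h k).map_mul a b
  · rw [idTensor_map_conj]; exact (h k).map_conj a
  · rw [idTensor_tmul, map_one]; exact (h k).map_point

/-- The constant family `a ↦ a ⊗ 1` at the identity is symmetric. -/
theorem isSymmetryFamily_trivial (s : InvariantData A) :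
    IsSymmetryFamily φ s (starIncludeLeft A B) where
  invertible := by
    refine eq_top_iff.2 fun x _ => ?_
    induction x with
    | zero => exact Submodule.zero_mem _
    | add x y hx hy => exact Submodule.add_mem _ (hx trivial) (hy trivial)
    | tmul a b =>
      refine Submodule.subset_span ⟨a, b, ?_⟩
      change _ = (a ⊗ₜ[ℂ] (1 : B)) * _
      simp
  preserves a := by
    change sliceLeft φ (a ⊗ₜ[ℂ] (1 : B)) = _
    rw [sliceLeft_tmul, Algebra.algebraMap_eq_smul_one]
  map_mul a b := by
    change _ ⊗ₜ[ℂ] (1 : B) = TensorProduct.map₂ _ _ (a ⊗ₜ[ℂ] (1 : B)) (b ⊗ₜ[ℂ] (1 : B))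
    simp [TensorProduct.map₂_apply_tmul]
  map_conj a := by
    change _ ⊗ₜ[ℂ] (1 : B) = TensorProduct.map _ _ (a ⊗ₜ[ℂ] (1 : B))
    simp
  map_point := rfl

end Families

/-! ### Composition of families -/

section Composition

variable {A : Type u} [CStarAlgebra A] {B : Type v} [CStarAlgebra B]

/-- The family `α`, with its parameters placed in the first factor of `B ⊗ B`. -/
def firstFactor (α : A →⋆ₐ[ℂ] A ⊗[ℂ] B) : A →⋆ₐ[ℂ] A ⊗[ℂ] SpatialTensor B B :=
  (idTensor A (SpatialTensor.includeLeft B B)).comp α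

theorem commute_includeLeft_includeRight (b c : B) :
    Commute (SpatialTensor.includeLeft B B b) (SpatialTensor.includeRight B B c) := by
  rw [Commute, SemiconjBy, SpatialTensor.includeLeft_apply, SpatialTensor.includeRight_apply,
    SpatialTensor.tmul_mul_tmul, SpatialTensor.tmul_mul_tmul]
  simp only [mul_one, one_mul]

theorem commute_idTensor_includeLeft (z : A ⊗[ℂ] B) (c : B) :
    Commute (idTensor A (SpatialTensor.includeLeft B B) z)
      ((1 : A) ⊗ₜ[ℂ] SpatialTensor.includeRight B B c) := by
  induction z with
  | zero => rw [map_zero]; exact Commute.zero_left _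
  | add x y hx hy => rw [map_add]; exact hx.add_left hy
  | tmul a b =>
    rw [Commute, SemiconjBy, idTensor_tmul, Algebra.TensorProduct.tmul_mul_tmul,
      Algebra.TensorProduct.tmul_mul_tmul, (commute_includeLeft_includeRight b c).eq, one_mul,
      mul_one]

/-- The star-homomorphism `α ⊗ id`, with values in `A ⊗ (B ⊗ B)`. -/
def tensorId (α : A →⋆ₐ[ℂ] A ⊗[ℂ] B) : A ⊗[ℂ] B →⋆ₐ[ℂ] A ⊗[ℂ] SpatialTensor B B :=
  SpatialTensor.liftCommute (firstFactor α)
    ((starIncludeRight A (SpatialTensor B B)).comp (SpatialTensor.includeRight B B))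
    fun a c => commute_idTensor_includeLeft (α a) c

theorem tensorId_tmul (α : A →⋆ₐ[ℂ] A ⊗[ℂ] B) (a : A) (b : B) : tensorId α (a ⊗ₜ b) =
    idTensor A (SpatialTensor.includeLeft B B) (α a) * (1 ⊗ₜ SpatialTensor.includeRight B B b) :=
  SpatialTensor.liftCommute_tmul _ _ _ a b

theorem tensorId_eq (α : A →⋆ₐ[ℂ] A ⊗[ℂ] B) (z : A ⊗[ℂ] B) : tensorId α z =
    (SpatialTensor.incl B B).toAlgHom.toLinearMap.lTensor A
      (TensorProduct.assoc ℂ A B B (α.toAlgHom.toLinearMap.rTensor B z)) := by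
  have key : ∀ (x : A ⊗[ℂ] B) (c : B), idTensor A (SpatialTensor.includeLeft B B) x *
      (1 ⊗ₜ SpatialTensor.includeRight B B c) =
      (SpatialTensor.incl B B).toAlgHom.toLinearMap.lTensor A
        (TensorProduct.assoc ℂ A B B (x ⊗ₜ c)) := by
    intro x c
    induction x with
    | zero => simp only [map_zero, zero_mul, TensorProduct.zero_tmul]
    | add x y hx hy => simp only [map_add, add_mul, TensorProduct.add_tmul, hx, hy]
    | tmul a b =>
      rw [idTensor_tmul, Algebra.TensorProduct.tmul_mul_tmul, mul_one,
        SpatialTensor.includeLeft_apply, SpatialTensor.includeRight_apply,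
        SpatialTensor.tmul_mul_tmul, mul_one, one_mul]
      rfl
  induction z with
  | zero => simp only [map_zero]
  | add x y hx hy => rw [map_add, hx, hy]; simp only [map_add]
  | tmul a b => rw [tensorId_tmul, key]; rfl

/-- The composition `(α ⊗ id) ∘ α` of a family with itself. -/
def selfComp (α : A →⋆ₐ[ℂ] A ⊗[ℂ] B) : A →⋆ₐ[ℂ] A ⊗[ℂ] SpatialTensor B B :=
  (tensorId α).comp α

variable {n : ℕ} {e : Module.Basis (Fin n) ℂ A} {α : A →⋆ₐ[ℂ] A ⊗[ℂ] B} {φ : A →ₗ[ℂ] ℂ}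

/-- The coefficients of the composition are `∑ₖ u_ik ⊗ u_kj`. -/
theorem coeffMatrix_selfComp : coeffMatrix e (selfComp α) =
    (coeffMatrix e α).map (SpatialTensor.includeLeft B B) *
      (coeffMatrix e α).map (SpatialTensor.includeRight B B) := by
  ext i j
  rw [coeffMatrix_apply, selfComp, StarAlgHom.comp_apply, apply_basis_eq_sum e α j, map_sum,
    map_sum, Matrix.mul_apply]
  refine Finset.sum_congr rfl fun k _ => ?_
  rw [tensorId_tmul, sliceLeft_mul_one_tmul, sliceLeft_idTensor]
  rfl

theorem map₂_includeLeft_mul (m : A →ₗ[ℂ] A →ₗ[ℂ] A) (x y : A ⊗[ℂ] B) (b c : B) :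
    TensorProduct.map₂ m (LinearMap.mul ℂ (SpatialTensor B B))
        (idTensor A (SpatialTensor.includeLeft B B) x *
          (1 ⊗ₜ SpatialTensor.includeRight B B b))
        (idTensor A (SpatialTensor.includeLeft B B) y *
          (1 ⊗ₜ SpatialTensor.includeRight B B c)) =
      TensorProduct.map₂ m (LinearMap.mul ℂ (SpatialTensor B B))
        (idTensor A (SpatialTensor.includeLeft B B) x)
        (idTensor A (SpatialTensor.includeLeft B B) y) *
          (1 ⊗ₜ SpatialTensor.includeRight B B (b * c)) := by
  induction x with
  | zero => simp only [map_zero, zero_mul, LinearMap.zero_apply]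
  | add x y hx hy => simp only [map_add, add_mul, LinearMap.add_apply, hx, hy]
  | tmul a d =>
    induction y with
    | zero => simp only [map_zero, zero_mul]
    | add x y hx hy => simp only [map_add, add_mul, hx, hy]
    | tmul a' d' =>
      simp only [idTensor_tmul, Algebra.TensorProduct.tmul_mul_tmul, mul_one,
        TensorProduct.map₂_apply_tmul, TensorProduct.map_tmul, LinearMap.mul_apply_apply, map_mul]
      rw [mul_assoc, ← mul_assoc _ _ (SpatialTensor.includeRight B B c),
        ← (commute_includeLeft_includeRight d' b).eq]
      simp only [mul_assoc]

theorem tensorId_map₂ {m : A →ₗ[ℂ] A →ₗ[ℂ] A}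
    (hm : ∀ a b : A, α (m a b) = TensorProduct.map₂ m (LinearMap.mul ℂ B) (α a) (α b))
    (z w : A ⊗[ℂ] B) : tensorId α (TensorProduct.map₂ m (LinearMap.mul ℂ B) z w) =
      TensorProduct.map₂ m (LinearMap.mul ℂ _) (tensorId α z) (tensorId α w) := by
  induction z with
  | zero => simp only [map_zero, LinearMap.zero_apply]
  | add x y hx hy => simp only [map_add, LinearMap.add_apply, hx, hy]
  | tmul a b =>
    induction w with
    | zero => simp only [map_zero]
    | add x y hx hy => simp only [map_add, hx, hy]
    | tmul a' b' =>
      rw [tensorId_tmul, tensorId_tmul, map₂_includeLeft_mul, ← idTensor_map₂, ← hm,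
        TensorProduct.map₂_apply_tmul, TensorProduct.map_tmul, tensorId_tmul]
      rfl

theorem tensorId_map_conj {j : A →ₗ⋆[ℂ] A}
    (hj : ∀ a : A, α (j a) =
      TensorProduct.map j (starLinearEquiv ℂ : B ≃ₗ⋆[ℂ] B).toLinearMap (α a)) (z : A ⊗[ℂ] B) :
    tensorId α (TensorProduct.map j (starLinearEquiv ℂ : B ≃ₗ⋆[ℂ] B).toLinearMap z) =
      TensorProduct.map j (starLinearEquiv ℂ :
        SpatialTensor B B ≃ₗ⋆[ℂ] SpatialTensor B B).toLinearMap (tensorId α z) := by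
  have key : ∀ (x : A ⊗[ℂ] B) (c : B), TensorProduct.map j (starLinearEquiv ℂ :
        SpatialTensor B B ≃ₗ⋆[ℂ] SpatialTensor B B).toLinearMap
      (idTensor A (SpatialTensor.includeLeft B B) x * (1 ⊗ₜ SpatialTensor.includeRight B B c)) =
      idTensor A (SpatialTensor.includeLeft B B)
        (TensorProduct.map j (starLinearEquiv ℂ : B ≃ₗ⋆[ℂ] B).toLinearMap x) *
        (1 ⊗ₜ SpatialTensor.includeRight B B (star c)) := by
    intro x c
    induction x with
    | zero => simp only [map_zero, zero_mul]
    | add x y hx hy => simp only [map_add, add_mul, hx, hy]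
    | tmul a d =>
      rw [idTensor_tmul, Algebra.TensorProduct.tmul_mul_tmul,
        (commute_includeLeft_includeRight d c).eq]
      simp [map_star]
  induction z with
  | zero => simp only [map_zero]
  | add x y hx hy => simp only [map_add, hx, hy]
  | tmul a b =>
    rw [tensorId_tmul, key, ← hj, TensorProduct.map_tmul, tensorId_tmul]
    rfl

theorem IsSymmetryFamily.selfComp {s : InvariantData A} (he : IsOrthonormalFor φ e)
    (hα : IsSymmetryFamily φ s α) : IsSymmetryFamily φ s (selfComp α) := by
  have hu := (coeffMatrix_mem_unitary_iff he).2 ⟨hα.invertible, hα.preserves⟩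
  have hu' : coeffMatrix e (_root_.selfComp α) ∈ unitary _ := by
    rw [coeffMatrix_selfComp]
    exact mul_mem (Matrix.map_mem_unitary _ hu) (Matrix.map_mem_unitary _ hu)
  obtain ⟨h1, h2⟩ := (coeffMatrix_mem_unitary_iff he).1 hu'
  refine ⟨h1, h2, fun a b => ?_, fun a => ?_, ?_⟩
  · simp only [_root_.selfComp, StarAlgHom.comp_apply, hα.map_mul, tensorId_map₂ hα.map_mul]
  · simp only [_root_.selfComp, StarAlgHom.comp_apply, hα.map_conj,
      tensorId_map_conj hα.map_conj]
  · simp only [_root_.selfComp, StarAlgHom.comp_apply, hα.map_point, tensorId_tmul,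
      idTensor_tmul, map_one]
    simp

end Composition

/-! ### Quantum families of automorphisms -/

section Automorphisms

open FiniteQuantumGroup

variable (A : Type u) [CStarAlgebra A] [FiniteQuantumGroup A]

/-- The convolution product, the convolution adjoint and the Haar element of a finite quantum
group. -/
def convData : InvariantData A where
  mul := convProd A
  conj := convAdjoint A
  point := haarElement A

variable {A}

theorem convProd_one (a : A) : convProd A a 1 = haarState A a • 1 := by
  simp [convProd, comul_one, Algebra.TensorProduct.one_def, antipode_one]

variable {B : Type v} [CStarAlgebra B] {α : A →⋆ₐ[ℂ] A ⊗[ℂ] B}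

/-- Since `a ⋆ 1 = h(a)1`, a family preserving the convolution product preserves the Haar state. -/
theorem IsAutomorphismFamily.preservesFunctional (hα : IsAutomorphismFamily α) :
    PreservesFunctional (haarState A) α := by
  intro a
  have key : ∀ z : A ⊗[ℂ] B, TensorProduct.map₂ (convProd A) (LinearMap.mul ℂ B) z 1 =
      1 ⊗ₜ sliceLeft (haarState A) z := by
    intro z
    induction z with
    | zero => simp
    | add x y hx hy => simp only [map_add, LinearMap.add_apply, hx, hy, TensorProduct.tmul_add]
    | tmul a b =>
      rw [Algebra.TensorProduct.one_def, TensorProduct.map₂_apply_tmul, TensorProduct.map_tmul,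
        convProd_one]
      simp [TensorProduct.smul_tmul]
  have h := hα.map_convProd a 1
  rw [convProd_one, map_smul, map_one, key] at h
  have h' := congrArg (sliceLeft (haarState A)) h
  rw [map_smul, Algebra.TensorProduct.one_def, sliceLeft_tmul, sliceLeft_tmul,
    (isHaarState_haarState A).map_one, one_smul, one_smul] at h'
  rw [← h', Algebra.algebraMap_eq_smul_one]

theorem isAutomorphismFamily_iff :
    IsAutomorphismFamily α ↔ IsSymmetryFamily (haarState A) (convData A) α :=
  ⟨fun h => ⟨h.invertible, h.preservesFunctional, h.map_convProd, h.map_convAdjoint,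
    h.map_haarElement⟩, fun h => ⟨h.invertible, h.map_mul, h.map_conj, h.map_point⟩⟩

/-- Without additional structure, the symmetric families are the families of invertible maps that
preserve the functional. -/
theorem isSymmetryFamily_zero_iff {A : Type u} [CStarAlgebra A] {φ : A →ₗ[ℂ] ℂ}
    {α : A →⋆ₐ[ℂ] A ⊗[ℂ] B} :
    IsSymmetryFamily φ ⟨0, 0, 0⟩ α ↔ IsInvertibleFamily α ∧ PreservesFunctional φ α := by
  refine ⟨fun h => ⟨h.invertible, h.preserves⟩, fun h => ⟨h.1, h.2, fun a b => ?_, fun a => ?_, ?_⟩⟩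
  · have : TensorProduct.map₂ (0 : A →ₗ[ℂ] A →ₗ[ℂ] A) (LinearMap.mul ℂ B) = 0 := by
      ext; simp [TensorProduct.map₂_apply_tmul]
    rw [this]; simp
  · have : ∀ z : A ⊗[ℂ] B, TensorProduct.map (0 : A →ₗ⋆[ℂ] A)
        (starLinearEquiv ℂ : B ≃ₗ⋆[ℂ] B).toLinearMap z = 0 := fun z => by
      induction z with
      | zero => simp
      | add x y hx hy => rw [map_add, hx, hy, add_zero]
      | tmul a b => simp
    rw [this]; simp
  · simp

end Automorphisms

/-! ### The free star-algebra on self-adjoint generators -/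

section Free

instance FreeAlgebra.instStarModuleReal (Y : Type*) : StarModule ℝ (FreeAlgebra ℝ Y) where
  star_smul r x := by
    rw [Algebra.smul_def, star_mul, FreeAlgebra.star_algebraMap, ← Algebra.commutes,
      ← Algebra.smul_def, star_trivial r]

/-- The free complex star-algebra on a type of self-adjoint generators, obtained as the
complexification of the real free algebra (whose involution reverses words). -/
abbrev FreeStarAlgebra (Y : Type v) : Type v := ℂ ⊗[ℝ] FreeAlgebra ℝ Y

variable {Y : Type v} {B : Type*} [CStarAlgebra B]

namespace FreeStarAlgebra

instance : StarModule ℂ (FreeStarAlgebra Y) where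
  star_smul c x := by
    induction x using TensorProduct.induction_on with
    | zero => simp
    | add x y hx hy => simp only [smul_add, star_add, hx, hy]
    | tmul a b => simp [TensorProduct.smul_tmul', TensorProduct.star_tmul]

/-- The generators of the free star-algebra. -/
def gen (y : Y) : FreeStarAlgebra Y := 1 ⊗ₜ FreeAlgebra.ι ℝ y

theorem star_gen (y : Y) : star (gen y) = gen y := by
  simp [gen, TensorProduct.star_tmul]

theorem commute_ofId (c : ℂ) (b : B) : Commute (Algebra.ofId ℂ B c) b :=
  Algebra.commutes c b

/-- The star-homomorphism determined by the images of the generators. -/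
def lift (g : Y → B) (hg : ∀ y, star (g y) = g y) : FreeStarAlgebra Y →⋆ₐ[ℂ] B :=
  { Algebra.TensorProduct.lift (Algebra.ofId ℂ B) (FreeAlgebra.lift ℝ g)
      (fun c x => commute_ofId c (FreeAlgebra.lift ℝ g x)) with
    map_star' := fun x => by
      have key : ∀ z : FreeAlgebra ℝ Y,
          FreeAlgebra.lift ℝ g (star z) = star (FreeAlgebra.lift ℝ g z) := by
        intro z
        induction z using FreeAlgebra.induction with
        | grade0 r =>
          rw [FreeAlgebra.star_algebraMap, AlgHom.commutes, ← algebraMap_star_comm, star_trivial]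
        | grade1 y => simp [hg]
        | mul a b ha hb => simp [ha, hb]
        | add a b ha hb => simp [ha, hb]
      change Algebra.TensorProduct.lift (Algebra.ofId ℂ B) (FreeAlgebra.lift ℝ g) _ (star x) =
        star (Algebra.TensorProduct.lift (Algebra.ofId ℂ B) (FreeAlgebra.lift ℝ g) _ x)
      induction x using TensorProduct.induction_on with
      | zero => simp
      | add x y hx hy => rw [star_add, map_add, map_add, star_add, hx, hy]
      | tmul c z =>
        rw [TensorProduct.star_tmul, Algebra.TensorProduct.lift_tmul,
          Algebra.TensorProduct.lift_tmul, key, star_mul, Algebra.ofId_apply, Algebra.ofId_apply,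
          ← algebraMap_star_comm]
        exact Algebra.commutes (star c) (star (FreeAlgebra.lift ℝ g z)) }

theorem lift_tmul (g : Y → B) (hg : ∀ y, star (g y) = g y) (c : ℂ) (z : FreeAlgebra ℝ Y) :
    lift g hg (c ⊗ₜ z) = algebraMap ℂ B c * FreeAlgebra.lift ℝ g z :=
  Algebra.TensorProduct.lift_tmul (Algebra.ofId ℂ B) (FreeAlgebra.lift ℝ g)
    (fun c x => commute_ofId c (FreeAlgebra.lift ℝ g x)) c z

theorem lift_gen (g : Y → B) (hg : ∀ y, star (g y) = g y) (y : Y) : lift g hg (gen y) = g y := by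
  rw [gen, lift_tmul, map_one, one_mul, FreeAlgebra.lift_ι_apply]

theorem mem_of_gen_mem (S : Subalgebra ℂ (FreeStarAlgebra Y)) (h : ∀ y, gen y ∈ S)
    (x : FreeStarAlgebra Y) : x ∈ S := by
  have key : ∀ z : FreeAlgebra ℝ Y, (1 : ℂ) ⊗ₜ[ℝ] z ∈ S := by
    intro z
    induction z using FreeAlgebra.induction with
    | grade0 r =>
      rw [Algebra.algebraMap_eq_smul_one, ← TensorProduct.smul_tmul, Complex.real_smul, mul_one]
      exact S.algebraMap_mem (r : ℂ)
    | grade1 y => exact h y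
    | mul a b ha hb => simpa using S.mul_mem ha hb
    | add a b ha hb => simpa [TensorProduct.tmul_add] using S.add_mem ha hb
  induction x using TensorProduct.induction_on with
  | zero => exact S.zero_mem
  | add x y hx hy => exact S.add_mem hx hy
  | tmul c z =>
    have : c ⊗ₜ[ℝ] z = c • ((1 : ℂ) ⊗ₜ[ℝ] z) := by
      rw [TensorProduct.smul_tmul', smul_eq_mul, mul_one]
    rw [this]
    exact S.smul_mem (key z) c

end FreeStarAlgebra

/-- The supremum of the C*-seminorms given by a pointwise bounded family of star-homomorphisms to
C*-algebras. -/
def CStarSeminorm.ofBounded {D : Type u} [Ring D] [StarRing D] [Algebra ℂ D] {ι : Type*}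
    {E : ι → Type*} [∀ i, CStarAlgebra (E i)] (f : ∀ i, D →⋆ₐ[ℂ] E i)
    (hf : ∀ x, BddAbove (Set.range fun i => ‖f i x‖)) : CStarSeminorm D where
  toFun x := ⨆ i, ‖f i x‖
  map_zero' := by simp
  add_le' x y := Real.iSup_le (fun i => by
      rw [map_add]
      exact (norm_add_le _ _).trans (add_le_add (le_ciSup (hf x) i) (le_ciSup (hf y) i)))
    (add_nonneg (Real.iSup_nonneg fun _ => norm_nonneg _) (Real.iSup_nonneg fun _ => norm_nonneg _))
  neg' x := by simp
  smul' c x := by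
    simp only [map_smul, norm_smul]
    exact (Real.mul_iSup_of_nonneg (norm_nonneg c) _).symm
  mul_le' x y := Real.iSup_le (fun i => by
      rw [map_mul]
      exact (norm_mul_le _ _).trans (mul_le_mul (le_ciSup (hf x) i) (le_ciSup (hf y) i)
        (norm_nonneg _) (Real.iSup_nonneg fun _ => norm_nonneg _)))
    (mul_nonneg (Real.iSup_nonneg fun _ => norm_nonneg _) (Real.iSup_nonneg fun _ => norm_nonneg _))
  star_mul_self' x := by
    have h0 : 0 ≤ ⨆ i, ‖f i x‖ := Real.iSup_nonneg fun _ => norm_nonneg _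
    have h0' : 0 ≤ ⨆ i, ‖f i (star x * x)‖ := Real.iSup_nonneg fun _ => norm_nonneg _
    refine le_antisymm (Real.iSup_le (fun i => ?_) (mul_nonneg h0 h0)) ?_
    · rw [map_mul, map_star, CStarRing.norm_star_mul_self]
      exact mul_le_mul (le_ciSup (hf x) i) (le_ciSup (hf x) i) (norm_nonneg _) h0
    · have h : ⨆ i, ‖f i x‖ ≤ √(⨆ i, ‖f i (star x * x)‖) := by
        refine Real.iSup_le (fun i => Real.le_sqrt_of_sq_le ?_) (Real.sqrt_nonneg _)
        rw [pow_two, ← CStarRing.norm_star_mul_self, ← map_star, ← map_mul]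
        exact le_ciSup (hf (star x * x)) i
      exact (mul_le_mul h h h0 (Real.sqrt_nonneg _)).trans (Real.mul_self_sqrt h0').le
  star' x := by simp [map_star]

end Free

/-! ### The universal symmetric family -/

section Universal

open scoped CStarAlgebra

variable {A : Type u} [CStarAlgebra A]

/-- A symmetric family through which every symmetric family (over a C*-algebra in the same
universe) factors uniquely. -/
structure IsUniversalFamily (φ : A →ₗ[ℂ] ℂ) (s : InvariantData A) {B : Type v} [CStarAlgebra B]
    (α : A →⋆ₐ[ℂ] A ⊗[ℂ] B) : Prop where
  isSymmetryFamily : IsSymmetryFamily φ s α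
  existsUnique : ∀ (B' : Type v) [CStarAlgebra B'] (α' : A →⋆ₐ[ℂ] A ⊗[ℂ] B'),
    IsSymmetryFamily φ s α' → ∃! Λ : B →⋆ₐ[ℂ] B', (idTensor A Λ).comp α = α'

/-- The coefficients of the family `α` generate `B` as a closed algebra. -/
def CoefficientsGenerate {B : Type v} [CStarAlgebra B] {n : ℕ} (e : Module.Basis (Fin n) ℂ A)
    (α : A →⋆ₐ[ℂ] A ⊗[ℂ] B) : Prop :=
  ∀ S : Subalgebra ℂ B, IsClosed (S : Set B) → (∀ i j, coeffMatrix e α i j ∈ S) → ∀ x, x ∈ S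

variable {B : Type v} [CStarAlgebra B] {n : ℕ} {e : Module.Basis (Fin n) ℂ A}
  {φ : A →ₗ[ℂ] ℂ}

/-- The norm of the unit is `1`, except in the zero algebra. -/
theorem CStarAlgebra.norm_one_le (B : Type*) [CStarAlgebra B] : ‖(1 : B)‖ ≤ 1 := by
  have : ‖(1 : B)‖ * ‖(1 : B)‖ = ‖(1 : B)‖ := by
    rw [← CStarRing.norm_star_mul_self, star_one, one_mul]
  nlinarith [norm_nonneg (1 : B)]

open scoped ComplexOrder CStarAlgebra in
theorem norm_coeffMatrix_le {α : A →⋆ₐ[ℂ] A ⊗[ℂ] B}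
    (hu : star (coeffMatrix e α) * coeffMatrix e α = 1) (i j : Fin n) :
    ‖coeffMatrix e α i j‖ ≤ 1 := by
  let _ := CStarAlgebra.spectralOrder B
  have := CStarAlgebra.spectralOrderedRing B
  have h1 : ∑ k, star (coeffMatrix e α k j) * coeffMatrix e α k j = 1 := by
    have := congrFun (congrFun hu j) j
    rwa [Matrix.mul_apply, Matrix.one_apply_eq] at this
  have h2 : star (coeffMatrix e α i j) * coeffMatrix e α i j ≤ 1 := by
    rw [← h1]
    exact Finset.single_le_sum (f := fun k => star (coeffMatrix e α k j) * coeffMatrix e α k j)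
      (fun k _ => star_mul_self_nonneg _) (Finset.mem_univ i)
  have h3 := CStarAlgebra.norm_le_norm_of_nonneg_of_le (star_mul_self_nonneg _) h2
  have h4 := CStarAlgebra.norm_one_le B
  rw [CStarRing.norm_star_mul_self] at h3
  nlinarith [norm_nonneg (coeffMatrix e α i j)]

/-- Adjoints of coefficients are linear combinations of coefficients, because `α` commutes with
the involutions. -/
theorem star_coeffMatrix_mem (e : Module.Basis (Fin n) ℂ A) (α : A →⋆ₐ[ℂ] A ⊗[ℂ] B)
    (S : Submodule ℂ B) (hS : ∀ i j, coeffMatrix e α i j ∈ S) (i j : Fin n) :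
    star (coeffMatrix e α i j) ∈ S := by
  have h1 : ∀ (ψ : A →ₗ[ℂ] ℂ) (a : A), sliceLeft ψ (α a) ∈ S := by
    intro ψ a
    rw [← e.sum_repr a]
    simp only [map_sum, map_smul, apply_basis_eq_sum e α, sliceLeft_tmul]
    exact S.sum_mem fun i _ => S.smul_mem _ (S.sum_mem fun k _ => S.smul_mem _ (hS k i))
  let ψ : A →ₗ[ℂ] ℂ :=
    { toFun := fun a => star (e.coord i (star a))
      map_add' := fun a b => by simp
      map_smul' := fun c a => by simp }
  have h2 : ∀ z : A ⊗[ℂ] B, sliceLeft ψ (star z) = star (sliceLeft (e.coord i) z) := by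
    intro z
    induction z with
    | zero => simp
    | add x y hx hy => simp only [star_add, map_add, hx, hy]
    | tmul a b => simp [ψ, TensorProduct.star_tmul]
  rw [coeffMatrix_apply, ← h2, ← map_star]
  exact h1 _ _

theorem CoefficientsGenerate.hom_ext {α : A →⋆ₐ[ℂ] A ⊗[ℂ] B} (h : CoefficientsGenerate e α)
    {B' : Type*} [CStarAlgebra B'] {F G : B →⋆ₐ[ℂ] B'}
    (hFG : ∀ i j, F (coeffMatrix e α i j) = G (coeffMatrix e α i j)) : F = G := by
  refine StarAlgHom.ext fun x => ?_
  exact h (AlgHom.equalizer F.toAlgHom G.toAlgHom)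
    (isClosed_eq (map_continuous F) (map_continuous G)) hFG x

end Universal

namespace UniversalFamily

/-- Symmetric families over C*-algebras of a fixed universe. -/
structure Family {A : Type u} [CStarAlgebra A] (φ : A →ₗ[ℂ] ℂ) (s : InvariantData A) where
  carrier : Type v
  [cstarAlgebra : CStarAlgebra carrier]
  map : A →⋆ₐ[ℂ] A ⊗[ℂ] carrier
  isSymmetryFamily : IsSymmetryFamily φ s map

attribute [instance] Family.cstarAlgebra

/-- Generators for the real and imaginary parts of the entries of an `n × n` matrix, lifted to the
universe of the families, so that the universal C*-algebra lies in it. -/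
abbrev Generators (n : ℕ) : Type v := ULift.{v} ((Fin n × Fin n) ⊕ (Fin n × Fin n))

variable {A : Type u} [CStarAlgebra A] {n : ℕ} (e : Module.Basis (Fin n) ℂ A)
  {φ : A →ₗ[ℂ] ℂ} {s : InvariantData A}

/-- The images of the generators in a symmetric family: the real and imaginary parts of its
coefficients. -/
def parts (X : Family.{u, v} φ s) : Generators.{v} n → X.carrier
  | ⟨.inl ij⟩ => realPart (coeffMatrix e X.map ij.1 ij.2)
  | ⟨.inr ij⟩ => imaginaryPart (coeffMatrix e X.map ij.1 ij.2)

theorem star_parts (X : Family.{u, v} φ s) : ∀ y, star (parts e X y) = parts e X y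
  | ⟨.inl ij⟩ => (realPart (coeffMatrix e X.map ij.1 ij.2)).2
  | ⟨.inr ij⟩ => (imaginaryPart (coeffMatrix e X.map ij.1 ij.2)).2

/-- The star-homomorphism from the free star-algebra given by a symmetric family. -/
def eval (X : Family.{u, v} φ s) : FreeStarAlgebra (Generators.{v} n) →⋆ₐ[ℂ] X.carrier :=
  FreeStarAlgebra.lift (parts e X) (star_parts e X)

variable {e}

theorem norm_parts_le (he : IsOrthonormalFor φ e) (X : Family.{u, v} φ s) (y : Generators.{v} n) :
    ‖parts e X y‖ ≤ 1 := by
  have hu := (preservesFunctional_iff he).1 X.isSymmetryFamily.preserves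
  obtain ⟨ij | ij⟩ := y
  · exact (realPart.norm_le _).trans (norm_coeffMatrix_le hu _ _)
  · exact (imaginaryPart.norm_le _).trans (norm_coeffMatrix_le hu _ _)

theorem bddAbove_eval (he : IsOrthonormalFor φ e) (s : InvariantData A)
    (x : FreeStarAlgebra (Generators.{v} n)) :
    BddAbove (Set.range fun X : Family.{u, v} φ s => ‖eval e X x‖) := by
  let S : Subalgebra ℂ (FreeStarAlgebra (Generators.{v} n)) :=
    { carrier := {x | ∃ C : ℝ, ∀ X : Family.{u, v} φ s, ‖eval e X x‖ ≤ C}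
      mul_mem' := by
        rintro x y ⟨C, hC⟩ ⟨C', hC'⟩
        refine ⟨C * C', fun X => ?_⟩
        rw [map_mul]
        exact (norm_mul_le _ _).trans (mul_le_mul (hC X) (hC' X) (norm_nonneg _)
          ((norm_nonneg _).trans (hC X)))
      add_mem' := by
        rintro x y ⟨C, hC⟩ ⟨C', hC'⟩
        refine ⟨C + C', fun X => ?_⟩
        rw [map_add]
        exact (norm_add_le _ _).trans (add_le_add (hC X) (hC' X))
      algebraMap_mem' := fun r => ⟨‖r‖, fun X => by
        rw [Algebra.algebraMap_eq_smul_one, map_smul, map_one, norm_smul]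
        exact mul_le_of_le_one_right (norm_nonneg _) (CStarAlgebra.norm_one_le _)⟩ }
  obtain ⟨C, hC⟩ := FreeStarAlgebra.mem_of_gen_mem S (fun y => ⟨1, fun X => by
    rw [eval, FreeStarAlgebra.lift_gen]
    exact norm_parts_le he X y⟩) x
  exact ⟨C, Set.forall_mem_range.2 hC⟩

/-- The universal C*-seminorm on the free star-algebra: the supremum of `‖x‖` over all symmetric
families. The supremum is taken in `ℝ`, so the size of the index type does not matter. -/
def seminorm (he : IsOrthonormalFor φ e) (s : InvariantData A) :
    CStarSeminorm (FreeStarAlgebra (Generators.{v} n)) :=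
  CStarSeminorm.ofBounded (fun X : Family.{u, v} φ s => eval e X) (bddAbove_eval he s)

/-- The universal C*-algebra: the completion of the free star-algebra in the largest C*-seminorm
that comes from symmetric families. -/
abbrev Carrier (he : IsOrthonormalFor φ e) (s : InvariantData A) : Type v :=
  (seminorm.{u, v} he s).Completion

theorem norm_eval_le (he : IsOrthonormalFor φ e) (X : Family.{u, v} φ s)
    (x : FreeStarAlgebra (Generators.{v} n)) :
    ‖eval e X x‖ ≤ (seminorm.{u, v} he s).toFun x :=
  le_ciSup (bddAbove_eval he s x) X

/-- The map from the universal C*-algebra given by a symmetric family. -/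
def proj (he : IsOrthonormalFor φ e) (X : Family.{u, v} φ s) :
    Carrier.{u, v} he s →⋆ₐ[ℂ] X.carrier :=
  (seminorm.{u, v} he s).extend (eval e X) (norm_eval_le he X)

theorem proj_incl (he : IsOrthonormalFor φ e) (X : Family.{u, v} φ s)
    (x : FreeStarAlgebra (Generators.{v} n)) :
    proj he X ((seminorm.{u, v} he s).incl x) = eval e X x :=
  (seminorm.{u, v} he s).extend_incl _ (norm_eval_le he X) x

/-- The symmetric families separate the points of the universal C*-algebra. -/
theorem eq_zero_of_forall_proj (he : IsOrthonormalFor φ e) (x : Carrier.{u, v} he s)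
    (hx : ∀ X : Family.{u, v} φ s, proj he X x = 0) : x = 0 := by
  refine (seminorm.{u, v} he s).eq_zero_of_forall (proj he) (fun x M hM h => ?_) hx
  refine Real.iSup_le (fun X => ?_) hM
  have := h X
  rwa [proj_incl] at this

/-- The coefficients of the universal family. -/
def coeff (he : IsOrthonormalFor φ e) (s : InvariantData A) (i j : Fin n) :
    Carrier.{u, v} he s :=
  (seminorm.{u, v} he s).incl (.gen ⟨.inl (i, j)⟩) +
    Complex.I • (seminorm.{u, v} he s).incl (.gen ⟨.inr (i, j)⟩)

theorem proj_coeff (he : IsOrthonormalFor φ e) (X : Family.{u, v} φ s) (i j : Fin n) :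
    proj he X (coeff he s i j) = coeffMatrix e X.map i j := by
  rw [coeff, map_add, map_smul, proj_incl, proj_incl, eval,
    FreeStarAlgebra.lift_gen, FreeStarAlgebra.lift_gen]
  exact realPart_add_I_smul_imaginaryPart _

/-- The linear map underlying the universal family. -/
def linearMap (he : IsOrthonormalFor φ e) (s : InvariantData A) :
    A →ₗ[ℂ] A ⊗[ℂ] Carrier.{u, v} he s :=
  e.constr ℂ fun j => ∑ i, e i ⊗ₜ coeff he s i j

theorem idTensor_proj_linearMap (he : IsOrthonormalFor φ e) (X : Family.{u, v} φ s) (a : A) :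
    idTensor A (proj he X) (linearMap he s a) = X.map a := by
  have : (idTensor A (proj he X)).toAlgHom.toLinearMap ∘ₗ linearMap he s =
      X.map.toAlgHom.toLinearMap := by
    refine e.ext fun j => ?_
    change idTensor A (proj he X) (linearMap he s (e j)) = X.map (e j)
    rw [linearMap, e.constr_basis, map_sum, apply_basis_eq_sum e X.map]
    simp only [idTensor_tmul, proj_coeff]
  exact LinearMap.congr_fun this a

theorem eq_of_forall_proj (he : IsOrthonormalFor φ e) {z w : A ⊗[ℂ] Carrier.{u, v} he s}
    (h : ∀ X : Family.{u, v} φ s, idTensor A (proj he X) z = idTensor A (proj he X) w) : z = w :=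
  eq_of_idTensor_eq e (proj he) (eq_zero_of_forall_proj he) h

/-- The universal symmetric family. It is multiplicative and star-preserving because all its images
under the maps `id ⊗ proj` are. -/
def map (he : IsOrthonormalFor φ e) (s : InvariantData A) :
    A →⋆ₐ[ℂ] A ⊗[ℂ] Carrier.{u, v} he s where
  toFun := linearMap he s
  map_one' := eq_of_forall_proj he fun X => by
    rw [idTensor_proj_linearMap, map_one, map_one]
  map_mul' a b := eq_of_forall_proj he fun X => by
    simp only [idTensor_proj_linearMap, map_mul]
  map_zero' := map_zero _
  map_add' := map_add _
  commutes' c := eq_of_forall_proj he fun X => by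
    simp only [idTensor_proj_linearMap, AlgHomClass.commutes]
  map_star' a := eq_of_forall_proj he fun X => by
    simp only [idTensor_proj_linearMap, map_star]

theorem idTensor_proj_comp_map (he : IsOrthonormalFor φ e) (X : Family.{u, v} φ s) :
    (idTensor A (proj he X)).comp (map he s) = X.map :=
  StarAlgHom.ext (idTensor_proj_linearMap he X)

theorem coeffMatrix_map (he : IsOrthonormalFor φ e) (s : InvariantData A) (i j : Fin n) :
    coeffMatrix e (map.{u, v} he s) i j = coeff he s i j := by
  change sliceLeft (e.coord i) (linearMap he s (e j)) = _
  rw [linearMap, e.constr_basis, e.slice_sum_tmul]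

theorem isSymmetryFamily_map (he : IsOrthonormalFor φ e) (s : InvariantData A) :
    IsSymmetryFamily φ s (map.{u, v} he s) :=
  IsSymmetryFamily.of_jointly_injective he (proj he) (eq_zero_of_forall_proj he) fun X => by
    rw [idTensor_proj_comp_map]
    exact X.isSymmetryFamily

/-- The generators are linear combinations of coefficients and their adjoints, hence of
coefficients. -/
theorem coefficientsGenerate_map (he : IsOrthonormalFor φ e) (s : InvariantData A) :
    CoefficientsGenerate e (map.{u, v} he s) := by
  intro S hS hu x
  have hu' : ∀ i j, coeff he s i j ∈ S := fun i j => coeffMatrix_map he s i j ▸ hu i j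
  have hs : ∀ i j, star (coeff he s i j) ∈ S := fun i j => by
    have := star_coeffMatrix_mem e (map.{u, v} he s) S.toSubmodule hu i j
    rwa [coeffMatrix_map] at this
  have hre : ∀ i j, (seminorm.{u, v} he s).incl (.gen ⟨.inl (i, j)⟩) =
      (1 / 2 : ℂ) • (coeff he s i j + star (coeff he s i j)) := fun i j => by
    simp only [coeff, star_add, star_smul, ← map_star, FreeStarAlgebra.star_gen,
      RCLike.star_def, Complex.conj_I]
    module
  have him : ∀ i j, (seminorm.{u, v} he s).incl (.gen ⟨.inr (i, j)⟩) =
      (- Complex.I / 2 : ℂ) • (coeff he s i j - star (coeff he s i j)) := fun i j => by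
    simp only [coeff, star_add, star_smul, ← map_star, FreeStarAlgebra.star_gen,
      RCLike.star_def, Complex.conj_I, smul_sub, smul_add, smul_smul]
    have h1 : -Complex.I / 2 * Complex.I = 1 / 2 := by
      linear_combination (-1 / 2 : ℂ) * Complex.I_mul_I
    have h2 : -Complex.I / 2 * -Complex.I = -1 / 2 := by
      linear_combination (1 / 2 : ℂ) * Complex.I_mul_I
    rw [h1, h2]
    module
  have hd : ∀ d, (seminorm.{u, v} he s).incl d ∈ S := by
    refine FreeStarAlgebra.mem_of_gen_mem (S.comap (seminorm.{u, v} he s).incl.toAlgHom) ?_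
    rintro ⟨ij | ij⟩
    · change (seminorm.{u, v} he s).incl (.gen ⟨.inl (ij.1, ij.2)⟩) ∈ S
      rw [hre]
      exact S.smul_mem (S.add_mem (hu' _ _) (hs _ _)) _
    · change (seminorm.{u, v} he s).incl (.gen ⟨.inr (ij.1, ij.2)⟩) ∈ S
      rw [him]
      exact S.smul_mem (S.sub_mem (hu' _ _) (hs _ _)) _
  exact (seminorm.{u, v} he s).denseRange_incl.induction_on x hS hd

theorem isUniversalFamily_map (he : IsOrthonormalFor φ e) (s : InvariantData A) :
    IsUniversalFamily φ s (map.{u, v} he s) where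
  isSymmetryFamily := isSymmetryFamily_map he s
  existsUnique B' _ α' hα' := by
    refine ⟨proj he ⟨B', α', hα'⟩, idTensor_proj_comp_map he ⟨B', α', hα'⟩, fun Λ hΛ => ?_⟩
    refine (coefficientsGenerate_map he s).hom_ext fun i j => ?_
    rw [coeffMatrix_map, proj_coeff]
    refine Eq.trans ?_ (congrArg (coeffMatrix e · i j) hΛ)
    rw [coeffMatrix_idTensor, Matrix.map_apply, coeffMatrix_map]

end UniversalFamily

section Universal

open scoped CStarAlgebra

variable {A : Type u} [CStarAlgebra A] {B : Type v} [CStarAlgebra B] {n : ℕ}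
  {e : Module.Basis (Fin n) ℂ A} {φ : A →ₗ[ℂ] ℂ} {s : InvariantData A}
  {α : A →⋆ₐ[ℂ] A ⊗[ℂ] B}

/-- Every universal family is isomorphic to the one constructed from the free star-algebra. -/
theorem IsUniversalFamily.coefficientsGenerate (he : IsOrthonormalFor φ e)
    (hα : IsUniversalFamily φ s α) : CoefficientsGenerate e α := by
  intro S hS hu x
  obtain ⟨Λ, hΛ, -⟩ := hα.existsUnique _ _ (UniversalFamily.isSymmetryFamily_map.{u, v} he s)
  obtain ⟨Λ', hΛ', -⟩ := (UniversalFamily.isUniversalFamily_map.{u, v} he s).existsUnique _ _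
    hα.isSymmetryFamily
  have hid : Λ'.comp Λ = StarAlgHom.id ℂ B := by
    refine (hα.existsUnique _ _ hα.isSymmetryFamily).unique ?_ ?_
    · rw [← idTensor_comp_idTensor, StarAlgHom.comp_assoc, hΛ, hΛ']
    · rw [idTensor_id]
      rfl
  have hx := UniversalFamily.coefficientsGenerate_map.{u, v} he s (S.comap Λ'.toAlgHom)
    (hS.preimage (map_continuous Λ')) (fun i j => by
      change Λ' _ ∈ S
      have : (coeffMatrix e (UniversalFamily.map.{u, v} he s)).map Λ' i j ∈ S := by
        rw [← coeffMatrix_idTensor, hΛ']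
        exact hu i j
      exact this) (Λ x)
  have h2 : Λ' (Λ x) = x := DFunLike.congr_fun hid x
  rw [← h2]
  exact hx

theorem IsUniversalFamily.nontrivial (hα : IsUniversalFamily φ s α) : Nontrivial B := by
  -- a nonzero C*-algebra in the right universe
  obtain ⟨Λ, -, -⟩ := hα.existsUnique C(PUnit.{v + 1}, ℂ) _ (isSymmetryFamily_trivial s)
  exact Λ.toAlgHom.toRingHom.domain_nontrivial

end Universal

/-! ### The range of a star-homomorphism -/

section Range

open scoped CStarAlgebra

variable {B B' : Type*} [CStarAlgebra B] [CStarAlgebra B']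

/-- A self-adjoint element in the range of a star-homomorphism lifts without increasing the norm:
truncate the spectrum of any self-adjoint lift. -/
theorem StarAlgHom.exists_lift_of_isSelfAdjoint (π : B →⋆ₐ[ℂ] B') {x : B} (hx : IsSelfAdjoint x) :
    ∃ y, π y = π x ∧ ‖y‖ ≤ ‖π x‖ := by
  let f : ℝ → ℝ := fun t => max (-‖π x‖) (min t ‖π x‖)
  have hf : Continuous f := by fun_prop
  have hπx : IsSelfAdjoint (π x) := hx.map π
  refine ⟨cfc f x, ?_, norm_cfc_le (norm_nonneg _) fun t _ => ?_⟩
  · rw [StarAlgHom.map_cfc π f x hf.continuousOn (map_continuous π) hx hπx]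
    conv_rhs => rw [← cfc_id ℝ (π x) hπx]
    refine cfc_congr fun t ht => ?_
    have h1 : ‖t‖ ≤ ‖π x‖ := by
      have := norm_apply_le_norm_cfc (id : ℝ → ℝ) (π x) ht continuousOn_id hπx
      rwa [cfc_id ℝ (π x) hπx] at this
    obtain ⟨h2, h3⟩ := abs_le.1 h1
    simp [f, h2, h3]
  · refine abs_le.2 ⟨le_max_left _ _, max_le ?_ (min_le_right _ _)⟩
    linarith [norm_nonneg (π x)]

theorem StarAlgHom.exists_lift_norm_le (π : B →⋆ₐ[ℂ] B') (x : B) :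
    ∃ y, π y = π x ∧ ‖y‖ ≤ 2 * ‖π x‖ := by
  obtain ⟨y, hy, hy'⟩ := π.exists_lift_of_isSelfAdjoint (realPart x).2
  obtain ⟨z, hz, hz'⟩ := π.exists_lift_of_isSelfAdjoint (imaginaryPart x).2
  rw [map_realPart] at hy hy'
  rw [map_imaginaryPart] at hz hz'
  refine ⟨y + Complex.I • z, ?_, ?_⟩
  · rw [map_add, map_smul, hy, hz, realPart_add_I_smul_imaginaryPart]
  · refine (norm_add_le _ _).trans ?_
    rw [norm_smul, Complex.norm_I, one_mul, two_mul]
    exact add_le_add (hy'.trans (realPart.norm_le (π x)))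
      (hz'.trans (imaginaryPart.norm_le (π x)))

/-- Controlled lifts exist on the range, hence on its closure by completeness. -/
theorem StarAlgHom.isClosed_range (π : B →⋆ₐ[ℂ] B') : IsClosed (Set.range π) := by
  let f : NormedAddGroupHom B B' := AddMonoidHom.mkNormedAddGroupHom
    (π : B →+ B') 1 fun x => by
      rw [one_mul]
      exact NonUnitalStarAlgHom.norm_apply_le π x
  have h := controlled_closure_of_complete (f := f) (K := f.range) two_pos one_pos (by
    rintro _ ⟨x, rfl⟩
    exact π.exists_lift_norm_le x)
  refine isClosed_of_closure_subset fun b hb => ?_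
  obtain ⟨g, hg, -⟩ := h b hb
  exact ⟨g, hg⟩

end Range

namespace SpatialTensor

variable {A : Type u} {B : Type v} [CStarAlgebra A] [CStarAlgebra B]

theorem star_tmul (a : A) (b : B) : star (tmul a b) = tmul (star a) (star b) := by
  rw [tmul, ← map_star, TensorProduct.star_tmul]
  rfl

theorem sum_tmul {ι : Type*} (t : Finset ι) (f : ι → A) (b : B) :
    tmul (∑ i ∈ t, f i) b = ∑ i ∈ t, tmul (f i) b := by
  simp only [tmul, TensorProduct.sum_tmul, map_sum]

theorem tmul_sum {ι : Type*} (t : Finset ι) (a : A) (f : ι → B) :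
    tmul a (∑ i ∈ t, f i) = ∑ i ∈ t, tmul a (f i) := by
  simp only [tmul, TensorProduct.tmul_sum, map_sum]

theorem dense_of_forall_tmul_mem (S : Submodule ℂ (SpatialTensor A B))
    (h : ∀ a b, tmul a b ∈ S.topologicalClosure) : Dense (S : Set (SpatialTensor A B)) := by
  intro z
  refine (spatialSeminorm A B).denseRange_incl.induction_on z isClosed_closure fun x => ?_
  change incl A B x ∈ S.topologicalClosure
  induction x with
  | zero => rw [map_zero]; exact Submodule.zero_mem _
  | add x y hx hy => rw [map_add]; exact Submodule.add_mem _ hx hy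
  | tmul a b => exact h a b

end SpatialTensor

/-! ### Compact quantum groups from universal families -/

section QuantumGroup

open scoped CStarAlgebra

open SpatialTensor

variable {A : Type u} [CStarAlgebra A] {B : Type v} [CStarAlgebra B] {n : ℕ}
  {e : Module.Basis (Fin n) ℂ A} {α : A →⋆ₐ[ℂ] A ⊗[ℂ] B} {Δ : B →⋆ₐ[ℂ] SpatialTensor B B}

theorem isAction_iff :
    IsAction Δ α ↔ IsInvertibleFamily α ∧ (idTensor A Δ).comp α = selfComp α := by
  constructor
  · refine fun h => ⟨h.invertible, StarAlgHom.ext fun a => ?_⟩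
    rw [StarAlgHom.comp_apply, idTensor_eq_lTensor, h.action_eq, selfComp, StarAlgHom.comp_apply,
      tensorId_eq]
  · refine fun h => ⟨h.1, fun a => ?_⟩
    rw [← idTensor_eq_lTensor, ← tensorId_eq]
    exact DFunLike.congr_fun h.2 a

/-- The coproduct on coefficients: `Δ(u_ij) = ∑ₖ u_ik ⊗ u_kj`. -/
theorem IsAction.apply_coeffMatrix (h : IsAction Δ α) (e : Module.Basis (Fin n) ℂ A)
    (i j : Fin n) : Δ (coeffMatrix e α i j) =
      ∑ k, tmul (coeffMatrix e α i k) (coeffMatrix e α k j) := by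
  have h1 : (coeffMatrix e α).map Δ = coeffMatrix e (selfComp α) := by
    rw [← coeffMatrix_idTensor, (isAction_iff.1 h).2]
  rw [coeffMatrix_selfComp] at h1
  refine (congrFun (congrFun h1 i) j).trans ?_
  rw [Matrix.mul_apply]
  refine Finset.sum_congr rfl fun k _ => ?_
  rw [Matrix.map_apply, Matrix.map_apply, includeLeft_apply, includeRight_apply, tmul_mul_tmul,
    mul_one, one_mul]

/-- Both sides of coassociativity map `u_ij` to `∑ u_ik ⊗ u_kl ⊗ u_lj`. -/
theorem CoefficientsGenerate.isCoassociative (hα : CoefficientsGenerate e α)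
    (h : IsAction Δ α) : IsCoassociative Δ := by
  refine ⟨SpatialTensor.assoc B B B, SpatialTensor.assoc_tmul, fun b => ?_⟩
  have key : ((SpatialTensor.assoc B B B).comp (SpatialTensor.map Δ (StarAlgHom.id ℂ B))).comp Δ =
      (SpatialTensor.map (StarAlgHom.id ℂ B) Δ).comp Δ := by
    refine hα.hom_ext fun i j => ?_
    simp only [StarAlgHom.comp_apply, h.apply_coeffMatrix e, map_sum, map_tmul, sum_tmul, tmul_sum,
      assoc_tmul, StarAlgHom.coe_id, id_eq]
    exact Finset.sum_comm
  exact DFunLike.congr_fun key b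

/-- If the span of `Δ(B) g(B)` contains `f(u_ij)` for all generators `u_ij` of `B`, its closure
contains `f(B) g(B)`. -/
theorem CoefficientsGenerate.mul_mem_closure_span (hα : CoefficientsGenerate e α) {R : Type*}
    [CStarAlgebra R] (δ f g : B →⋆ₐ[ℂ] R) (hfg : ∀ b c, Commute (f b) (g c))
    (hu : ∀ i j, f (coeffMatrix e α i j) ∈ Submodule.span ℂ {x | ∃ a b : B, x = δ a * g b})
    (b c : B) :
    f b * g c ∈ (Submodule.span ℂ {x | ∃ a b : B, x = δ a * g b}).topologicalClosure := by
  set E := Submodule.span ℂ {x | ∃ a b : B, x = δ a * g b} with hE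
  have h1 : ∀ (x y z : R), (∀ w ∈ E, x * w * y ∈ E) → z ∈ E.topologicalClosure →
      x * z * y ∈ E.topologicalClosure := fun x y z h hz =>
    map_mem_closure (f := fun w => x * w * y) (by fun_prop) hz h
  have hl : ∀ (a : B), ∀ z ∈ E.topologicalClosure, δ a * z ∈ E.topologicalClosure := by
    intro a z hz
    have := h1 (δ a) 1 z (fun w hw => ?_) hz
    · rwa [mul_one] at this
    · rw [mul_one]
      induction hw using Submodule.span_induction with
      | mem x hx =>
        obtain ⟨a', b', rfl⟩ := hx
        exact Submodule.subset_span ⟨a * a', b', by rw [map_mul, mul_assoc]⟩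
      | zero => rw [mul_zero]; exact E.zero_mem
      | add x y _ _ hx hy => rw [mul_add]; exact E.add_mem hx hy
      | smul r x _ hx => rw [mul_smul_comm]; exact E.smul_mem r hx
  have hr : ∀ (c : B), ∀ z ∈ E.topologicalClosure, z * g c ∈ E.topologicalClosure := by
    intro c z hz
    have := h1 1 (g c) z (fun w hw => ?_) hz
    · rwa [one_mul] at this
    · rw [one_mul]
      induction hw using Submodule.span_induction with
      | mem x hx =>
        obtain ⟨a', b', rfl⟩ := hx
        exact Submodule.subset_span ⟨a', b' * c, by rw [map_mul, mul_assoc]⟩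
      | zero => rw [zero_mul]; exact E.zero_mem
      | add x y _ _ hx hy => rw [add_mul]; exact E.add_mem hx hy
      | smul r x _ hx => rw [smul_mul_assoc]; exact E.smul_mem r hx
  -- since `f(b)` commutes with `g(B)`, `δ(a) g(c) f(b) = δ(a) f(b) g(c)`
  have hm : ∀ b, f b ∈ E.topologicalClosure → ∀ z ∈ E.topologicalClosure,
      z * f b ∈ E.topologicalClosure := by
    intro b hb z hz
    have hsub : ∀ w ∈ E, w * f b ∈ E.topologicalClosure := by
      intro w hw
      induction hw using Submodule.span_induction with
      | mem x hx =>
        obtain ⟨a', b', rfl⟩ := hx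
        rw [mul_assoc, ← (hfg b b').eq]
        exact hl _ _ (hr _ _ hb)
      | zero => rw [zero_mul]; exact Submodule.zero_mem _
      | add x y _ _ hx hy => rw [add_mul]; exact Submodule.add_mem _ hx hy
      | smul r x _ hx => rw [smul_mul_assoc]; exact Submodule.smul_mem _ r hx
    have := map_mem_closure (f := fun w => w * f b) (by fun_prop) hz hsub
    rwa [E.isClosed_topologicalClosure.closure_eq] at this
  have h1E : (1 : R) ∈ E := Submodule.subset_span ⟨1, 1, by rw [map_one, map_one, mul_one]⟩
  let T : Subalgebra ℂ B :=
    { carrier := {b | f b ∈ E.topologicalClosure}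
      mul_mem' := fun {b b'} hb hb' => by
        change f (b * b') ∈ E.topologicalClosure
        rw [map_mul]
        exact hm b' hb' _ hb
      add_mem' := fun {b b'} hb hb' => by
        change f (b + b') ∈ E.topologicalClosure
        rw [map_add]
        exact Submodule.add_mem _ hb hb'
      algebraMap_mem' := fun r => by
        change f (algebraMap ℂ B r) ∈ E.topologicalClosure
        rw [AlgHomClass.commutes, Algebra.algebraMap_eq_smul_one]
        exact Submodule.smul_mem _ r (E.le_topologicalClosure h1E) }
  refine hr c _ (hα T (E.isClosed_topologicalClosure.preimage (map_continuous f)) (fun i j => ?_) b)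
  exact E.le_topologicalClosure (hu i j)

/-- A generating family with unitary coefficient matrix and an action of `Δ` make `Δ` a compact
quantum group. -/
theorem CoefficientsGenerate.isCompactQuantumGroup [Nontrivial B] (hα : CoefficientsGenerate e α)
    (hu : coeffMatrix e α ∈ unitary (Matrix (Fin n) (Fin n) B)) (h : IsAction Δ α) :
    IsCompactQuantumGroup Δ where
  nontrivial := inferInstance
  coassoc := hα.isCoassociative h
  dense_right := by
    refine dense_of_forall_tmul_mem _ fun b c => ?_
    have := hα.mul_mem_closure_span Δ (includeLeft B B) (includeRight B B)
      commute_includeLeft_includeRight (fun i j => ?_) b c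
    · rwa [includeLeft_apply, includeRight_apply, tmul_mul_tmul, mul_one, one_mul] at this
    · -- `u_ij ⊗ 1 = ∑ₖ Δ(u_ik)(1 ⊗ u_jk*)`, because `u u* = 1`
      have hsum : includeLeft B B (coeffMatrix e α i j) =
          ∑ k, Δ (coeffMatrix e α i k) * includeRight B B (star (coeffMatrix e α) k j) := by
        simp only [h.apply_coeffMatrix e, includeRight_apply, Finset.sum_mul, tmul_mul_tmul,
          mul_one]
        rw [Finset.sum_comm]
        simp only [← tmul_sum, ← Matrix.mul_apply, hu.2, Matrix.one_apply]
        rw [Finset.sum_eq_single j (fun l _ hl => by simp [hl, tmul]) (by simp), if_pos rfl]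
        rfl
      rw [hsum]
      exact Submodule.sum_mem _ fun k _ => Submodule.subset_span ⟨_, _, rfl⟩
  dense_left := by
    -- the adjoint of `(B ⊗ 1)Δ(B)` is `Δ(B)(B ⊗ 1)`
    set E := Submodule.span ℂ {x | ∃ a b : B, x = Δ a * includeLeft B B b} with hE
    have hstar : ∀ i j, includeRight B B (star (coeffMatrix e α i j)) ∈ E := by
      intro i j
      -- the adjoint of `1 ⊗ u_ij = ∑ₖ (u_ki* ⊗ 1)Δ(u_kj)`, which follows from `u* u = 1`
      have hsum : includeRight B B (star (coeffMatrix e α i j)) =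
          ∑ k, Δ (star (coeffMatrix e α k j)) * includeLeft B B (coeffMatrix e α k i) := by
        apply star_injective
        simp only [star_sum, star_mul, ← map_star, star_star, h.apply_coeffMatrix e,
          includeLeft_apply, star_tmul, star_one, Finset.mul_sum, tmul_mul_tmul, one_mul]
        rw [Finset.sum_comm]
        have hl : ∀ l, ∑ k, star (coeffMatrix e α k i) * coeffMatrix e α k l =
            (1 : Matrix (Fin n) (Fin n) B) i l := fun l => by
          rw [← hu.1, Matrix.mul_apply]
          rfl
        simp only [← sum_tmul, hl, Matrix.one_apply]
        rw [Finset.sum_eq_single i (fun l _ hl => by simp [hl.symm, tmul]) (by simp), if_pos rfl]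
        rfl
      rw [hsum]
      exact Submodule.sum_mem _ fun k _ => Submodule.subset_span ⟨_, _, rfl⟩
    -- coefficients are linear combinations of adjoints of coefficients
    have hmem : ∀ i j, includeRight B B (coeffMatrix e α i j) ∈ E := by
      intro i j
      have := star_coeffMatrix_mem e α ((E.comap (includeRight B B).toAlgHom.toLinearMap).comap
        (starLinearEquiv ℂ : B ≃ₗ⋆[ℂ] B).toLinearMap) hstar i j
      have h2 : includeRight B B (star (star (coeffMatrix e α i j))) ∈ E := this
      rwa [star_star] at h2
    refine dense_of_forall_tmul_mem _ fun b c => ?_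
    have h1 := hα.mul_mem_closure_span Δ (includeRight B B) (includeLeft B B)
      (fun b c => (commute_includeLeft_includeRight c b).symm) hmem (star c) (star b)
    have h2 := map_mem_closure (t := (Submodule.span ℂ
      {x : SpatialTensor B B | ∃ a b : B, x = .tmul b 1 * Δ a} : Set (SpatialTensor B B)))
      continuous_star h1 (fun x hx => ?_)
    · rwa [star_mul, ← map_star, ← map_star, star_star, star_star, includeLeft_apply,
        includeRight_apply, tmul_mul_tmul, mul_one, one_mul] at h2
    · change x ∈ E at hx
      induction hx using Submodule.span_induction with
      | mem x hx =>
        obtain ⟨a, b, rfl⟩ := hx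
        refine Submodule.subset_span ⟨star a, star b, ?_⟩
        rw [star_mul, ← map_star, ← map_star, includeLeft_apply]
      | zero => rw [star_zero]; exact Submodule.zero_mem _
      | add x y _ _ hx hy => rw [star_add]; exact Submodule.add_mem _ hx hy
      | smul r x _ hx => rw [star_smul]; exact Submodule.smul_mem _ _ hx

variable {φ : A →ₗ[ℂ] ℂ} {s : InvariantData A}

/-- Universality, applied to the composition `(α ⊗ id) ∘ α`, yields the coproduct. -/
theorem IsUniversalFamily.existsUnique_comul (he : IsOrthonormalFor φ e)
    (hα : IsUniversalFamily φ s α) :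
    ∃! Δ : B →⋆ₐ[ℂ] SpatialTensor B B, IsCompactQuantumGroup Δ ∧ IsAction Δ α := by
  obtain ⟨Δ, hΔ, huniq⟩ := hα.existsUnique _ _ (hα.isSymmetryFamily.selfComp he)
  have hact : IsAction Δ α := isAction_iff.2 ⟨hα.isSymmetryFamily.invertible, hΔ⟩
  have := hα.nontrivial
  refine ⟨Δ, ⟨(hα.coefficientsGenerate he).isCompactQuantumGroup
    ((coeffMatrix_mem_unitary_iff he).2 ⟨hα.isSymmetryFamily.invertible,
      hα.isSymmetryFamily.preserves⟩) hact, hact⟩, fun Δ' h' => huniq Δ' (isAction_iff.1 h'.2).2⟩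

end QuantumGroup

/-! ### Final objects -/

section Final

open CategoryTheory CategoryTheory.Limits

variable {A : Type u} [CStarAlgebra A]

/-- Final objects of `QAUT` are universal symmetric families for the convolution structure. -/
theorem QAUT.isUniversalFamily [FiniteQuantumGroup A] {X : QAUT.{u, v} A} (hX : IsTerminal X) :
    IsUniversalFamily (haarState A) (convData A) X.map where
  isSymmetryFamily := isAutomorphismFamily_iff.1 X.isAutomorphismFamily
  existsUnique B' _ α' hα' := by
    let Y : QAUT.{u, v} A := ⟨B', α', isAutomorphismFamily_iff.2 hα'⟩
    refine ⟨(hX.from Y).hom, StarAlgHom.ext fun a => ?_, fun Λ hΛ => ?_⟩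
    · rw [StarAlgHom.comp_apply, idTensor_eq_lTensor]
      exact (hX.from Y).comm a
    · let f : Y ⟶ X := QAUT.Hom.mk (X := Y) (Y := X) Λ fun a => by
        rw [← idTensor_eq_lTensor]
        exact DFunLike.congr_fun hΛ a
      exact congrArg QAUT.Hom.hom (hX.hom_ext f (hX.from Y))

theorem QAUT.exists_isTerminal (A : Type u) [CStarAlgebra A] [FiniteQuantumGroup A] :
    ∃ X : QAUT.{u, v} A, Nonempty (IsTerminal X) := by
  obtain ⟨n, e, he⟩ := (FiniteQuantumGroup.isHaarState_haarState A).isFaithfulPositive.exists_orthonormal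
  have hα := UniversalFamily.isUniversalFamily_map.{u, v} he (convData A)
  let X : QAUT.{u, v} A := ⟨_, UniversalFamily.map.{u, v} he (convData A),
    isAutomorphismFamily_iff.2 hα.isSymmetryFamily⟩
  have h := fun Y : QAUT.{u, v} A =>
    hα.existsUnique _ _ (isAutomorphismFamily_iff.1 Y.isAutomorphismFamily)
  refine ⟨X, ⟨IsTerminal.ofUniqueHom (fun Y => QAUT.Hom.mk (X := Y) (Y := X) (h Y).choose
    fun a => ?_) fun Y f => QAUT.Hom.ext ?_⟩⟩
  · rw [← idTensor_eq_lTensor]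
    exact DFunLike.congr_fun (h Y).choose_spec.1 a
  · refine (h Y).unique (StarAlgHom.ext fun a => ?_) (h Y).choose_spec.1
    rw [StarAlgHom.comp_apply, idTensor_eq_lTensor]
    exact f.comm a

/-- The universal family without additional structure is Wang's quantum automorphism group. -/
theorem PreservingAction.exists_isTerminal {φ : A →ₗ[ℂ] ℂ} {n : ℕ} {e : Module.Basis (Fin n) ℂ A}
    (he : IsOrthonormalFor φ e) :
    ∃ W : PreservingAction.{u, v} A φ, Nonempty (IsTerminal W) := by
  have hα := UniversalFamily.isUniversalFamily_map.{u, v} he ⟨0, 0, 0⟩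
  have hgen := UniversalFamily.coefficientsGenerate_map.{u, v} he ⟨0, 0, 0⟩
  obtain ⟨Δ, ⟨hΔ, hact⟩, -⟩ := hα.existsUnique_comul he
  let W : PreservingAction.{u, v} A φ := ⟨_, Δ, hΔ, _, hact, hα.isSymmetryFamily.preserves⟩
  have h := fun Y : PreservingAction.{u, v} A φ =>
    hα.existsUnique _ _ (isSymmetryFamily_zero_iff.2 ⟨Y.isAction.invertible, Y.preserves⟩)
  refine ⟨W, ⟨IsTerminal.ofUniqueHom (fun Y => PreservingAction.Hom.mk (X := Y) (Y := W)
    (h Y).choose (fun b => ?_) fun a => ?_) fun Y f => PreservingAction.Hom.ext ?_⟩⟩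
  · have hΛ : ∀ i j, (h Y).choose (coeffMatrix e W.map i j) = coeffMatrix e Y.map i j :=
      fun i j => by
        refine Eq.trans ?_ (congrArg (coeffMatrix e · i j) (h Y).choose_spec.1)
        rw [coeffMatrix_idTensor]
        rfl
    have key : (SpatialTensor.map (h Y).choose (h Y).choose).comp Δ =
        Y.comul.comp (h Y).choose := by
      refine hgen.hom_ext fun i j => ?_
      change SpatialTensor.map _ _ (Δ (coeffMatrix e W.map i j)) =
        Y.comul ((h Y).choose (coeffMatrix e W.map i j))
      rw [W.isAction.apply_coeffMatrix e, hΛ, Y.isAction.apply_coeffMatrix e, map_sum]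
      simp only [SpatialTensor.map_tmul, hΛ]
    exact DFunLike.congr_fun key b
  · rw [← idTensor_eq_lTensor]
    exact DFunLike.congr_fun (h Y).choose_spec.1 a
  · refine (h Y).unique (StarAlgHom.ext fun a => ?_) (h Y).choose_spec.1
    rw [StarAlgHom.comp_apply, idTensor_eq_lTensor]
    exact f.comm a

/-- A star-homomorphism that maps a family to one with generating coefficients is surjective. -/
theorem CoefficientsGenerate.surjective {B B' : Type v} [CStarAlgebra B] [CStarAlgebra B'] {n : ℕ}
    {e : Module.Basis (Fin n) ℂ A} {α : A →⋆ₐ[ℂ] A ⊗[ℂ] B} {α' : A →⋆ₐ[ℂ] A ⊗[ℂ] B'}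
    (hα' : CoefficientsGenerate e α') (π : B →⋆ₐ[ℂ] B') (h : (idTensor A π).comp α = α') :
    Function.Surjective π := by
  intro x
  refine hα' π.toAlgHom.range π.isClosed_range (fun i j => ⟨coeffMatrix e α i j, ?_⟩) x
  rw [← h, coeffMatrix_idTensor]
  rfl

end Final

theorem mainTheorem1 (A : Type u) [CStarAlgebra A] [FiniteQuantumGroup A] :
    -- `QAUT` has a final object, and it is unique up to isomorphism
    (∃ X : QAUT.{u, v} A, Nonempty (CategoryTheory.Limits.IsTerminal X)) ∧
    (∀ X Y : QAUT.{u, v} A, Nonempty (CategoryTheory.Limits.IsTerminal X) →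
      Nonempty (CategoryTheory.Limits.IsTerminal Y) → Nonempty (CategoryTheory.Iso X Y)) ∧
    -- the final object carries a unique compact quantum group structure acting through `α_u`
    (∀ X : QAUT.{u, v} A, Nonempty (CategoryTheory.Limits.IsTerminal X) →
      ∃! Δ : X.carrier →⋆ₐ[ℂ] SpatialTensor X.carrier X.carrier,
        IsCompactQuantumGroup Δ ∧ IsAction Δ X.map) ∧
    -- Wang's quantum automorphism group of `(A, h)` exists, and contains the one above as a
    -- quantum subgroup
    (∃ W : PreservingAction.{u, v} A (haarState A), IsWangQuantumAutomorphismGroup W) ∧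
    (∀ X : QAUT.{u, v} A, Nonempty (CategoryTheory.Limits.IsTerminal X) →
      ∀ Δ : X.carrier →⋆ₐ[ℂ] SpatialTensor X.carrier X.carrier,
        IsCompactQuantumGroup Δ → IsAction Δ X.map →
        ∀ W : PreservingAction.{u, v} A (haarState A), IsWangQuantumAutomorphismGroup W →
          ∃ π : W.carrier →⋆ₐ[ℂ] X.carrier, Function.Surjective π ∧
            (∀ b, SpatialTensor.map π π (W.comul b) = Δ (π b)) ∧
            ∀ a : A, π.toAlgHom.toLinearMap.lTensor A (W.map a) = X.map a) := by
  obtain ⟨n, e, he⟩ := (FiniteQuantumGroup.isHaarState_haarState A).isFaithfulPositive.exists_orthonormal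
  refine ⟨QAUT.exists_isTerminal A, fun X Y ⟨hX⟩ ⟨hY⟩ => ⟨hX.uniqueUpToIso hY⟩,
    fun X ⟨hX⟩ => (QAUT.isUniversalFamily hX).existsUnique_comul he,
    PreservingAction.exists_isTerminal he, ?_⟩
  rintro X ⟨hX⟩ Δ hΔ hact W ⟨hW⟩
  have hα := QAUT.isUniversalFamily hX
  let Y : PreservingAction.{u, v} A (haarState A) :=
    ⟨X.carrier, Δ, hΔ, X.map, hact, hα.isSymmetryFamily.preserves⟩
  let f : PreservingAction.Hom Y W := hW.from Y
  refine ⟨f.hom, ?_, f.comul_comm, f.comm⟩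
  refine (hα.coefficientsGenerate he).surjective (α := W.map) f.hom (StarAlgHom.ext fun a => ?_)
  rw [StarAlgHom.comp_apply, idTensor_eq_lTensor]
  exact f.comm a

end
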